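/- **Setting.** Units belong to groups $G\in\{1,\dots,N_G+1\}$, $N_G\ge 1$; group $1$ is treated, only in the last of the periods $1,\dots,\mathcal T$, where $\mathcal T\ge\max(2,N_G)$; the other groups are never treated. With potential outcomes $Y_t(0),Y_t(1)$ and $\mathcal G_g=\mathbf 1\{G=g\}$, the observed outcomes are $Y_t=\mathcal G_1Y_t(1)+(1-\mathcal G_1)Y_t(0)$, with $\mathbb E[Y_t^2]<\infty$; $X$ is a real covariate with law $F_X$, density $f_X$ and compact support $\mathcal X$. There is no anticipation: $Y_t(1)=Y_t(0)$ for $t<\mathcal T$. One observes i.i.d. copies $S_1,S_2,\dots$ of $S=(Y_1,\dots,Y_{\mathcal T},G,X)$. The parameter is $\theta=\mathbb E[Y_{\mathcal T}(1)-Y_{\mathcal T}(0)\mid G=1]$. Put $\Delta Y=Y_{\mathcal T}-Y_{\mathcal T-1}$, $\pi_1=\mathbb P(G=1)$, $p_g(x)=\mathbb P(G=g\mid X=x)$, $r_{1,g}=p_1/p_g$, $m_{g,t}(x)=\mathbb E[Y_t\mid G=g,X=x]$, $m_{g,\Delta}=m_{g,\mathcal T}-m_{g,\mathcal T-1}$,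 $m_\Delta(x)=\mathbb E[\Delta Y\mid G\ne1,X=x]$. Assume overlap, $p_g(X)>0$ a.s. for all $g$, and the synthetic control assumption: there are weight functions $w=(w_2,\dots,w_{N_G+1})$ with $\sum_{g\ge2}w_g=1$ such that, for $F_X$-almost every $x$ and $t=1,\dots,\mathcal T$, $$\mathbb E[Y_t(0)\mid G=1,X=x]=\sum_{g=2}^{N_G+1}w_g(x)\,\mathbb E[Y_t(0)\mid G=g,X=x].$$ For functions $m_{g,t}$ let $M(x)$ be the $(\mathcal T-1)\times(N_G-1)$ matrix with entries $m_{g,t}(x)-m_{N_G+1,t}(x)$ ($1\le t\le\mathcal T-1$, $2\le g\le N_G$), and $m_1(x)$ the vector with entries $m_{1,t}(x)-m_{N_G+1,t}(x)$. **Estimator.** Let $L\ge2$ be fixed and $n=Lk$; split $\{1,\dots,n\}$ into $L$ folds $I_\ell$ of size $k$. From the data outside $I_\ell$ compute (all estimators being jointly measurable in data and $x$), with kernel $K$, bandwidth $h=h_n>0$ and a fixed order $\bar s$, the local polynomial estimators: $\hat r^\ell_{1,g}(x)$ ($g\ge 2$) and $\hat m^\ell_{g,t}(x)$ are the intercepts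 $\beta_0$ of minimizers over $\beta\in\mathbb R^{\bar s+1}$ of the averages over $i\notin I_\ell$ of $$K\big(\tfrac{X_i-x}h\big)\big(b_i^2\,\mathcal G_{gi}-2b_i\,\mathcal G_{1i}\big)\quad\text{and}\quad K\big(\tfrac{X_i-x}h\big)(Y_{ti}-b_i)^2\,\mathcal G_{gi},\qquad b_i=\sum_{s=0}^{\bar s}\beta_s(X_i-x)^s,$$ respectively (arbitrary where no minimizer exists). Let $(\hat w_2^\ell,\dots,\hat w_{N_G}^\ell)'=(\hat M'\hat M)^{-1}\hat M'\hat m_1$ be computed from the $\hat m^\ell_{g,t}$ (the inverse of a singular matrix being read as $0$) and $\hat w^\ell_{N_G+1}=1-\sum_{g=2}^{N_G}\hat w^\ell_g$; let $\hat m^\ell_\Delta$ be any estimator of $m_\Delta$ from the data outside $I_\ell$. With $\hat\pi_1=n^{-1}\sum_i\mathcal G_{1i}$ and $$\phi(S;m_\Delta,r,w;\pi)=\frac{\mathcal G_1}{\pi}(\Delta Y-m_\Delta(X))-\frac1\pi\sum_{g=2}^{N_G+1}w_g(X)\,r_{1,g}(X)\,\mathcal G_g\,(\Delta Y-m_\Delta(X)),$$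 put $\hat\theta=n^{-1}\sum_{\ell}\sum_{i\in I_\ell}\phi(S_i;\hat m_\Delta^\ell,\hat r^\ell,\hat w^\ell;\hat\pi_1)$. **Conditions** (for all $\ell$; $\|\cdot\|_2$ and $\|\cdot\|_1$ are the norms of $L_2(F_X)$ and $L_1(F_X)$; asymptotics as $n=Lk\to\infty$). 1. $\mathbb E[(\Delta Y-m_\Delta(X))^2\mid X,G=g]$ and $1/p_g(X)$, for all $g\geq 1$, and $w_g(X)$, for $g\ge 2$, are a.s. bounded. 2. $\sup_{x\in\mathcal X}|\hat w^\ell_g(x)|=O_p(1)$, $\|\hat m^\ell_\Delta-m_\Delta\|_2=o_p(1)$ and $\|\hat r^\ell_{1,g}-r_{1,g}\|_2\,\|\hat m^\ell_\Delta-m_\Delta\|_2=o_p(n^{-1/2})$ for $g\ge2$. 3. $\|\hat m^\ell_{g,t}-m_{g,t}\|_2$ (all $g,t$), $\|\hat r^\ell_{1,g}-r_{1,g}\|_2$ and $\|\hat w^\ell_g-w_g\|_2$ ($g\ge2$) are $o_p(n^{-1/4})$. 4. $h=o(n^{-1/4})$; $K$ is a symmetric probability density with $\int u^2K(u)\,du<\infty$.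 With $K_h=K(\cdot/h)/h$ and $P_n^{\ell}$ the average over the observations $i\notin I_\ell$, $$\hat r^\ell_{1,g}(x)-r_{1,g}(x)=P^\ell_n\Big[\frac{K_h(X-x)}{f_X(x)}\,\frac{\mathcal G_1-r_{1,g}(X)\mathcal G_g}{p_g(X)}\Big]+R^\ell_{g}(x),\quad g\ge 2,$$ $$\hat m^\ell_{g,t}(x)-m_{g,t}(x)=P^\ell_n\Big[\frac{K_h(X-x)}{f_X(x)}\,\frac{\mathcal G_g(Y_t-m_{g,t}(X))}{p_g(X)}\Big]+R^\ell_{g,t}(x),\quad g\ge1,\ 1\le t\le\mathcal T-1,$$ with $\|R^\ell_g\|_1=o_p(n^{-1/2})$ and $\|R^\ell_{g,t}\|_1=o_p(n^{-1/2})$ (in particular, remainders that are $o_p(n^{-1/2})$ uniformly over $x\in\mathcal X$ are allowed). 5. $w_g,m_{g,t},p_g$ are twice continuously differentiable on $\mathcal X$, and for some $c>0$ the smallest eigenvalue of $M(x)'M(x)$ exceeds $c$ for all $x\in\mathcal X$. **Influence function.** Let $\varepsilon_{g,t}=\mathcal G_g(Y_t-m_{g,t}(X))/p_g(X)$; let $A(S)$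 be the $(\mathcal T-1)\times(N_G-1)$ matrix with entries $\varepsilon_{g,t}-\varepsilon_{N_G+1,t}$ ($2\le g\le N_G$), $a_1(S)$ the vector with entries $\varepsilon_{1,t}-\varepsilon_{N_G+1,t}$ ($1\le t\le\mathcal T-1$), and, with $M=M(X)$, $m_1=m_1(X)$, $A=A(S)$, $$P(S)=(M'M)^{-1}M'a_1(S)+(M'M)^{-1}A'm_1-(M'M)^{-1}[A'M+M'A](M'M)^{-1}M'm_1 .$$ Let $u(x)=p_1(x)\,(m_{g,\Delta}(x)-m_\Delta(x))_{2\le g\le N_G+1}$ and $\psi_{\mathrm{SC}}=\psi_{\mathrm{PT}}+\psi_1+\psi_2$, where $$\psi_{\mathrm{PT}}=\phi(S;m_\Delta,r,w;\pi_1)-\frac{\theta\,\mathcal G_1}{\pi_1},\qquad \psi_1=-\frac1{\pi_1}\sum_{g=2}^{N_G+1}w_g(X)\big(\mathcal G_1-r_{1,g}(X)\mathcal G_g\big)\big(m_{g,\Delta}(X)-m_\Delta(X)\big),$$ $$\psi_2=-\frac1{\pi_1}\,u(X)'\begin{bmatrix}P(S)\\-\mathbf 1'P(S)\end{bmatrix}.$$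 **Theorem.** If $V_{\mathrm{SC}}=\mathbb E[\psi_{\mathrm{SC}}(S)^2]$ is finite, then $\sqrt n(\hat\theta-\theta)\overset d\to N(0,V_{\mathrm{SC}})$ as $n=Lk\to\infty$. -/

import Mathlib

open MeasureTheory ProbabilityTheory Filter Topology Matrix
open scoped ENNReal

noncomputable section

namespace SyntheticDiD

/-! Conventions. There are `N + 2` groups: group `0` is the treated group and the `N + 1` control
groups are `g.succ` for `g : Fin (N + 1)`.  There are `T + 2` periods: the treatment takes place in
the final period `Fin.last (T + 1)`, and the `T + 1` earlier periods are `t.castSucc` for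
`t : Fin (T + 1)`. -/

/-- The final (post-treatment) period. -/
def post (T : ℕ) : Fin (T + 2) := Fin.last (T + 1)

/-- The last pre-treatment period. -/
def pre (T : ℕ) : Fin (T + 2) := (Fin.last T).castSucc

/-- What is observed on one unit: the outcomes in all periods, the group and the covariate. -/
abbrev Obs (N T : ℕ) : Type := (Fin (T + 2) → ℝ) × Fin (N + 2) × ℝ

variable {N T : ℕ}

/-- The outcome of a unit in period `t`. -/
def Obs.y (o : Obs N T) (t : Fin (T + 2)) : ℝ := o.1 t

/-- The covariate of a unit. -/
def Obs.x (o : Obs N T) : ℝ := o.2.2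

/-- The indicator that a unit belongs to group `g`. -/
def Obs.ind (o : Obs N T) (g : Fin (N + 2)) : ℝ := if o.2.1 = g then 1 else 0

/-- The change of the outcome between the last two periods. -/
def Obs.dy (o : Obs N T) : ℝ := o.y (post T) - o.y (pre T)

/-! ### The population -/

section Population

variable {Ω : Type*}

/-- The observed outcome: treated units show `Y1`, all the others show `Y0`. -/
def observedY (Y0 Y1 : Fin (T + 2) → Ω → ℝ) (G : Ω → Fin (N + 2)) (t : Fin (T + 2)) (ω : Ω) : ℝ :=
  (if G ω = 0 then 1 else 0) * Y1 t ω + (1 - if G ω = 0 then 1 else 0) * Y0 t ω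

/-- The observed vector of a unit. -/
def observation (Y0 Y1 : Fin (T + 2) → Ω → ℝ) (G : Ω → Fin (N + 2)) (X : Ω → ℝ) (ω : Ω) :
    Obs N T :=
  (fun t => observedY Y0 Y1 G t ω, G ω, X ω)

variable [MeasurableSpace Ω]

/-- `f` is (a version of) the regression function `x ↦ E_ν[Z | X = x]`. -/
def IsRegression (ν : Measure Ω) (X Z : Ω → ℝ) (f : ℝ → ℝ) : Prop :=
  Measurable f ∧ Integrable Z ν ∧
    (fun ω => f (X ω)) =ᵐ[ν] ν[Z | MeasurableSpace.comap X inferInstance]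

/-- The law of a unit given that its group is `g`. -/
def givenGroup (P : Measure Ω) (G : Ω → Fin (N + 2)) (g : Fin (N + 2)) : Measure Ω :=
  P[|G ⁻¹' {g}]

/-- The law of a unit given that it belongs to some control group. -/
def givenControl (P : Measure Ω) (G : Ω → Fin (N + 2)) : Measure Ω :=
  P[|G ⁻¹' {0}ᶜ]

/-- The average effect of the treatment on the treated in the final period. -/
def att (P : Measure Ω) (Y0 Y1 : Fin (T + 2) → Ω → ℝ) (G : Ω → Fin (N + 2)) : ℝ :=
  ∫ ω, (Y1 (post T) ω - Y0 (post T) ω) ∂(givenGroup P G 0)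

/-- The synthetic control assumption for the weight functions `w`: they sum to one, and, in every
period, the conditional mean of the untreated potential outcome in the treated group is the
`w`-weighted combination of those in the control groups, at almost every covariate value. -/
def SyntheticControl (P : Measure Ω) (Y0 : Fin (T + 2) → Ω → ℝ) (G : Ω → Fin (N + 2)) (X : Ω → ℝ)
    (w : Fin (N + 1) → ℝ → ℝ) : Prop :=
  ∃ m0 : Fin (N + 2) → Fin (T + 2) → ℝ → ℝ,
    (∀ g t, IsRegression (givenGroup P G g) X (Y0 t) (m0 g t)) ∧
    ∀ᵐ x ∂(P.map X), ∑ g, w g x = 1 ∧ ∀ t, m0 0 t x = ∑ g, w g x * m0 g.succ t x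

end Population

/-! ### Synthetic control weights from the outcome regressions -/

/-- The matrix `M(x)` with entries `m_{g,t}(x) - m_{last,t}(x)`: rows are the pre-treatment periods,
columns the control groups except the last. -/
def weightMatrix (m : Fin (N + 2) → Fin (T + 2) → ℝ → ℝ) (x : ℝ) :
    Matrix (Fin (T + 1)) (Fin N) ℝ :=
  Matrix.of fun t j => m j.castSucc.succ t.castSucc x - m (Fin.last (N + 1)) t.castSucc x

/-- The vector `m₁(x)` with entries `m_{treated,t}(x) - m_{last,t}(x)`. -/
def weightVector (m : Fin (N + 2) → Fin (T + 2) → ℝ → ℝ) (x : ℝ) : Fin (T + 1) → ℝ :=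
  fun t => m 0 t.castSucc x - m (Fin.last (N + 1)) t.castSucc x

/-- The least-squares weights `(M'M)⁻¹ M' m₁` of the control groups except the last, completed
by the weight of the last control group so that the sum is one. -/
def leastSquaresWeights (m : Fin (N + 2) → Fin (T + 2) → ℝ → ℝ) (g : Fin (N + 1)) (x : ℝ) : ℝ :=
  let M := weightMatrix m x
  let v : Fin N → ℝ := (Mᵀ * M)⁻¹ *ᵥ (Mᵀ *ᵥ weightVector m x)
  Fin.snoc (α := fun _ => ℝ) v (1 - ∑ j, v j) g

/-! ### The moment function and the influence function -/

/-- The moment function `φ`, with the propensity scores entering through the ratios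
`r g = p_treated / p_g`, and with `π` in place of the probability of the treated group. -/
def phi (mΔ : ℝ → ℝ) (r w : Fin (N + 1) → ℝ → ℝ) (π : ℝ) (o : Obs N T) : ℝ :=
  o.ind 0 / π * (o.dy - mΔ o.x)
    - 1 / π * ∑ g : Fin (N + 1), w g o.x * r g o.x * o.ind g.succ * (o.dy - mΔ o.x)

/-- The population nuisance functions: propensity scores `p`, outcome regressions `m`, the
regression `mΔ` of the outcome change among all controls, and the weights `w`. -/
structure Nuisance (N T : ℕ) where
  p : Fin (N + 2) → ℝ → ℝ
  m : Fin (N + 2) → Fin (T + 2) → ℝ → ℝ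
  mΔ : ℝ → ℝ
  w : Fin (N + 1) → ℝ → ℝ

namespace Nuisance

variable (q : Nuisance N T)

/-- The propensity score ratio `p_treated / p_g` for a control group `g`. -/
def r (g : Fin (N + 1)) (x : ℝ) : ℝ := q.p 0 x / q.p g.succ x

/-- `m_{g,Δ}(x) = E[ΔY | G = g, X = x]`. -/
def mDelta (g : Fin (N + 2)) (x : ℝ) : ℝ := q.m g (post T) x - q.m g (pre T) x

/-- The part of the influence function in which the nuisance functions are known. -/
def psiPT (π θ : ℝ) (o : Obs N T) : ℝ := phi q.mΔ q.r q.w π o - θ * o.ind 0 / π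

/-- The adjustment for the estimation of the ratios `r`. -/
def psi1 (π : ℝ) (o : Obs N T) : ℝ :=
  -(1 / π) * ∑ g : Fin (N + 1),
    q.w g o.x * (o.ind 0 - q.r g o.x * o.ind g.succ) * (q.mDelta g.succ o.x - q.mΔ o.x)

/-- The inverse-probability-weighted residual of the outcome of group `g` in period `t`. -/
def residual (o : Obs N T) (g : Fin (N + 2)) (t : Fin (T + 2)) : ℝ :=
  o.ind g * (o.y t - q.m g t o.x) / q.p g o.x

/-- The matrix `A(S)`. -/
def matA (o : Obs N T) : Matrix (Fin (T + 1)) (Fin N) ℝ :=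
  Matrix.of fun t j =>
    q.residual o j.castSucc.succ t.castSucc - q.residual o (Fin.last (N + 1)) t.castSucc

/-- The vector `a₁(S)`. -/
def vecA (o : Obs N T) : Fin (T + 1) → ℝ :=
  fun t => q.residual o 0 t.castSucc - q.residual o (Fin.last (N + 1)) t.castSucc

/-- The vector `P(S) = P₁(S) + P₂(S) + P₃(S)`. -/
def vecP (o : Obs N T) : Fin N → ℝ :=
  let M := weightMatrix q.m o.x
  let m₁ := weightVector q.m o.x
  let A := q.matA o
  (Mᵀ * M)⁻¹ *ᵥ (Mᵀ *ᵥ q.vecA o)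
    + (Mᵀ * M)⁻¹ *ᵥ (Aᵀ *ᵥ m₁)
    + -((Mᵀ * M)⁻¹ *ᵥ ((Aᵀ * M + Mᵀ * A) *ᵥ ((Mᵀ * M)⁻¹ *ᵥ (Mᵀ *ᵥ m₁))))

/-- The vector `u(x)`. -/
def vecU (x : ℝ) : Fin (N + 1) → ℝ := fun g => q.p 0 x * (q.mDelta g.succ x - q.mΔ x)

/-- The adjustment for the estimation of the weights `w`. -/
def psi2 (π : ℝ) (o : Obs N T) : ℝ :=
  -(1 / π) * (q.vecU o.x ⬝ᵥ Fin.snoc (α := fun _ => ℝ) (q.vecP o) (-∑ j, q.vecP o j))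

/-- The influence function under the synthetic control assumption. -/
def psiSC (π θ : ℝ) (o : Obs N T) : ℝ := q.psiPT π θ o + q.psi1 π o + q.psi2 π o

end Nuisance

/-! ### Estimation -/

section Estimation

variable {ι : Type*} [Fintype ι]

/-- The empirical average of `f` over a finite sample `s`. -/
def average (s : ι → Obs N T) (f : Obs N T → ℝ) : ℝ := (Fintype.card ι : ℝ)⁻¹ * ∑ i, f (s i)

/-- The polynomial `∑ₛ βₛ (z - x)ˢ`. -/
def localPoly {d : ℕ} (β : Fin (d + 1) → ℝ) (x z : ℝ) : ℝ := ∑ j, β j * (z - x) ^ (j : ℕ)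

/-- The local polynomial criterion for the ratio of control group `g` at the point `x`. -/
def ratioLoss (K : ℝ → ℝ) (h : ℝ) (d : ℕ) (g : Fin (N + 1)) (s : ι → Obs N T) (x : ℝ)
    (β : Fin (d + 1) → ℝ) : ℝ :=
  average s fun o => K ((o.x - x) / h) *
    (localPoly β x o.x ^ 2 * o.ind g.succ - 2 * localPoly β x o.x * o.ind 0)

/-- The local polynomial criterion for the outcome regression of group `g` in period `t`. -/
def outcomeLoss (K : ℝ → ℝ) (h : ℝ) (d : ℕ) (g : Fin (N + 2)) (t : Fin (T + 2))
    (s : ι → Obs N T) (x : ℝ) (β : Fin (d + 1) → ℝ) : ℝ :=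
  average s fun o => K ((o.x - x) / h) * (o.y t - localPoly β x o.x) ^ 2 * o.ind g

/-- `f` estimates by the intercept of a minimizer of the criterion, at every sample and every point
at which the criterion has a minimizer (elsewhere `f` is unrestricted). -/
def IsInterceptOfArgmin {d : ℕ} (loss : (ι → Obs N T) → ℝ → (Fin (d + 1) → ℝ) → ℝ)
    (f : (ι → Obs N T) → ℝ → ℝ) : Prop :=
  ∀ s x, (∃ β, ∀ β', loss s x β ≤ loss s x β') →
    ∃ β, (∀ β', loss s x β ≤ loss s x β') ∧ f s x = β 0

/-- Estimators of the ratios, of the outcome regressions and of `mΔ`, from a sample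
indexed by `ι`. -/
structure Estimators (ι : Type*) (N T : ℕ) where
  r : Fin (N + 1) → (ι → Obs N T) → ℝ → ℝ
  m : Fin (N + 2) → Fin (T + 2) → (ι → Obs N T) → ℝ → ℝ
  mΔ : (ι → Obs N T) → ℝ → ℝ

namespace Estimators

/-- The plug-in estimator of the weights. -/
def w (e : Estimators ι N T) (g : Fin (N + 1)) (s : ι → Obs N T) (x : ℝ) : ℝ :=
  leastSquaresWeights (fun g t => e.m g t s) g x

/-- The estimators are jointly measurable in the sample and the covariate value. -/
def IsMeasurable (e : Estimators ι N T) : Prop :=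
  (∀ g, Measurable (Function.uncurry (e.r g))) ∧
  (∀ g t, Measurable (Function.uncurry (e.m g t))) ∧
  Measurable (Function.uncurry e.mΔ)

/-- The ratios and the outcome regressions are estimated by local polynomial regressions of order
`d` with kernel `K` and bandwidth `h`. -/
def IsLocalPolynomial (e : Estimators ι N T) (K : ℝ → ℝ) (h : ℝ) (d : ℕ) : Prop :=
  (∀ g, IsInterceptOfArgmin (ratioLoss K h d g) (e.r g)) ∧
  (∀ g t, IsInterceptOfArgmin (outcomeLoss K h d g t) (e.m g t))

end Estimators

/-- The leading term of the Bahadur representation of the ratio estimator at `x`. -/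
def ratioBahadur (q : Nuisance N T) (fX K : ℝ → ℝ) (h : ℝ) (g : Fin (N + 1)) (s : ι → Obs N T)
    (x : ℝ) : ℝ :=
  average s fun o =>
    K ((o.x - x) / h) / h / fX x * ((o.ind 0 - q.r g o.x * o.ind g.succ) / q.p g.succ o.x)

/-- The leading term of the Bahadur representation of the outcome regression estimator at `x`. -/
def outcomeBahadur (q : Nuisance N T) (fX K : ℝ → ℝ) (h : ℝ) (g : Fin (N + 2)) (t : Fin (T + 2))
    (s : ι → Obs N T) (x : ℝ) : ℝ :=
  average s fun o => K ((o.x - x) / h) / h / fX x * (o.ind g * (o.y t - q.m g t o.x) / q.p g o.x)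

end Estimation

/-! ### Cross-fitting -/

section CrossFitting

/-- The indices outside fold `ℓ`. -/
abbrev Train {n L : ℕ} (fold : Fin n → Fin L) (ℓ : Fin L) : Type := {i : Fin n // fold i ≠ ℓ}

/-- The subsample outside fold `ℓ`. -/
def train {n L : ℕ} (fold : Fin n → Fin L) (ℓ : Fin L) (s : ℕ → Obs N T) :
    Train fold ℓ → Obs N T := fun i => s i.1

/-- The sample share of the treated group. -/
def piHat (n : ℕ) (s : ℕ → Obs N T) : ℝ := (∑ i : Fin n, (s i).ind 0) / n

/-- The cross-fitted estimator: a unit is evaluated at the nuisance estimates that are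
computed without its fold. -/
def thetaHat {n L : ℕ} (fold : Fin n → Fin L) (e : ∀ ℓ, Estimators (Train fold ℓ) N T)
    (s : ℕ → Obs N T) : ℝ :=
  1 / (n : ℝ) * ∑ ℓ : Fin L, ∑ i : Fin n with fold i = ℓ,
    phi ((e ℓ).mΔ (train fold ℓ s)) (fun g => (e ℓ).r g (train fold ℓ s))
      (fun g => (e ℓ).w g (train fold ℓ s)) (piHat n s) (s i)

end CrossFitting

/-! ### Stochastic orders -/

section StochasticOrder

variable {Ω : Type*} [MeasurableSpace Ω]

/-- `Z k = o_p(a k)`, for nonnegative random quantities `Z k`. -/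
def IsLittleOp (P : Measure Ω) (Z : ℕ → Ω → ℝ≥0∞) (a : ℕ → ℝ) : Prop :=
  ∀ ε : ℝ, 0 < ε → Tendsto (fun k => P {ω | ENNReal.ofReal (ε * a k) < Z k ω}) atTop (𝓝 0)

/-- `sup_{x ∈ A} |F k ω x| = O_p(1)`. -/
def SupIsBigOpOne (P : Measure Ω) (F : ℕ → Ω → ℝ → ℝ) (A : Set ℝ) : Prop :=
  ∀ ε : ℝ, 0 < ε → ∃ C : ℝ, ∀ᶠ k in atTop, P {ω | ∃ x ∈ A, C < |F k ω x|} ≤ ENNReal.ofReal ε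

end StochasticOrder

end SyntheticDiD

end

/-! The treated share enters `phi` as a scalar factor, so the problem is to expand the root-n sum of
φ(S_i; m̂_Δ, r̂, ŵ; 1). The exact identity `phi_sub_phi` separates a cubic term ŵ (r̂ − r)(m̂_Δ −
m_Δ) from terms that are a function of X, fitted without the fold, times a fixed factor of the
observation. Given the training data the observations of the fold are i.i.d. The cubic term is then
small by Markov's inequality and the product rate, and the other terms, once centred at their
conditional means, are small by Chebyshev's inequality and consistency (`negligible_fold_sum`,
`negligible_centered_fold_sum`). What remains is the conditional mean.

In that mean the contribution of m̂_Δ cancels identically, because r_g p_g = p_1 and the estimated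
weights sum to one. Up to products of two errors there remain a linear functional of r̂ − r with
coefficient w_g p_g (m_{g,Δ} − m_Δ), and u'(ŵ − w) (`Population.enorm_mean_expansion_le`). No
anticipation and the synthetic control assumption give the exact fit M w = m_1. Hence the population
least-squares residual vanishes and the derivative of the weights is (M'M)⁻¹M'(δm_1 − δM w); the
remainder is quadratic even where the estimated Gram matrix is singular (`abs_leastSquares_sub_le`).
The same identity collapses the three summands of P(S) into this derivative at the residuals
(`Nuisance.RegularAt.psi2_eq`). The quadratic terms vanish at the root-n scale by the n^(-1/4) rates
and the boundedness of ŵ.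

A functional ∫ c (m̂ − m) dF is treated by inserting the Bahadur representation: the density
cancels, and ∫ c(x) K_h(X_i − x) dx is a smoothing of c at X_i. The residual it multiplies has
conditional mean zero given X, so replacing the smoothing by c(X_i) costs a centred average whose
variance vanishes as h → 0; there is no smoothing bias (`negligible_integral_sub_average`). Thus the
conditional mean is minus the training average of `Nuisance.adjustment`. Each observation lies in
all training samples but one, so over the folds these averages add up to the full sample average
(`sum_average_train`).

The estimator is therefore asymptotically linear with influence function ψ_SC. It is centred since
the moment function identifies the effect (`integral_phi_eq_att`), and the central limit theorem,
the law of large numbers for the treated share and Slutsky's theorem conclude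
(`tendstoInDistribution_thetaHat`). -/

namespace SyntheticDiD

/-! ### Stochastic orders in outer probability, with values in [0, ∞]. -/

section StochasticOrder

variable {Ω : Type*} [MeasurableSpace Ω] {P : Measure Ω} {Z Z' : ℕ → Ω → ℝ≥0∞}

/-- `Z k` tends to zero in (outer) probability. -/
def Negligible (P : Measure Ω) (Z : ℕ → Ω → ℝ≥0∞) : Prop :=
  ∀ ε : ℝ≥0∞, ε ≠ 0 → Tendsto (fun k => P {ω | ε ≤ Z k ω}) atTop (𝓝 0)

/-- `Z k` is bounded in (outer) probability. -/
def BoundedInProb (P : Measure Ω) (Z : ℕ → Ω → ℝ≥0∞) : Prop :=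
  ∀ ε : ℝ≥0∞, ε ≠ 0 → ∃ C : ℝ≥0∞, C ≠ ∞ ∧ ∀ᶠ k in atTop, P {ω | C < Z k ω} ≤ ε

lemma Negligible.mono_ae (hZ : Negligible P Z) (h : ∀ᶠ k in atTop, ∀ᵐ ω ∂P, Z' k ω ≤ Z k ω) :
    Negligible P Z' := fun ε hε =>
  tendsto_of_tendsto_of_tendsto_of_le_of_le' tendsto_const_nhds (hZ ε hε)
    (Eventually.of_forall fun _ => zero_le) (h.mono fun k hk => measure_mono_ae <|
      hk.mono fun ω hω (h1 : ε ≤ Z' k ω) => h1.trans hω)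

lemma Negligible.mono (hZ : Negligible P Z) (h : ∀ k ω, Z' k ω ≤ Z k ω) : Negligible P Z' :=
  hZ.mono_ae (Eventually.of_forall fun k => Eventually.of_forall (h k))

lemma negligible_zero : Negligible P fun _ _ => 0 := fun ε hε => by
  simp [hε]

lemma Negligible.add (hZ : Negligible P Z) (hZ' : Negligible P Z') :
    Negligible P fun k ω => Z k ω + Z' k ω := by
  intro ε hε
  have h2 : ε / 2 ≠ 0 := by simpa using hε
  have h := (hZ _ h2).add (hZ' _ h2)
  rw [add_zero] at h
  refine tendsto_of_tendsto_of_tendsto_of_le_of_le tendsto_const_nhds h (fun _ => zero_le)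
    fun k => (measure_mono ?_).trans (measure_union_le _ _)
  intro ω (hω : ε ≤ Z k ω + Z' k ω)
  by_contra hcon
  simp only [Set.mem_union, Set.mem_ofPred_eq, not_or, not_le] at hcon
  have h3 := ENNReal.add_lt_add hcon.1 hcon.2
  rw [ENNReal.add_halves] at h3
  exact absurd hω (not_le.2 h3)

lemma negligible_sum {ι : Type*} (s : Finset ι) {Z : ι → ℕ → Ω → ℝ≥0∞}
    (hZ : ∀ i ∈ s, Negligible P (Z i)) : Negligible P fun k ω => ∑ i ∈ s, Z i k ω := by
  classical
  induction s using Finset.induction_on with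
  | empty => simpa using negligible_zero
  | insert a s ha ih =>
    simp only [Finset.sum_insert ha]
    exact (hZ a (by simp)).add (ih fun i hi => hZ i (by simp [hi]))

/-- Off an event of small probability `Z'` is at most a finite constant, and a constant times a
negligible quantity is negligible. -/
lemma BoundedInProb.mul_negligible (hZ' : BoundedInProb P Z') (hZ : Negligible P Z) :
    Negligible P fun k ω => Z' k ω * Z k ω := by
  intro ε hε
  rw [ENNReal.tendsto_nhds_zero]
  intro η hη
  have h2 : η / 2 ≠ 0 := by simpa using hη.ne'
  obtain ⟨C, hC, hCk⟩ := hZ' _ h2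
  -- Dividing by `C + 1` instead of `C` keeps the divisor nonzero.
  have h3 : min ε 1 / (C + 1) ≠ 0 := by
    refine (ENNReal.div_pos (by simp [hε]) (by simp [hC])).ne'
  have h4 := ENNReal.tendsto_nhds_zero.1 (hZ _ h3) (η / 2) (pos_iff_ne_zero.2 h2)
  filter_upwards [hCk, h4] with k hk1 hk2
  rw [← ENNReal.add_halves η]
  refine le_trans ((measure_mono ?_).trans (measure_union_le _ _)) (add_le_add hk1 hk2)
  intro ω (hω : ε ≤ Z' k ω * Z k ω)
  by_contra hcon
  simp only [Set.mem_union, Set.mem_ofPred_eq, not_or, not_le, not_lt] at hcon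
  have h5 : Z' k ω * Z k ω < ε := by
    have hC1 : C + 1 ≠ ∞ := by simp [hC]
    have hC0 : C + 1 ≠ 0 := by simp
    calc Z' k ω * Z k ω ≤ (C + 1) * Z k ω := by
          gcongr; exact hcon.1.trans le_self_add
      _ < (C + 1) * (min ε 1 / (C + 1)) := by
          gcongr
          exact hcon.2
      _ = min ε 1 := ENNReal.mul_div_cancel hC0 hC1
      _ ≤ ε := min_le_left _ _
  exact absurd hω (not_le.2 h5)

lemma Negligible.boundedInProb (hZ : Negligible P Z) : BoundedInProb P Z := fun ε hε =>
  ⟨1, by simp, ((ENNReal.tendsto_nhds_zero.1 (hZ 1 (by simp)) ε (pos_iff_ne_zero.2 hε)).mono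
    fun k hk => (measure_mono fun ω (hω : 1 < Z k ω) => hω.le).trans hk)⟩

lemma BoundedInProb.mono_ae (hZ : BoundedInProb P Z)
    (h : ∀ᶠ k in atTop, ∀ᵐ ω ∂P, Z' k ω ≤ Z k ω) : BoundedInProb P Z' := fun ε hε => by
  obtain ⟨C, hC, hk⟩ := hZ ε hε
  refine ⟨C, hC, ?_⟩
  filter_upwards [h, hk] with k h1 h2
  exact (measure_mono_ae <| h1.mono fun ω hω (h3 : C < Z' k ω) => h3.trans_le hω).trans h2

lemma boundedInProb_const (c : ℝ≥0∞) (hc : c ≠ ∞) : BoundedInProb P fun _ _ => c := fun ε _ =>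
  ⟨c, hc, by simp⟩

lemma BoundedInProb.add (hZ : BoundedInProb P Z) (hZ' : BoundedInProb P Z') :
    BoundedInProb P fun k ω => Z k ω + Z' k ω := by
  intro ε hε
  have h2 : ε / 2 ≠ 0 := by simpa using hε
  obtain ⟨C, hC, hk⟩ := hZ _ h2
  obtain ⟨C', hC', hk'⟩ := hZ' _ h2
  refine ⟨C + C', by simp [hC, hC'], ?_⟩
  filter_upwards [hk, hk'] with k h3 h4
  rw [← ENNReal.add_halves ε]
  refine le_trans ((measure_mono ?_).trans (measure_union_le _ _)) (add_le_add h3 h4)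
  intro ω (hω : C + C' < Z k ω + Z' k ω)
  by_contra hcon
  simp only [Set.mem_union, Set.mem_ofPred_eq, not_or, not_lt] at hcon
  exact absurd hω (not_lt.2 (add_le_add hcon.1 hcon.2))

lemma BoundedInProb.sum {ι : Type*} (s : Finset ι) {Z : ι → ℕ → Ω → ℝ≥0∞}
    (hZ : ∀ i ∈ s, BoundedInProb P (Z i)) : BoundedInProb P fun k ω => ∑ i ∈ s, Z i k ω := by
  classical
  induction s using Finset.induction_on with
  | empty => simpa using boundedInProb_const 0 (by simp)
  | insert a s ha ih =>
    simp only [Finset.sum_insert ha]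
    exact (hZ a (by simp)).add (ih fun i hi => hZ i (by simp [hi]))

lemma Negligible.const_mul (hZ : Negligible P Z) {c : ℝ≥0∞} (hc : c ≠ ∞) :
    Negligible P fun k ω => c * Z k ω := (boundedInProb_const c hc).mul_negligible hZ

lemma Negligible.of_tendsto {a : ℕ → ℝ≥0∞} (ha : Tendsto a atTop (𝓝 0)) :
    Negligible P fun k _ => a k := fun ε hε => by
  refine tendsto_const_nhds.congr' ?_
  filter_upwards [ha.eventually_lt_const (pos_iff_ne_zero.2 hε)] with k hk
  simp [not_le.2 hk]

/-- Passes from the rates of the theorem to normalized quantities. Positivity is asked for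
eventually only, because a negative power of the sample size is `0` at `k = 0`. -/
lemma IsLittleOp.negligible {a : ℕ → ℝ} (h : IsLittleOp P Z a) (ha : ∀ᶠ k in atTop, 0 < a k) :
    Negligible P fun k ω => ENNReal.ofReal (a k)⁻¹ * Z k ω := by
  intro ε hε
  -- A real level strictly below `ε` reconciles the strict real thresholds of `IsLittleOp` with the
  -- weak, possibly infinite, ones of `Negligible`.
  obtain ⟨r, hr, hrε⟩ := ENNReal.lt_iff_exists_nnreal_btwn.1 (pos_iff_ne_zero.2 hε)
  have hr0 : (0 : ℝ) < r := by exact_mod_cast hr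
  refine tendsto_of_tendsto_of_tendsto_of_le_of_le' tendsto_const_nhds (h r hr0)
    (Eventually.of_forall fun _ => zero_le) (ha.mono fun k hk => measure_mono ?_)
  intro ω (hω : ε ≤ _)
  change ENNReal.ofReal (r * a k) < Z k ω
  by_contra hcon
  rw [not_lt] at hcon
  have : ENNReal.ofReal (a k)⁻¹ * Z k ω ≤ r := by
    calc _ ≤ ENNReal.ofReal (a k)⁻¹ * ENNReal.ofReal (r * a k) := by gcongr
      _ = ENNReal.ofReal r := by
        rw [← ENNReal.ofReal_mul (by positivity)]
        congr 1
        field_simp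
      _ = r := ENNReal.ofReal_coe_nnreal
  exact absurd (hω.trans this) (not_le.2 hrε)

/-- The bridge to the notion of convergence used by Slutsky's theorem. -/
lemma negligible_iff_tendstoInMeasure {f : ℕ → Ω → ℝ} :
    Negligible P (fun k ω => ‖f k ω‖ₑ) ↔ TendstoInMeasure P f atTop 0 := by
  simp only [Negligible, TendstoInMeasure, Pi.zero_apply, edist_zero_right, pos_iff_ne_zero]

/-- A uniform bound in probability on a set of full measure bounds the essential supremum. -/
lemma SupIsBigOpOne.boundedInProb {F : ℕ → Ω → ℝ → ℝ} {A : Set ℝ} (h : SupIsBigOpOne P F A)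
    (μ : Measure ℝ) (hA : μ Aᶜ = 0) :
    BoundedInProb P fun k ω => eLpNorm (F k ω) ∞ μ := by
  intro ε hε
  obtain ⟨r, hr, hrε⟩ := ENNReal.lt_iff_exists_nnreal_btwn.1 (pos_iff_ne_zero.2 hε)
  obtain ⟨C, hC⟩ := h r (by exact_mod_cast hr)
  refine ⟨ENNReal.ofReal C, by simp, hC.mono fun k hk => (measure_mono ?_).trans
    (hk.trans (by simpa using hrε.le))⟩
  intro ω (hω : ENNReal.ofReal C < eLpNorm (F k ω) ∞ μ)
  by_contra hcon
  simp only [Set.mem_ofPred_eq, not_exists, not_and, not_lt] at hcon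
  refine absurd hω (not_lt.2 ?_)
  rw [eLpNorm_exponent_top]
  refine eLpNormEssSup_le_of_ae_bound ?_
  filter_upwards [show ∀ᵐ x ∂μ, x ∈ A from hA] with x hx
  exact hcon x hx

end StochasticOrder

/-! ### Markov and Chebyshev inequalities conditional on independent data. -/

section Conditional

variable {Ω α β ι : Type*} [MeasurableSpace Ω] [MeasurableSpace α] [MeasurableSpace β]
  {P : Measure Ω} [IsProbabilityMeasure P] {Q : Measure β} [IsProbabilityMeasure Q]

/-- Markov's inequality conditional on `τ`, for a sum of nonnegative terms. -/
lemma measure_sum_ge_le_of_lintegral {τ : Ω → α} {V : ι → Ω → β} (s : Finset ι)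
    (hτ : Measurable τ) (hV : ∀ i, Measurable (V i))
    (hlaw : ∀ i ∈ s, P.map (fun ω => (τ ω, V i ω)) = (P.map τ).prod Q)
    {f : α → β → ℝ≥0∞} (hf : Measurable (Function.uncurry f)) (c δ ε : ℝ≥0∞)
    (hε : ε ≠ 0) (hε' : ε ≠ ∞) :
    P {ω | ε ≤ c * ∑ i ∈ s, f (τ ω) (V i ω)}
      ≤ P {ω | δ < ∫⁻ o, f (τ ω) o ∂Q} + c * s.card * δ / ε := by
  have hI : Measurable fun a => ∫⁻ o, f a o ∂Q := hf.lintegral_prod_right'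
  -- Conditioning is replaced by truncation: `f` is set to zero where its mean under `Q` exceeds
  -- `δ`. Since the joint law is a product, Fubini bounds the mean of the truncated function by `δ`,
  -- and truncation matters only on the first event of the bound.
  set E : Set α := {a | ∫⁻ o, f a o ∂Q ≤ δ} with hEdef
  have hE : MeasurableSet E := measurableSet_le hI measurable_const
  let g : α × β → ℝ≥0∞ := (E ×ˢ Set.univ).indicator (Function.uncurry f)
  have hg : Measurable g := hf.indicator (hE.prod .univ)
  have hgi : ∀ i ∈ s, ∫⁻ ω, g (τ ω, V i ω) ∂P ≤ δ := by
    intro i hi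
    have : IsProbabilityMeasure (P.map τ) := Measure.isProbabilityMeasure_map hτ.aemeasurable
    rw [← lintegral_map hg (hτ.prodMk (hV i)), hlaw i hi, lintegral_prod _ hg.aemeasurable]
    calc _ ≤ ∫⁻ _, δ ∂(P.map τ) := by
          refine lintegral_mono fun a => ?_
          by_cases ha : a ∈ E
          · have ha' : ∫⁻ o, f a o ∂Q ≤ δ := ha
            simpa [g, ha] using ha'
          · simp [g, ha]
      _ = δ := by simp
  have hsub : {ω | ε ≤ c * ∑ i ∈ s, f (τ ω) (V i ω)} ⊆
      {ω | δ < ∫⁻ o, f (τ ω) o ∂Q} ∪ {ω | ε ≤ c * ∑ i ∈ s, g (τ ω, V i ω)} := by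
    intro ω hω
    by_cases hE' : τ ω ∈ E
    · right
      simpa [g, hE'] using hω
    · left
      simpa [E] using hE'
  refine (measure_mono hsub).trans ((measure_union_le _ _).trans (add_le_add le_rfl ?_))
  have hm : Measurable fun ω => c * ∑ i ∈ s, g (τ ω, V i ω) :=
    (Finset.measurable_sum _ fun i _ => hg.comp (hτ.prodMk (hV i))).const_mul c
  refine (meas_ge_le_lintegral_div hm.aemeasurable hε hε').trans ?_
  gcongr
  have hmi : ∀ i, Measurable fun ω => g (τ ω, V i ω) := fun i => hg.comp (hτ.prodMk (hV i))
  rw [lintegral_const_mul _ (Finset.measurable_sum _ fun i _ => hmi i),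
    lintegral_finsetSum _ fun i _ => hmi i, mul_assoc]
  gcongr
  calc _ ≤ ∑ i ∈ s, δ := Finset.sum_le_sum hgi
    _ = _ := by simp

/-- Chebyshev's inequality conditional on `τ`, for a conditionally centred sum. -/
lemma measure_centered_sum_ge_le {τ : Ω → α} {V : ι → Ω → β} (s : Finset ι)
    (hτ : Measurable τ) (hV : ∀ i, Measurable (V i))
    (hlaw : ∀ i ∈ s, P.map (fun ω => (τ ω, V i ω)) = (P.map τ).prod Q)
    (hlaw2 : ∀ i ∈ s, ∀ j ∈ s, i ≠ j →
      P.map (fun ω => (τ ω, V i ω, V j ω)) = (P.map τ).prod (Q.prod Q))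
    {f : α → β → ℝ} (hf : Measurable (Function.uncurry f)) (c δ ε : ℝ≥0∞)
    (hδ : δ ≠ ∞) (hε : ε ≠ 0) (hε' : ε ≠ ∞) :
    P {ω | ε ≤ c * ‖∑ i ∈ s, (f (τ ω) (V i ω) - ∫ o, f (τ ω) o ∂Q)‖ₑ}
      ≤ P {ω | δ < ∫⁻ o, ‖f (τ ω) o‖ₑ ^ 2 ∂Q} + c ^ 2 * (s.card * δ) / ε ^ 2 := by
  have : IsProbabilityMeasure (P.map τ) := Measure.isProbabilityMeasure_map hτ.aemeasurable
  have hI : Measurable fun a => ∫⁻ o, ‖f a o‖ₑ ^ 2 ∂Q :=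
    (hf.enorm.pow_const 2).lintegral_prod_right'
  -- The same truncation by the second moment. As `δ` is finite, `f a` is square-integrable for `a`
  -- in `E`, so the centring there is by a genuine mean.
  set E : Set α := {a | ∫⁻ o, ‖f a o‖ₑ ^ 2 ∂Q ≤ δ} with hEdef
  have hE : MeasurableSet E := measurableSet_le hI measurable_const
  have hfa : ∀ a, Measurable (f a) := fun a => hf.comp measurable_prodMk_left
  have hf2 : ∀ a ∈ E, MemLp (f a) 2 Q := by
    intro a ha
    refine ⟨(hfa a).aestronglyMeasurable, ?_⟩
    rw [eLpNorm_lt_top_iff_lintegral_rpow_enorm_lt_top (by simp) (by simp)]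
    refine lt_of_le_of_lt ?_ (lt_of_le_of_lt ha hδ.lt_top)
    simp
  have hmean : Measurable fun a => ∫ o, f a o ∂Q :=
    (hf.stronglyMeasurable.integral_prod_right').measurable
  let g : α × β → ℝ :=
    (E ×ˢ Set.univ).indicator fun z => f z.1 z.2 - ∫ o, f z.1 o ∂Q
  have hg : Measurable g :=
    (hf.sub (hmean.comp measurable_fst)).indicator (hE.prod .univ)
  have hg0 : ∀ a, ∫ o, g (a, o) ∂Q = 0 := by
    intro a
    by_cases ha : a ∈ E
    · have hi : Integrable (f a) Q := (hf2 a ha).integrable (by norm_num)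
      simp only [g, Set.indicator, Set.mem_prod, ha, Set.mem_univ, and_self, if_true]
      rw [integral_sub hi (integrable_const _)]
      simp
    · simp [g, ha]
  have hgsq : ∀ a, ∫⁻ o, ‖g (a, o)‖ₑ ^ 2 ∂Q ≤ δ := by
    intro a
    by_cases ha : a ∈ E
    · have h1 : ∫⁻ o, ‖g (a, o)‖ₑ ^ 2 ∂Q = evariance (f a) Q := by
        simp [g, ha, evariance]
      have hv : evariance (f a) Q ≤ ∫⁻ o, ‖f a o‖ₑ ^ 2 ∂Q := by
        rw [← (hf2 a ha).ofReal_variance_eq]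
        calc _ ≤ ENNReal.ofReal (∫ o, f a o ^ 2 ∂Q) :=
              ENNReal.ofReal_le_ofReal (variance_le_expectation_sq (hfa a).aestronglyMeasurable)
          _ = _ := by
            rw [ofReal_integral_eq_lintegral_ofReal (hf2 a ha).integrable_sq
              (Eventually.of_forall fun _ => sq_nonneg _)]
            refine lintegral_congr fun o => ?_
            rw [← enorm_pow, Real.enorm_eq_ofReal (sq_nonneg _)]
      rw [h1]
      exact hv.trans ha
    · simp [g, ha]
  have hgi : ∀ i ∈ s, ∫⁻ ω, ‖g (τ ω, V i ω)‖ₑ ^ 2 ∂P ≤ δ := by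
    intro i hi
    rw [← lintegral_map (hg.enorm.pow_const 2) (hτ.prodMk (hV i)), hlaw i hi,
      lintegral_prod _ (hg.enorm.pow_const 2).aemeasurable]
    calc _ ≤ ∫⁻ _, δ ∂(P.map τ) := lintegral_mono fun a => hgsq a
      _ = δ := by simp
  have hgL : ∀ i ∈ s, MemLp (fun ω => g (τ ω, V i ω)) 2 P := by
    intro i hi
    refine ⟨(hg.comp (hτ.prodMk (hV i))).aestronglyMeasurable, ?_⟩
    rw [eLpNorm_lt_top_iff_lintegral_rpow_enorm_lt_top (by simp) (by simp)]
    refine lt_of_le_of_lt ?_ (lt_of_le_of_lt (hgi i hi) hδ.lt_top)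
    simp
  -- Under the product law of `τ` and two observations the inner integral factors into two centred
  -- ones.
  have hcross : ∀ i ∈ s, ∀ j ∈ s, i ≠ j →
      ∫ ω, g (τ ω, V i ω) * g (τ ω, V j ω) ∂P = 0 := by
    intro i hi j hj hij
    have hm3 : Measurable fun z : α × β × β => g (z.1, z.2.1) * g (z.1, z.2.2) :=
      (hg.comp (by fun_prop)).mul (hg.comp (by fun_prop))
    have hint : Integrable (fun ω => g (τ ω, V i ω) * g (τ ω, V j ω)) P :=
      (hgL i hi).integrable_mul (hgL j hj)
    have hmap : Measurable fun ω => (τ ω, V i ω, V j ω) := hτ.prodMk ((hV i).prodMk (hV j))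
    have hint' : Integrable (fun z : α × β × β => g (z.1, z.2.1) * g (z.1, z.2.2))
        ((P.map τ).prod (Q.prod Q)) := by
      rw [← hlaw2 i hi j hj hij]
      exact (integrable_map_measure hm3.aestronglyMeasurable hmap.aemeasurable).2 hint
    have : ∫ ω, g (τ ω, V i ω) * g (τ ω, V j ω) ∂P =
        ∫ z : α × β × β, g (z.1, z.2.1) * g (z.1, z.2.2)
          ∂(P.map fun ω => (τ ω, V i ω, V j ω)) :=
      (integral_map hmap.aemeasurable hm3.aestronglyMeasurable).symm
    rw [this, hlaw2 i hi j hj hij, integral_prod _ hint']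
    refine integral_eq_zero_of_ae (Eventually.of_forall fun a => ?_)
    exact (integral_prod_mul (μ := Q) (ν := Q) (fun o => g (a, o)) fun o => g (a, o)).trans
      (by simp [hg0])
  have hsum : ∫⁻ ω, ‖∑ i ∈ s, g (τ ω, V i ω)‖ₑ ^ 2 ∂P ≤ s.card * δ := by
    have hL : MemLp (fun ω => ∑ i ∈ s, g (τ ω, V i ω)) 2 P := memLp_finsetSum _ hgL
    have key : ∫ ω, (∑ i ∈ s, g (τ ω, V i ω)) ^ 2 ∂P = ∑ i ∈ s, ∫ ω, g (τ ω, V i ω) ^ 2 ∂P := by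
      have hij : ∀ i ∈ s, ∀ j ∈ s, Integrable (fun ω => g (τ ω, V i ω) * g (τ ω, V j ω)) P :=
        fun i hi j hj => (hgL i hi).integrable_mul (hgL j hj)
      simp_rw [sq, Finset.sum_mul_sum]
      rw [integral_finsetSum _ fun i hi => integrable_finsetSum _ fun j hj => hij i hi j hj]
      refine Finset.sum_congr rfl fun i hi => ?_
      rw [integral_finsetSum _ fun j hj => hij i hi j hj]
      rw [Finset.sum_eq_single_of_mem i hi fun j hj hji => hcross i hi j hj hji.symm]
    have e1 : ∀ u : Ω → ℝ, MemLp u 2 P →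
        ∫⁻ ω, ‖u ω‖ₑ ^ 2 ∂P = ENNReal.ofReal (∫ ω, u ω ^ 2 ∂P) := fun u hu => by
      rw [ofReal_integral_eq_lintegral_ofReal hu.integrable_sq
        (Eventually.of_forall fun _ => sq_nonneg _)]
      refine lintegral_congr fun o => ?_
      rw [← enorm_pow, Real.enorm_eq_ofReal (sq_nonneg _)]
    rw [e1 _ hL, key, ENNReal.ofReal_sum_of_nonneg fun i _ => integral_nonneg fun _ => sq_nonneg _]
    calc _ ≤ ∑ i ∈ s, δ := Finset.sum_le_sum fun i hi => by
          rw [← e1 _ (hgL i hi)]; exact hgi i hi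
      _ = _ := by simp
  have hsub : {ω | ε ≤ c * ‖∑ i ∈ s, (f (τ ω) (V i ω) - ∫ o, f (τ ω) o ∂Q)‖ₑ} ⊆
      {ω | δ < ∫⁻ o, ‖f (τ ω) o‖ₑ ^ 2 ∂Q} ∪
        {ω | ε ^ 2 ≤ c ^ 2 * ‖∑ i ∈ s, g (τ ω, V i ω)‖ₑ ^ 2} := by
    intro ω hω
    by_cases hE' : τ ω ∈ E
    · right
      simp only [Set.mem_ofPred_eq] at hω ⊢
      rw [← mul_pow]
      simp only [g, Set.indicator, Set.mem_prod, hE', Set.mem_univ, and_self, if_true]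
      gcongr
    · left
      simpa [E] using hE'
  refine (measure_mono hsub).trans ((measure_union_le _ _).trans (add_le_add le_rfl ?_))
  have hm : Measurable fun ω => ‖∑ i ∈ s, g (τ ω, V i ω)‖ₑ ^ 2 :=
    (Finset.measurable_sum _ fun i _ => hg.comp (hτ.prodMk (hV i))).enorm.pow_const 2
  refine (meas_ge_le_lintegral_div (hm.const_mul _).aemeasurable (by simp [hε])
    (by simp [hε'])).trans ?_
  gcongr
  rw [lintegral_const_mul _ hm]
  gcongr

/-- Averages of nonnegative functions of an independent observation and of `τ` are negligible if
their conditional means are. -/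
lemma negligible_sum_of_lintegral {α ι : ℕ → Type*} [∀ k, MeasurableSpace (α k)]
    {τ : ∀ k, Ω → α k} {V : ∀ k, ι k → Ω → β} (s : ∀ k, Finset (ι k))
    (hτ : ∀ k, Measurable (τ k)) (hV : ∀ k i, Measurable (V k i))
    (hlaw : ∀ k, ∀ i ∈ s k, P.map (fun ω => (τ k ω, V k i ω)) = (P.map (τ k)).prod Q)
    {f : ∀ k, α k → β → ℝ≥0∞} (hf : ∀ k, Measurable (Function.uncurry (f k)))
    {c a : ℕ → ℝ≥0∞} (hca : ∀ k, c k * (s k).card ≤ a k)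
    (ha : ∀ᶠ k in atTop, a k ≠ 0 ∧ a k ≠ ∞)
    (hneg : Negligible P fun k ω => a k * ∫⁻ o, f k (τ k ω) o ∂Q) :
    Negligible P fun k ω => c k * ∑ i ∈ s k, f k (τ k ω) (V k i ω) := by
  have key : ∀ ε : ℝ≥0∞, ε ≠ 0 → ε ≠ ∞ → Tendsto
      (fun k => P {ω | ε ≤ c k * ∑ i ∈ s k, f k (τ k ω) (V k i ω)}) atTop (𝓝 0) := by
    intro ε hε hε'
    rw [ENNReal.tendsto_nhds_zero]
    intro η hη
    obtain ⟨δ, hδ0, hδ⟩ : ∃ δ : ℝ≥0∞, δ ≠ 0 ∧ δ / ε ≤ η / 2 := by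
      refine ⟨η / 2 * ε, by simp [hε, hη.ne'], ?_⟩
      rw [ENNReal.mul_div_cancel_right hε hε']
    have h2 : η / 2 ≠ 0 := by simpa using hη.ne'
    filter_upwards [ENNReal.tendsto_nhds_zero.1 (hneg δ hδ0) (η / 2) (pos_iff_ne_zero.2 h2), ha]
      with k hk hak
    refine (measure_sum_ge_le_of_lintegral (s k) (hτ k) (hV k) (hlaw k) (hf k) (c k)
      (δ / a k) ε hε hε').trans ?_
    rw [← ENNReal.add_halves η]
    refine add_le_add (le_trans (measure_mono fun ω hω => ?_) hk) (le_trans ?_ hδ)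
    · simp only [Set.mem_ofPred_eq] at hω ⊢
      have := (ENNReal.div_lt_iff (Or.inl hak.1) (Or.inl hak.2)).1 hω
      rw [mul_comm]
      exact this.le
    · gcongr
      calc c k * (s k).card * (δ / a k) ≤ a k * (δ / a k) := by gcongr; exact hca k
        _ = δ := ENNReal.mul_div_cancel hak.1 hak.2
  -- Markov's inequality divides by `ε`, so the level `∞` is reduced to the finite level `min ε 1`.
  intro ε hε
  refine tendsto_of_tendsto_of_tendsto_of_le_of_le tendsto_const_nhds
    (key (min ε 1) (by simp [hε]) (by simp)) (fun _ => zero_le)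
    fun k => measure_mono fun ω (hω : ε ≤ _) => (min_le_left ε 1).trans hω

/-- Conditionally centred averages of functions of an independent observation and of `τ` are
negligible at the root-`n` scale if their conditional second moments are negligible. -/
lemma negligible_centered_sum {α ι : ℕ → Type*} [∀ k, MeasurableSpace (α k)]
    {τ : ∀ k, Ω → α k} {V : ∀ k, ι k → Ω → β} (s : ∀ k, Finset (ι k))
    (hτ : ∀ k, Measurable (τ k)) (hV : ∀ k i, Measurable (V k i))
    (hlaw : ∀ k, ∀ i ∈ s k, P.map (fun ω => (τ k ω, V k i ω)) = (P.map (τ k)).prod Q)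
    (hlaw2 : ∀ k, ∀ i ∈ s k, ∀ j ∈ s k, i ≠ j →
      P.map (fun ω => (τ k ω, V k i ω, V k j ω)) = (P.map (τ k)).prod (Q.prod Q))
    {f : ∀ k, α k → β → ℝ} (hf : ∀ k, Measurable (Function.uncurry (f k)))
    {c : ℕ → ℝ≥0∞} (hc : ∀ k, c k ^ 2 * (s k).card ≤ 1)
    (hneg : Negligible P fun k ω => ∫⁻ o, ‖f k (τ k ω) o‖ₑ ^ 2 ∂Q) :
    Negligible P fun k ω =>
      c k * ‖∑ i ∈ s k, (f k (τ k ω) (V k i ω) - ∫ o, f k (τ k ω) o ∂Q)‖ₑ := by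
  have key : ∀ ε : ℝ≥0∞, ε ≠ 0 → ε ≠ ∞ → Tendsto
      (fun k => P {ω | ε ≤
        c k * ‖∑ i ∈ s k, (f k (τ k ω) (V k i ω) - ∫ o, f k (τ k ω) o ∂Q)‖ₑ}) atTop (𝓝 0) := by
    intro ε hε hε'
    rw [ENNReal.tendsto_nhds_zero]
    intro η hη
    have he2 : ε ^ 2 ≠ 0 := by simp [hε]
    have he2' : ε ^ 2 ≠ ∞ := by simp [hε']
    obtain ⟨δ, hδ0, hδt, hδ⟩ : ∃ δ : ℝ≥0∞, δ ≠ 0 ∧ δ ≠ ∞ ∧ δ / ε ^ 2 ≤ η / 2 := by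
      -- The minimum with `1` keeps `δ` finite when `η` is infinite.
      refine ⟨min (η / 2) 1 * ε ^ 2, by simp [hε, hη.ne'],
        ENNReal.mul_ne_top (by simp) he2', ?_⟩
      rw [ENNReal.mul_div_cancel_right he2 he2']
      exact min_le_left _ _
    have h2 : η / 2 ≠ 0 := by simpa using hη.ne'
    filter_upwards [ENNReal.tendsto_nhds_zero.1 (hneg δ hδ0) (η / 2) (pos_iff_ne_zero.2 h2)]
      with k hk
    refine (measure_centered_sum_ge_le (s k) (hτ k) (hV k) (hlaw k) (hlaw2 k) (hf k) (c k)
      δ ε hδt hε hε').trans ?_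
    rw [← ENNReal.add_halves η]
    refine add_le_add (le_trans (measure_mono fun ω hω => ?_) hk) (le_trans ?_ hδ)
    · simp only [Set.mem_ofPred_eq] at hω ⊢
      exact hω.le
    · gcongr
      rw [← mul_assoc]
      calc _ ≤ 1 * δ := by gcongr; exact hc k
        _ = δ := one_mul _
  intro ε hε
  refine tendsto_of_tendsto_of_tendsto_of_le_of_le tendsto_const_nhds
    (key (min ε 1) (by simp [hε]) (by simp)) (fun _ => zero_le)
    fun k => measure_mono fun ω (hω : ε ≤ _) => (min_le_left ε 1).trans hω

end Conditional

end SyntheticDiD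

namespace SyntheticDiD

/-! ### Kernel smoothing of a bounded integrable function. -/

section Smoothing

/-- The smoothing of `c` at `y` by the kernel `K` with bandwidth `h`. -/
noncomputable def smooth (K c : ℝ → ℝ) (h y : ℝ) : ℝ := ∫ x, c x * (K ((y - x) / h) / h)

variable {K c : ℝ → ℝ} {h C : ℝ}

/-- Substitution of `x = y - h u`; in this form the smoothing is an average of translates of `c`. -/
lemma smooth_eq (hh : 0 < h) (y : ℝ) : smooth K c h y = ∫ u, c (y - h * u) * K u := by
  have h1 := integral_sub_left_eq_self (fun x => c x * (K ((y - x) / h) / h)) volume y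
  have h2 := Measure.integral_comp_mul_left
    (fun x => c (y - x) * (K ((y - (y - x)) / h) / h)) h
  rw [smooth, ← h1]
  simp only [sub_sub_cancel] at h2 ⊢
  rw [abs_of_pos (inv_pos.2 hh), smul_eq_mul] at h2
  have h3 : ∀ x, c (y - h * x) * (K (h * x / h) / h) = h⁻¹ * (c (y - h * x) * K x) := by
    intro x
    rw [mul_div_cancel_left₀ _ hh.ne']
    ring
  simp only [h3, integral_const_mul] at h2
  exact (mul_left_cancel₀ (inv_ne_zero hh.ne') h2).symm

lemma measurable_smooth (hK : Measurable K) (hc : Measurable c) :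
    Measurable (smooth K c h) := by
  have : Measurable (Function.uncurry fun y x => c x * (K ((y - x) / h) / h)) := by
    refine (hc.comp measurable_snd).mul ((hK.comp ?_).div_const _)
    exact (measurable_fst.sub measurable_snd).div_const _
  exact this.stronglyMeasurable.integral_prod_right'.measurable

lemma abs_smooth_le (hh : 0 < h) (hK : Integrable K) (hK0 : ∀ u, 0 ≤ K u) (hK1 : ∫ u, K u = 1)
    (hcC : ∀ x, |c x| ≤ C) (y : ℝ) : |smooth K c h y| ≤ C := by
  rw [smooth_eq hh, ← Real.norm_eq_abs]
  calc ‖∫ u, c (y - h * u) * K u‖ ≤ ∫ u, C * K u := by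
        refine norm_integral_le_of_norm_le (hK.const_mul C) (Eventually.of_forall fun u => ?_)
        rw [norm_mul, Real.norm_eq_abs, Real.norm_eq_abs, abs_of_nonneg (hK0 u)]
        exact mul_le_mul_of_nonneg_right (hcC _) (hK0 u)
    _ = C := by rw [integral_const_mul, hK1, mul_one]

/-- Translation acts continuously on `L¹`, so no regularity of `c` beyond integrability enters. -/
lemma tendsto_lintegral_translate (hc : Integrable c) :
    Tendsto (fun z => ∫⁻ y, ‖c (y - z) - c y‖ₑ) (𝓝 0) (𝓝 0) := by
  have hc1 : MemLp c 1 volume := memLp_one_iff_integrable.2 hc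
  have : Fact ((1 : ℝ≥0∞) ≠ ∞) := ⟨by simp⟩
  have hcont : Continuous fun z : ℝ => edist (DomAddAct.mk (-z) +ᵥ hc1.toLp c) (hc1.toLp c) := by
    have : Continuous fun z : ℝ => DomAddAct.mk (-z) :=
      DomAddAct.continuous_mk.comp continuous_neg
    exact (this.vadd continuous_const).edist continuous_const
  have h0 := hcont.tendsto 0
  rw [neg_zero] at h0
  have hz : edist (DomAddAct.mk (0 : ℝ) +ᵥ hc1.toLp c) (hc1.toLp c) = 0 := by
    rw [DomAddAct.mk_vadd_toLp]
    simp
  rw [hz] at h0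
  refine h0.congr fun z => ?_
  rw [DomAddAct.mk_vadd_toLp, Lp.edist_toLp_toLp, eLpNorm_one_eq_lintegral_enorm]
  simp [sub_eq_neg_add, vadd_eq_add]

/-- Since `K` integrates to one, the smoothing error is a `K`-average of translation differences;
Tonelli's theorem exchanges the integrals. -/
lemma lintegral_smooth_sub_le (hh : 0 < h) (hKm : Measurable K) (hK : Integrable K)
    (hK1 : ∫ u, K u = 1) (hc : Measurable c) (hcC : ∀ x, |c x| ≤ C) :
    ∫⁻ y, ‖smooth K c h y - c y‖ₑ ≤ ∫⁻ u, ‖K u‖ₑ * ∫⁻ y, ‖c (y - h * u) - c y‖ₑ := by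
  have hm : Measurable (Function.uncurry fun y u => ‖(c (y - h * u) - c y) * K u‖ₑ) := by
    refine Measurable.enorm (Measurable.mul (Measurable.sub ?_ ?_) (hKm.comp measurable_snd))
    · exact hc.comp (by fun_prop)
    · exact hc.comp measurable_fst
  have h1 : ∀ y, ‖smooth K c h y - c y‖ₑ ≤ ∫⁻ u, ‖(c (y - h * u) - c y) * K u‖ₑ := by
    intro y
    have hi1 : Integrable fun u => c (y - h * u) * K u :=
      hK.bdd_mul (c := C) (hc.comp (by fun_prop)).aestronglyMeasurable
        (Eventually.of_forall fun u => hcC _)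
    have : smooth K c h y - c y = ∫ u, (c (y - h * u) - c y) * K u := by
      simp_rw [sub_mul]
      rw [integral_sub hi1 (hK.const_mul _), integral_const_mul, hK1, mul_one, smooth_eq hh]
    rw [this]
    exact enorm_integral_le_lintegral_enorm _
  calc _ ≤ ∫⁻ y, ∫⁻ u, ‖(c (y - h * u) - c y) * K u‖ₑ := lintegral_mono h1
    _ = ∫⁻ u, ∫⁻ y, ‖(c (y - h * u) - c y) * K u‖ₑ := lintegral_lintegral_swap hm.aemeasurable
    _ = _ := by
      refine lintegral_congr fun u => ?_
      rw [← lintegral_const_mul' _ _ enorm_ne_top]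
      refine lintegral_congr fun y => ?_
      rw [enorm_mul, mul_comm]

/-- Kernel smoothings with vanishing bandwidth converge in `L¹`. -/
lemma tendsto_lintegral_smooth (hKm : Measurable K) (hK : Integrable K)
    (hK1 : ∫ u, K u = 1) (hc : Measurable c) (hcC : ∀ x, |c x| ≤ C)
    (hci : Integrable c) {h : ℕ → ℝ} (hh : ∀ n, 0 < h n) (hh0 : Tendsto h atTop (𝓝 0)) :
    Tendsto (fun n => ∫⁻ y, ‖smooth K c (h n) y - c y‖ₑ) atTop (𝓝 0) := by
  refine tendsto_of_tendsto_of_tendsto_of_le_of_le tendsto_const_nhds ?_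
    (fun _ => zero_le) fun n => lintegral_smooth_sub_le (hh n) hKm hK hK1 hc hcC
  have hmeas : ∀ n, Measurable fun u => ‖K u‖ₑ * ∫⁻ y, ‖c (y - h n * u) - c y‖ₑ := by
    intro n
    have : Measurable (Function.uncurry fun u y => ‖c (y - h n * u) - c y‖ₑ) :=
      ((hc.comp (by fun_prop)).sub (hc.comp measurable_snd)).enorm
    exact hKm.enorm.mul this.lintegral_prod_right'
  have hb : ∀ z, ∫⁻ y, ‖c (y - z) - c y‖ₑ ≤ 2 * ∫⁻ y, ‖c y‖ₑ := by
    intro z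
    calc _ ≤ ∫⁻ y, (‖c (y - z)‖ₑ + ‖c y‖ₑ) := lintegral_mono fun y => enorm_sub_le
      _ = _ := by
        rw [lintegral_add_right _ hc.enorm, lintegral_sub_right_eq_self (fun y => ‖c y‖ₑ) z,
          two_mul]
  -- For fixed `u` the shift `h n * u` vanishes; twice the `L¹` norm of `c`, times `K`, dominates.
  have hlim := tendsto_lintegral_of_dominated_convergence (μ := volume) (F := fun n u =>
      ‖K u‖ₑ * ∫⁻ y, ‖c (y - h n * u) - c y‖ₑ) (f := fun _ => 0)
    (fun u => ‖K u‖ₑ * (2 * ∫⁻ y, ‖c y‖ₑ)) hmeas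
    (fun n => Eventually.of_forall fun u => by dsimp only; gcongr; exact hb _) ?_ ?_
  · simpa using hlim
  · rw [lintegral_mul_const _ hKm.enorm]
    exact ENNReal.mul_ne_top hK.2.ne (ENNReal.mul_ne_top (by simp) hci.2.ne)
  · refine Eventually.of_forall fun u => ?_
    have h1 : Tendsto (fun n => h n * u) atTop (𝓝 0) := by simpa using hh0.mul_const u
    have h2 := ENNReal.Tendsto.const_mul ((tendsto_lintegral_translate hci).comp h1)
      (Or.inr (enorm_ne_top (x := K u)))
    simpa using h2

/-- Kernel smoothings with vanishing bandwidth converge in mean square along any law that has a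
density, also after multiplication by a square-integrable variable. -/
lemma tendsto_lintegral_smooth_sq {β : Type*} [MeasurableSpace β] {Q : Measure β}
    {X ξ : β → ℝ} (hX : Measurable X) (hξm : Measurable ξ) (hξ : MemLp ξ 2 Q)
    (hac : Q.map X ≪ volume) (hKm : Measurable K) (hK : Integrable K)
    (hK0 : ∀ u, 0 ≤ K u) (hK1 : ∫ u, K u = 1) (hc : Measurable c) (hcC : ∀ x, |c x| ≤ C)
    (hci : Integrable c) {h : ℕ → ℝ} (hh : ∀ n, 0 < h n) (hh0 : Tendsto h atTop (𝓝 0)) :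
    Tendsto (fun n => ∫⁻ o, ‖(smooth K c (h n) (X o) - c (X o)) * ξ o‖ₑ ^ 2 ∂Q) atTop (𝓝 0) := by
  -- The density of the law of `X` may be unbounded, so Lebesgue `L¹` convergence does not bound the
  -- integral under `Q` directly. Instead a subsequence converges almost everywhere, this passes to
  -- `Q` by absolute continuity, and `(2C)² ξ²` dominates.
  refine tendsto_of_subseq_tendsto fun ns hns => ?_
  have h1 := (tendsto_lintegral_smooth hKm hK hK1 hc hcC hci hh hh0).comp hns
  have h2 : TendstoInMeasure volume (fun n => smooth K c (h (ns n))) atTop c := by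
    refine tendstoInMeasure_of_tendsto_eLpNorm (p := 1) (by simp)
      (fun n => (measurable_smooth hKm hc).aestronglyMeasurable) hc.aestronglyMeasurable ?_
    simpa only [eLpNorm_one_eq_lintegral_enorm, Function.comp_def, Pi.sub_apply] using h1
  obtain ⟨ms, -, hae⟩ := h2.exists_seq_tendsto_ae
  refine ⟨ms, ?_⟩
  have hae' : ∀ᵐ o ∂Q, Tendsto (fun n => smooth K c (h (ns (ms n))) (X o)) atTop (𝓝 (c (X o))) :=
    ae_of_ae_map hX.aemeasurable (hac.ae_le hae)
  have hC0 : 0 ≤ C := (abs_nonneg _).trans (hcC 0)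
  have hlim := tendsto_lintegral_of_dominated_convergence (μ := Q) (F := fun n o =>
      ‖(smooth K c (h (ns (ms n))) (X o) - c (X o)) * ξ o‖ₑ ^ 2) (f := fun _ => 0)
    (fun o => ENNReal.ofReal (2 * C) ^ 2 * ‖ξ o‖ₑ ^ 2) ?_ ?_ ?_ ?_
  · simpa using hlim
  · intro n
    exact ((((measurable_smooth hKm hc).comp hX).sub (hc.comp hX)).mul hξm).enorm.pow_const 2
  · intro n
    refine Eventually.of_forall fun o => ?_
    dsimp only
    rw [← mul_pow, enorm_mul]
    gcongr
    rw [Real.enorm_eq_ofReal_abs]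
    refine ENNReal.ofReal_le_ofReal ?_
    calc _ ≤ |smooth K c (h (ns (ms n))) (X o)| + |c (X o)| := abs_sub _ _
      _ ≤ C + C := add_le_add (abs_smooth_le (hh _) hK hK0 hK1 hcC _) (hcC _)
      _ = 2 * C := by ring
  · rw [lintegral_const_mul _ (hξm.enorm.pow_const 2)]
    refine ENNReal.mul_ne_top (ENNReal.pow_ne_top ENNReal.ofReal_ne_top) ?_
    have := eLpNorm_lt_top_iff_lintegral_rpow_enorm_lt_top (p := 2) (by simp) (by simp) |>.1 hξ.2
    simpa using this.ne
  · filter_upwards [hae'] with o ho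
    have h3 : Tendsto (fun n => (smooth K c (h (ns (ms n))) (X o) - c (X o)) * ξ o) atTop
        (𝓝 0) := by
      simpa using (ho.sub_const (c (X o))).mul_const (ξ o)
    have h4 := (ENNReal.continuous_pow 2).tendsto _ |>.comp ((continuous_enorm.tendsto _).comp h3)
    simpa [Function.comp_def] using h4

end Smoothing

end SyntheticDiD

namespace SyntheticDiD

variable {N T : ℕ}

/-! ### Coordinates of an observation. -/

section Measurability

lemma measurable_obs_y (t : Fin (T + 2)) : Measurable fun o : Obs N T => o.y t :=
  (measurable_pi_apply t).comp measurable_fst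

lemma measurable_obs_x : Measurable fun o : Obs N T => o.x :=
  measurable_snd.comp measurable_snd

lemma measurable_obs_ind (g : Fin (N + 2)) : Measurable fun o : Obs N T => o.ind g :=
  (measurable_from_top (f := fun j : Fin (N + 2) => if j = g then (1 : ℝ) else 0)).comp
    (measurable_fst.comp measurable_snd)

lemma measurable_obs_dy : Measurable fun o : Obs N T => o.dy :=
  (measurable_obs_y _).sub (measurable_obs_y _)

end Measurability

/-! ### Weighted integrals of Bahadur representations. -/

section Bahadur

variable {ι : Type*} [Fintype ι] {K c fX : ℝ → ℝ} {h C : ℝ}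

lemma integrable_kernel_div (hK : Integrable K) (hh : 0 < h) (y : ℝ) :
    Integrable fun x => K ((y - x) / h) := by
  have := (hK.comp_div hh.ne').comp_sub_left y
  simpa using this

/-- Integrating against the law of the covariate cancels the factor `1 / fX`, and leaves a Lebesgue
integral of `c` against the kernel. Where `fX` vanishes the quotient is a default value, which is
why `c` has to vanish there. -/
lemma integrable_and_integral_bahadur (hfX : Measurable fX) (hfX0 : ∀ x, 0 ≤ fX x)
    (hK : Integrable K) (hc : Measurable c) (hcC : ∀ x, |c x| ≤ C)
    (hcf : ∀ x, fX x = 0 → c x = 0) (hh : 0 < h) (y z : ℝ) :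
    Integrable (fun x => c x * (K ((y - x) / h) / h / fX x * z))
        (volume.withDensity fun x => ENNReal.ofReal (fX x)) ∧
      ∫ x, c x * (K ((y - x) / h) / h / fX x * z)
        ∂(volume.withDensity fun x => ENNReal.ofReal (fX x)) = smooth K c h y * z := by
  have hm : Measurable fun x => ENNReal.ofReal (fX x) := hfX.ennreal_ofReal
  have hlt : ∀ᵐ x ∂(volume : Measure ℝ), ENNReal.ofReal (fX x) < ∞ := by simp
  have e : ∀ x, (ENNReal.ofReal (fX x)).toReal • (c x * (K ((y - x) / h) / h / fX x * z))
      = c x * (K ((y - x) / h) / h) * z := by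
    intro x
    rw [ENNReal.toReal_ofReal (hfX0 x), smul_eq_mul]
    by_cases h0 : fX x = 0
    · simp [h0, hcf x h0]
    · field_simp
  have hi : Integrable fun x => c x * (K ((y - x) / h) / h) :=
    ((integrable_kernel_div hK hh y).div_const h).bdd_mul (c := C) hc.aestronglyMeasurable
      (Eventually.of_forall hcC)
  constructor
  · rw [integrable_withDensity_iff_integrable_smul' hm hlt]
    simp_rw [e]
    exact hi.mul_const z
  · rw [integral_withDensity_eq_integral_toReal_smul hm hlt]
    simp_rw [e]
    rw [integral_mul_const]
    rfl

lemma integrable_and_integral_average_bahadur (hfX : Measurable fX) (hfX0 : ∀ x, 0 ≤ fX x)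
    (hK : Integrable K) (hc : Measurable c) (hcC : ∀ x, |c x| ≤ C)
    (hcf : ∀ x, fX x = 0 → c x = 0) (hh : 0 < h) (s : ι → Obs N T) (Z : Obs N T → ℝ) :
    Integrable (fun x => c x * average s fun o => K ((o.x - x) / h) / h / fX x * Z o)
        (volume.withDensity fun x => ENNReal.ofReal (fX x)) ∧
      ∫ x, c x * average s (fun o => K ((o.x - x) / h) / h / fX x * Z o)
        ∂(volume.withDensity fun x => ENNReal.ofReal (fX x))
        = average s fun o => smooth K c h o.x * Z o := by
  have h1 := fun i => integrable_and_integral_bahadur hfX hfX0 hK hc hcC hcf hh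
    (s i).x (Z (s i))
  have e : (fun x => c x * average s fun o => K ((o.x - x) / h) / h / fX x * Z o) = fun x =>
      (Fintype.card ι : ℝ)⁻¹ * ∑ i, c x * (K (((s i).x - x) / h) / h / fX x * Z (s i)) := by
    funext x
    rw [average, mul_left_comm, Finset.mul_sum]
  rw [e]
  refine ⟨(integrable_finsetSum _ fun i _ => (h1 i).1).const_mul _, ?_⟩
  rw [integral_const_mul, integral_finsetSum _ fun i _ => (h1 i).1, average]
  simp_rw [(h1 _).2]

/-- A weighted integral of an estimation error with a Bahadur representation, up to the remainder
of the representation and a smoothing error. -/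
lemma enorm_integral_sub_average_le (hfX : Measurable fX) (hfX0 : ∀ x, 0 ≤ fX x)
    (hKm : Measurable K) (hK : Integrable K) (hc : Measurable c) (hcC : ∀ x, |c x| ≤ C)
    (hcf : ∀ x, fX x = 0 → c x = 0) (hh : 0 < h) (s : ι → Obs N T) {Z : Obs N T → ℝ}
    {F : Measure ℝ} (hF : F = volume.withDensity fun x => ENNReal.ofReal (fX x))
    {D : ℝ → ℝ} (hD : Measurable D) :
    ‖∫ x, c x * D x ∂F - average s (fun o => c o.x * Z o)‖ₑ ≤
      ENNReal.ofReal (C + 1) *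
        eLpNorm (fun x => D x - average s fun o => K ((o.x - x) / h) / h / fX x * Z o) 1 F
      + ‖average s fun o => (smooth K c h o.x - c o.x) * Z o‖ₑ := by
  have hC0 : 0 ≤ C := (abs_nonneg _).trans (hcC 0)
  set B : ℝ → ℝ := fun x => average s fun o => K ((o.x - x) / h) / h / fX x * Z o with hB
  have hBm : Measurable B := by
    refine Measurable.const_mul (Finset.measurable_sum _ fun i _ => ?_) _
    refine Measurable.mul_const (Measurable.div (Measurable.div_const (hKm.comp ?_) _) hfX) _
    exact (measurable_const.sub measurable_id).div_const _
  by_cases htop : eLpNorm (fun x => D x - B x) 1 F = ∞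
  · rw [htop, ENNReal.mul_top (by simp; linarith)]
    simp
  obtain ⟨hi, hint⟩ := integrable_and_integral_average_bahadur (N := N) (T := T) hfX hfX0 hK
    hc hcC hcf hh s Z
  rw [← hF] at hi hint
  have hDB : Integrable (fun x => D x - B x) F :=
    memLp_one_iff_integrable.1 ⟨(hD.sub hBm).aestronglyMeasurable, lt_top_iff_ne_top.2 htop⟩
  have hcDB : Integrable (fun x => c x * (D x - B x)) F :=
    hDB.bdd_mul (c := C) hc.aestronglyMeasurable (Eventually.of_forall hcC)
  have e1 : ∫ x, c x * D x ∂F = ∫ x, c x * (D x - B x) ∂F +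
      average s fun o => smooth K c h o.x * Z o := by
    rw [← hint, ← integral_add hcDB hi]
    refine integral_congr_ae (Eventually.of_forall fun x => ?_)
    change c x * D x = c x * (D x - B x) + c x * B x
    ring
  have e2 : ∫ x, c x * D x ∂F - average s (fun o => c o.x * Z o) = ∫ x, c x * (D x - B x) ∂F +
      average s fun o => (smooth K c h o.x - c o.x) * Z o := by
    rw [e1, add_sub_assoc]
    congr 1
    simp only [average, ← mul_sub, ← Finset.sum_sub_distrib, sub_mul]
  rw [e2]
  refine (enorm_add_le _ _).trans (add_le_add ?_ le_rfl)
  refine (enorm_integral_le_lintegral_enorm _).trans ?_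
  rw [eLpNorm_one_eq_lintegral_enorm, ← lintegral_const_mul' _ _ ENNReal.ofReal_ne_top]
  refine lintegral_mono fun x => ?_
  rw [enorm_mul]
  gcongr
  rw [Real.enorm_eq_ofReal_abs]
  exact ENNReal.ofReal_le_ofReal ((hcC x).trans (by linarith))

end Bahadur

/-! ### The i.i.d. sample and its division into folds. -/

section Sample

variable {Ω : Type*} [MeasurableSpace Ω] {P : Measure Ω}
  {Q : Measure (Obs N T)} {S : ℕ → Ω → Obs N T} {L : ℕ}

lemma measurable_train (hS : ∀ i, Measurable (S i)) {n : ℕ} (fold : Fin n → Fin L) (ℓ : Fin L) :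
    Measurable fun ω => train fold ℓ fun i => S i ω :=
  measurable_pi_iff.2 fun i => hS i.1

/-- The index sets of the training data and of `s` are disjoint. -/
lemma indepFun_train (hS : ∀ i, Measurable (S i)) (hindep : iIndepFun S P) {n : ℕ}
    (fold : Fin n → Fin L) (ℓ : Fin L) (s : Finset (Fin n)) (hs : ∀ i ∈ s, fold i = ℓ) :
    IndepFun (fun ω => train fold ℓ fun i => S i ω) (fun ω (i : s) => S i ω) P := by
  have h1 : iIndepFun (fun i : Fin n => S i) P := hindep.precomp Fin.val_injective
  have h2 := h1.indepFun_finset (Finset.univ.filter fun i => fold i ≠ ℓ) s (by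
    rw [Finset.disjoint_left]
    intro i hi his
    exact (Finset.mem_filter.1 hi).2 (hs i his)) fun i => hS i
  exact h2.comp (φ := fun a (i : Train fold ℓ) => a ⟨i.1, by simpa using i.2⟩) (ψ := id)
    (measurable_pi_iff.2 fun i => measurable_pi_apply _) measurable_id

/-- The product form of the joint law that the conditional Markov inequality takes as its
hypothesis; the version for two observations serves the cross terms in Chebyshev's inequality. -/
lemma map_train_prodMk [IsProbabilityMeasure P]
    (hS : ∀ i, Measurable (S i)) (hindep : iIndepFun S P)
    (hlaw : ∀ i, P.map (S i) = Q) {n : ℕ} (fold : Fin n → Fin L) (ℓ : Fin L) {i : Fin n}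
    (hi : fold i = ℓ) :
    P.map (fun ω => (train fold ℓ (fun i => S i ω), S i ω)) =
      (P.map fun ω => train fold ℓ fun i => S i ω).prod Q := by
  have hψ : Measurable fun a : ({i} : Finset (Fin n)) → Obs N T => a ⟨i, by simp⟩ :=
    measurable_pi_apply _
  have h1 := (indepFun_train hS hindep fold ℓ {i} (by simpa using hi)).comp measurable_id hψ
  rw [← hlaw i]
  exact (indepFun_iff_map_prod_eq_prod_map_map (measurable_train hS fold ℓ).aemeasurable
    (hS i).aemeasurable).1 h1

lemma map_train_prodMk_prodMk [IsProbabilityMeasure P]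
    (hS : ∀ i, Measurable (S i)) (hindep : iIndepFun S P)
    (hlaw : ∀ i, P.map (S i) = Q) {n : ℕ} (fold : Fin n → Fin L) (ℓ : Fin L) {i j : Fin n}
    (hi : fold i = ℓ) (hj : fold j = ℓ) (hij : i ≠ j) :
    P.map (fun ω => (train fold ℓ (fun i => S i ω), S i ω, S j ω)) =
      (P.map fun ω => train fold ℓ fun i => S i ω).prod (Q.prod Q) := by
  have hψ : Measurable fun a : ({i, j} : Finset (Fin n)) → Obs N T =>
      (a ⟨i, by simp⟩, a ⟨j, by simp⟩) :=
    (measurable_pi_apply _).prodMk (measurable_pi_apply _)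
  have h1 := (indepFun_train hS hindep fold ℓ {i, j} (by simp [hi, hj])).comp measurable_id hψ
  have h2 : P.map (fun ω => (S i ω, S j ω)) = Q.prod Q := by
    rw [(indepFun_iff_map_prod_eq_prod_map_map (hS i).aemeasurable (hS j).aemeasurable).1
      (hindep.indepFun fun h => hij (Fin.val_injective h)), hlaw, hlaw]
  rw [← h2]
  exact (indepFun_iff_map_prod_eq_prod_map_map (measurable_train hS fold ℓ).aemeasurable
    ((hS i).prodMk (hS j)).aemeasurable).1 h1

lemma card_train {k : ℕ} {fold : Fin (L * k) → Fin L} {ℓ : Fin L}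
    (hfold : (Finset.univ.filter fun i => fold i = ℓ).card = k) :
    (Fintype.card (Train fold ℓ) : ℝ) = (L - 1) * k := by
  have h1 : Fintype.card (Train fold ℓ) + k = L * k := by
    have h3 := Finset.card_filter_add_card_filter_not (s := Finset.univ) fun i => fold i = ℓ
    rw [hfold, Finset.card_univ, Fintype.card_fin] at h3
    rw [Fintype.card_subtype, add_comm]
    exact h3
  have h2 : (Fintype.card (Train fold ℓ) : ℝ) + k = L * k := by exact_mod_cast h1
  linarith

/-- Root-`n` training averages of centred functions with vanishing second moments are
negligible. -/
lemma negligible_average_train [IsProbabilityMeasure P] [IsProbabilityMeasure Q]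
    (hS : ∀ i, Measurable (S i))
    (hindep : iIndepFun S P) (hlaw : ∀ i, P.map (S i) = Q) (hL : 2 ≤ L)
    (fold : ∀ k : ℕ, Fin (L * k) → Fin L)
    (hfold : ∀ k ℓ, (Finset.univ.filter fun i => fold k i = ℓ).card = k) (ℓ : Fin L)
    {f : ℕ → Obs N T → ℝ} (hf : ∀ k, Measurable (f k)) (hf0 : ∀ k, ∫ o, f k o ∂Q = 0)
    (hf2 : Tendsto (fun k => ∫⁻ o, ‖f k o‖ₑ ^ 2 ∂Q) atTop (𝓝 0)) :
    Negligible P fun k ω => ENNReal.ofReal √((L * k : ℕ) : ℝ) *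
      ‖average (train (fold k) ℓ fun i => S i ω) (f k)‖ₑ := by
  have hL1 : (1 : ℝ) ≤ L - 1 := by
    have : (2 : ℝ) ≤ L := by exact_mod_cast hL
    linarith
  have hind : ∀ i j : ℕ, i ≠ j → P.map (fun ω => (S i ω, S j ω)) = Q.prod Q := fun i j hij => by
    rw [(indepFun_iff_map_prod_eq_prod_map_map (hS i).aemeasurable (hS j).aemeasurable).1
      (hindep.indepFun hij), hlaw, hlaw]
  -- The functions are deterministic, so the conditioning variable is trivial.
  have h1 := negligible_centered_sum (P := P) (Q := Q) (α := fun _ => Unit)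
    (ι := fun k => Train (fold k) ℓ)
    (τ := fun _ _ => ()) (V := fun k i => S i.1) (fun k => Finset.univ)
    (fun _ => measurable_const) (fun k i => hS _)
    (fun k i _ => by
      have : IndepFun (fun _ : Ω => ()) (S i.1) P := indepFun_const_left () _
      rw [← hlaw i.1]
      exact (indepFun_iff_map_prod_eq_prod_map_map measurable_const.aemeasurable
        (hS _).aemeasurable).1 this)
    (fun k i _ j _ hij => by
      have : IndepFun (fun _ : Ω => ()) (fun ω => (S i.1 ω, S j.1 ω)) P := indepFun_const_left () _
      rw [← hind i.1 j.1 fun h => hij (Subtype.ext (Fin.val_injective h))]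
      exact (indepFun_iff_map_prod_eq_prod_map_map measurable_const.aemeasurable
        ((hS _).prodMk (hS _)).aemeasurable).1 this)
    (f := fun k _ => f k) (fun k => (hf k).comp measurable_snd)
    -- Unhalved, the squared factor times the number of terms would be `L / (L - 1)`, which exceeds
    -- one; halving makes it at most one. The factor two is restored afterwards.
    (c := fun k => ENNReal.ofReal (√((L * k : ℕ) : ℝ) * (((L : ℝ) - 1) * k)⁻¹ / 2)) (fun k => by
      have hL0 : (0 : ℝ) < L - 1 := by linarith
      rw [Finset.card_univ, ← ENNReal.ofReal_pow (by positivity), ← ENNReal.ofReal_natCast,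
        card_train (hfold k ℓ), ← ENNReal.ofReal_mul (by positivity), ENNReal.ofReal_le_one]
      rcases Nat.eq_zero_or_pos k with rfl | hk
      · simp
      have hk' : (0 : ℝ) < k := by exact_mod_cast hk
      rw [div_pow, mul_pow, Real.sq_sqrt (by positivity)]
      push_cast
      field_simp
      linarith)
    (Negligible.of_tendsto hf2)
  refine (h1.const_mul (c := 2) (by simp)).mono fun k ω => ?_
  simp only [hf0, sub_zero]
  rw [average, card_train (hfold k ℓ), enorm_mul, ← mul_assoc, ← mul_assoc]
  refine mul_le_mul' ?_ le_rfl
  have hpos : (0 : ℝ) ≤ ((L - 1) * k : ℝ)⁻¹ :=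
    inv_nonneg.2 (mul_nonneg (by linarith) (Nat.cast_nonneg _))
  rw [Real.enorm_eq_ofReal hpos, ← ENNReal.ofReal_mul (by positivity),
    show (2 : ℝ≥0∞) = ENNReal.ofReal 2 by simp, ← ENNReal.ofReal_mul (by positivity)]
  exact ENNReal.ofReal_le_ofReal (le_of_eq (by ring))

/-- A root-`n` weighted integral of an estimation error with a Bahadur representation is
asymptotically linear. -/
lemma negligible_integral_sub_average [IsProbabilityMeasure P] [IsProbabilityMeasure Q]
    (hS : ∀ i, Measurable (S i))
    (hindep : iIndepFun S P) (hlaw : ∀ i, P.map (S i) = Q) (hL : 2 ≤ L)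
    (fold : ∀ k : ℕ, Fin (L * k) → Fin L)
    (hfold : ∀ k ℓ, (Finset.univ.filter fun i => fold k i = ℓ).card = k) (ℓ : Fin L)
    {fX K c : ℝ → ℝ} {C : ℝ} {h : ℕ → ℝ} {F : Measure ℝ} {Z : Obs N T → ℝ}
    (hfX : Measurable fX) (hfX0 : ∀ x, 0 ≤ fX x)
    (hF : F = volume.withDensity fun x => ENNReal.ofReal (fX x))
    (hQF : Q.map (fun o => o.x) = F)
    (hKm : Measurable K) (hK : Integrable K) (hK0 : ∀ u, 0 ≤ K u) (hK1 : ∫ u, K u = 1)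
    (hc : Measurable c) (hcC : ∀ x, |c x| ≤ C) (hci : Integrable c)
    (hcf : ∀ x, fX x = 0 → c x = 0)
    (hh : ∀ n, 0 < h n) (hh0 : Tendsto h atTop (𝓝 0))
    (hZm : Measurable Z) (hZ2 : MemLp Z 2 Q)
    (hZ0 : ∀ b : ℝ → ℝ, Measurable b → (∃ C, ∀ x, |b x| ≤ C) → ∫ o, b o.x * Z o ∂Q = 0)
    {D : ∀ k : ℕ, (Train (fold k) ℓ → Obs N T) → ℝ → ℝ}
    (hD : ∀ k s, Measurable (D k s))
    (hrem : Negligible P fun k ω => ENNReal.ofReal √((L * k : ℕ) : ℝ) *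
      eLpNorm (fun x => D k (train (fold k) ℓ fun i => S i ω) x
        - average (train (fold k) ℓ fun i => S i ω)
            fun o => K ((o.x - x) / h (L * k)) / h (L * k) / fX x * Z o) 1 F) :
    Negligible P fun k ω => ENNReal.ofReal √((L * k : ℕ) : ℝ) *
      ‖∫ x, c x * D k (train (fold k) ℓ fun i => S i ω) x ∂F
        - average (train (fold k) ℓ fun i => S i ω) (fun o => c o.x * Z o)‖ₑ := by
  have hac : Q.map (fun o : Obs N T => o.x) ≪ volume := by
    rw [hQF, hF]
    exact withDensity_absolutelyContinuous _ _
  have hLk : Tendsto (fun k => L * k) atTop atTop :=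
    tendsto_id.const_mul_atTop' (by omega)
  -- The difference between smoothed and unsmoothed weight, times `Z`, has mean exactly zero because
  -- `Z` is orthogonal to bounded functions of the covariate. So smoothing contributes variance but
  -- no bias, and the variance vanishes with the bandwidth.
  have h2 := negligible_average_train hS hindep hlaw hL fold hfold ℓ
    (f := fun k o => (smooth K c (h (L * k)) o.x - c o.x) * Z o)
    (fun k => (((measurable_smooth hKm hc).comp measurable_obs_x).sub
      (hc.comp measurable_obs_x)).mul hZm)
    (fun k => hZ0 (fun x => smooth K c (h (L * k)) x - c x) ((measurable_smooth hKm hc).sub hc)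
      ⟨C + C, fun x => (abs_sub _ _).trans
        (add_le_add (abs_smooth_le (hh _) hK hK0 hK1 hcC _) (hcC _))⟩)
    (tendsto_lintegral_smooth_sq measurable_obs_x hZm hZ2 hac hKm hK hK0 hK1 hc hcC hci
      (fun k => hh _) (hh0.comp hLk))
  refine ((hrem.const_mul (c := ENNReal.ofReal (C + 1)) ENNReal.ofReal_ne_top).add h2).mono
    fun k ω => ?_
  rw [mul_left_comm, ← mul_add]
  gcongr
  exact enorm_integral_sub_average_le hfX hfX0 hKm hK hc hcC hcf (hh _) _ hF (hD k _)

end Sample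

end SyntheticDiD

namespace SyntheticDiD

variable {N T : ℕ}

/-! ### Entrywise matrix bounds and the expansion of least-squares weights. -/

section MatrixBounds

variable {m n : Type*} [Fintype n] {a b : ℝ}

lemma abs_mulVec_le {A : Matrix m n ℝ} (hA : ∀ i j, |A i j| ≤ a) (v : n → ℝ) (i : m) :
    |(A *ᵥ v) i| ≤ a * ∑ j, |v j| := by
  rw [mulVec, dotProduct, Finset.mul_sum]
  refine (Finset.abs_sum_le_sum_abs _ _).trans (Finset.sum_le_sum fun j _ => ?_)
  rw [abs_mul]
  exact mul_le_mul_of_nonneg_right (hA i j) (abs_nonneg _)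

lemma abs_mulVec_le_card {A : Matrix m n ℝ} (hA : ∀ i j, |A i j| ≤ a) (ha : 0 ≤ a) {v : n → ℝ}
    (hv : ∀ j, |v j| ≤ b) (i : m) : |(A *ᵥ v) i| ≤ a * (Fintype.card n * b) := by
  refine (abs_mulVec_le hA v i).trans (mul_le_mul_of_nonneg_left ?_ ha)
  calc _ ≤ ∑ _j : n, b := Finset.sum_le_sum fun j _ => hv j
    _ = _ := by simp

lemma abs_mul_le_card {l k : Type*} {A : Matrix l n ℝ} {B : Matrix n k ℝ} (hA : ∀ i j, |A i j| ≤ a)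
    (hB : ∀ i j, |B i j| ≤ b) (ha : 0 ≤ a) (i : l) (j : k) :
    |(A * B) i j| ≤ a * (Fintype.card n * b) :=
  (abs_mulVec_le_card (A := fun (_ : Unit) k => A i k) (v := fun k => B k j) (fun _ => hA i) ha
    (fun k => hB k j) ())

end MatrixBounds

/-- The linear expansion of least-squares weights around weights with an exact fit has a remainder
of second order. -/
lemma abs_leastSquares_sub_le {C : ℝ} (hC : 0 ≤ C) : ∃ C' : ℝ, 0 ≤ C' ∧
    ∀ (M M' : Matrix (Fin (T + 1)) (Fin N) ℝ) (y y' : Fin (T + 1) → ℝ) (v v' : Fin N → ℝ) (d : ℝ),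
      IsUnit (Mᵀ * M).det → (∀ i j, |(Mᵀ * M)⁻¹ i j| ≤ C) → (∀ t j, |M t j| ≤ C) →
      (∀ j, |v j| ≤ C) → M *ᵥ v = y → (∀ t j, |M' t j - M t j| ≤ d) → (∀ t, |y' t - y t| ≤ d) →
      v' = (M'ᵀ * M')⁻¹ *ᵥ (M'ᵀ *ᵥ y') → ∀ j,
      |v' j - v j - ((Mᵀ * M)⁻¹ *ᵥ (Mᵀ *ᵥ (y' - y - (M' - M) *ᵥ v))) j| ≤
        C' * (d * ∑ j, |v' j - v j| + d ^ 2 * ∑ j, |v' j - v j| + d ^ 2) := by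
  set n : ℝ := (N : ℝ) with hn
  set t : ℝ := ((T + 1 : ℕ) : ℝ) with ht
  have hn0 : 0 ≤ n := Nat.cast_nonneg _
  have ht0 : 0 ≤ t := Nat.cast_nonneg _
  set A : ℝ := 1 + n * C with hA
  set b : ℝ := n * (C * (n * (C * t))) with hb
  have hA0 : 0 ≤ A := by positivity
  have hb0 : 0 ≤ b := by positivity
  -- The first two summands serve an invertible perturbed Gram matrix, the last two a singular one.
  -- Here `d * A` bounds the entries of `η`, and `b * d` bounds `J Mᵀ D` as an operator on the sum
  -- norm.
  refine ⟨C * n * t * (2 * C + 1) + C * n * t * A + C * b ^ 2 + C * n * C * t * A * b,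
    by positivity, ?_⟩
  intro M M' y y' v v' d hdet hJ hM hv hfit hdM hdy hv' j
  have hd0 : 0 ≤ d := (abs_nonneg _).trans (hdy 0)
  set J := (Mᵀ * M)⁻¹ with hJdef
  set D := M' - M with hD
  have hDb : ∀ t j, |D t j| ≤ d := hdM
  set η := y' - y - D *ᵥ v with hη
  have hηb : ∀ t, |η t| ≤ d * A := by
    intro t
    have h1 := abs_mulVec_le_card hDb hd0 hv t
    rw [Fintype.card_fin] at h1
    calc |η t| ≤ |y' t - y t| + |(D *ᵥ v) t| := abs_sub _ _
      _ ≤ d + d * (n * C) := add_le_add (hdy t) h1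
      _ = d * A := by rw [hA]; ring
  have hJM : J * (Mᵀ * M) = 1 := nonsing_inv_mul _ hdet
  set e := ∑ j, |v' j - v j| with he
  have he0 : 0 ≤ e := Finset.sum_nonneg fun _ _ => abs_nonneg _
  by_cases hdet' : IsUnit (M'ᵀ * M').det
  · have hη' : η = y' - M' *ᵥ v := by
      rw [hη, hD, sub_mulVec, hfit]
      abel
    have h1 : (M'ᵀ * M') *ᵥ (v' - v) = M'ᵀ *ᵥ η := by
      rw [mulVec_sub, hv', mulVec_mulVec, mul_nonsing_inv _ hdet', one_mulVec, hη', mulVec_sub,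
        mulVec_mulVec]
    -- Subtracting the perturbed normal equations from the unperturbed Gram matrix leaves only
    -- products of two small quantities: `Dᵀ` with `η`, and the change of the Gram matrix with `v' -
    -- v`.
    have h2 : v' - v - J *ᵥ (Mᵀ *ᵥ η) =
        J *ᵥ (Dᵀ *ᵥ η - (M'ᵀ * M' - Mᵀ * M) *ᵥ (v' - v)) := by
      have h3 : v' - v = J *ᵥ ((Mᵀ * M) *ᵥ (v' - v)) := by
        rw [mulVec_mulVec, hJM, one_mulVec]
      have h4 : Dᵀ *ᵥ η = M'ᵀ *ᵥ η - Mᵀ *ᵥ η := by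
        rw [hD, transpose_sub, sub_mulVec]
      rw [sub_mulVec, h1, h4]
      nth_rewrite 1 [h3]
      rw [← mulVec_sub]
      congr 1
      abel
    have hG : ∀ i k, |(M'ᵀ * M' - Mᵀ * M) i k| ≤ t * (2 * C * d + d ^ 2) := by
      intro i k
      have h5 : M'ᵀ * M' - Mᵀ * M = Dᵀ * M + Mᵀ * D + Dᵀ * D := by
        have : M' = M + D := by rw [hD]; abel
        rw [this, transpose_add]
        simp only [Matrix.add_mul, Matrix.mul_add]
        abel
      rw [h5]
      have h6 := abs_mul_le_card (A := Dᵀ) (B := M) (fun i j => hDb j i) hM hd0 i k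
      have h7 := abs_mul_le_card (A := Mᵀ) (B := D) (fun i j => hM j i) hDb hC i k
      have h8 := abs_mul_le_card (A := Dᵀ) (B := D) (fun i j => hDb j i) hDb hd0 i k
      rw [Fintype.card_fin] at h6 h7 h8
      calc _ ≤ |(Dᵀ * M) i k| + |(Mᵀ * D) i k| + |(Dᵀ * D) i k| := by
            simp only [Matrix.add_apply]
            exact (abs_add_le _ _).trans (add_le_add (abs_add_le _ _) le_rfl)
        _ ≤ d * (t * C) + C * (t * d) + d * (t * d) := add_le_add (add_le_add h6 h7) h8
        _ = _ := by ring
    have h9 : ∀ i, |(Dᵀ *ᵥ η - (M'ᵀ * M' - Mᵀ * M) *ᵥ (v' - v)) i| ≤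
        d * (t * (d * A)) + t * (2 * C * d + d ^ 2) * e := by
      intro i
      refine (abs_sub _ _).trans (add_le_add ?_ ?_)
      · have := abs_mulVec_le_card (A := Dᵀ) (fun i j => hDb j i) hd0 hηb i
        rwa [Fintype.card_fin] at this
      · exact abs_mulVec_le hG (v' - v) i
    have h10 := abs_mulVec_le_card hJ hC h9 j
    rw [Fintype.card_fin] at h10
    have h11 : v' j - v j - (J *ᵥ (Mᵀ *ᵥ η)) j = (v' - v - J *ᵥ (Mᵀ *ᵥ η)) j := rfl
    rw [h11, h2]
    refine h10.trans ?_
    have k1 : 0 ≤ d * e := by positivity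
    have k2 : 0 ≤ d ^ 2 * e := by positivity
    have k3 : 0 ≤ d ^ 2 := by positivity
    have c1 : 0 ≤ C * n * t := by positivity
    have c2 : 0 ≤ C * n * t * C := by positivity
    have c3 : 0 ≤ C * n * t * A := by positivity
    have c4 : 0 ≤ C * b ^ 2 := by positivity
    have c5 : 0 ≤ C * n * C * t * A * b := by positivity
    have e1 : C * (n * (d * (t * (d * A)) + t * (2 * C * d + d ^ 2) * e)) =
        C * n * t * A * d ^ 2 + 2 * (C * n * t * C) * (d * e) + C * n * t * (d ^ 2 * e) := by ring
    rw [e1]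
    have e2 : (C * n * t * (2 * C + 1) + C * n * t * A + C * b ^ 2 + C * n * C * t * A * b) *
        (d * e + d ^ 2 * e + d ^ 2) = (2 * (C * n * t * C) + C * n * t + C * n * t * A + C * b ^ 2 +
        C * n * C * t * A * b) * (d * e + d ^ 2 * e + d ^ 2) := by ring
    rw [e2]
    set S := d * e + d ^ 2 * e + d ^ 2
    have s1 : d * e ≤ S := by simp only [S]; linarith
    have s2 : d ^ 2 * e ≤ S := by simp only [S]; linarith
    have s3 : d ^ 2 ≤ S := by simp only [S]; linarith
    have s0 : 0 ≤ S := by positivity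
    have g1 := mul_le_mul_of_nonneg_left s3 c3
    have g2 := mul_le_mul_of_nonneg_left s1 c2
    have g3 := mul_le_mul_of_nonneg_left s2 c1
    have g4 := mul_nonneg c4 s0
    have g5 := mul_nonneg c5 s0
    linarith
  -- With the inverse read as zero the solution is zero. But a singular perturbed Gram matrix forces
  -- the perturbation to be bounded below, `1 ≤ b * d`, so that bounded errors are already of order
  -- `d ^ 2`.
  · have hv0 : v' = 0 := by
      rw [hv', nonsing_inv_apply_not_isUnit _ hdet', zero_mulVec]
    have hdz : (M'ᵀ * M').det = 0 := by simpa [isUnit_iff_ne_zero] using hdet'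
    obtain ⟨z, hz0, hz⟩ := exists_mulVec_eq_zero_iff.2 hdz
    have hMz : M' *ᵥ z = 0 := by
      have h1 : z ⬝ᵥ ((M'ᵀ * M') *ᵥ z) = (M' *ᵥ z) ⬝ᵥ (M' *ᵥ z) := by
        rw [← mulVec_mulVec, dotProduct_mulVec, vecMul_transpose]
      rw [hz, dotProduct_zero] at h1
      exact dotProduct_self_eq_zero.1 h1.symm
    -- A null vector of `M'` satisfies `M z = -D z`; solving by the left inverse `J Mᵀ` of `M`
    -- bounds the size of `z` by `b * d` times itself.
    have hzJ : z = -(J *ᵥ (Mᵀ *ᵥ (D *ᵥ z))) := by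
      rw [hD, sub_mulVec, hMz, zero_sub, mulVec_neg, mulVec_neg, neg_neg, mulVec_mulVec,
        mulVec_mulVec, Matrix.mul_assoc, hJM, one_mulVec]
    set s := ∑ j, |z j| with hs
    have hs0 : 0 < s := by
      obtain ⟨i, hi⟩ := Function.ne_iff.1 hz0
      exact Finset.sum_pos' (fun _ _ => abs_nonneg _) ⟨i, Finset.mem_univ _, abs_pos.2 hi⟩
    have hzi : ∀ i, |z i| ≤ C * (n * (C * (t * (d * s)))) := by
      intro i
      have h1 : ∀ t, |(D *ᵥ z) t| ≤ d * s := abs_mulVec_le hDb z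
      have h2 := abs_mulVec_le_card (A := Mᵀ) (fun i j => hM j i) hC h1
      have h3 := abs_mulVec_le_card hJ hC h2 i
      rw [Fintype.card_fin, Fintype.card_fin] at h3
      have h4 : |z i| = |(J *ᵥ (Mᵀ *ᵥ (D *ᵥ z))) i| := by
        nth_rewrite 1 [hzJ]
        exact abs_neg _
      rw [h4]
      exact h3
    have hsle : s ≤ b * d * s := by
      calc s ≤ ∑ _i : Fin N, C * (n * (C * (t * (d * s)))) := Finset.sum_le_sum fun i _ => hzi i
        _ = b * d * s := by
          rw [Finset.sum_const, Finset.card_univ, Fintype.card_fin, nsmul_eq_mul, hb]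
          ring
    have hbd : 1 ≤ b * d := by
      by_contra hcon
      rw [not_le] at hcon
      have := mul_lt_mul_of_pos_right hcon hs0
      linarith
    have h2 := abs_mulVec_le_card (A := Mᵀ) (fun i j => hM j i) hC hηb
    have h3 := abs_mulVec_le_card hJ hC h2 j
    rw [Fintype.card_fin, Fintype.card_fin] at h3
    have hmain : |v' j - v j - (J *ᵥ (Mᵀ *ᵥ η)) j| ≤
        C * b ^ 2 * d ^ 2 + C * n * C * t * A * b * d ^ 2 := by
      rw [hv0]
      calc |(0 : Fin N → ℝ) j - v j - (J *ᵥ (Mᵀ *ᵥ η)) j|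
          ≤ |(0 : Fin N → ℝ) j - v j| + |(J *ᵥ (Mᵀ *ᵥ η)) j| := abs_sub _ _
        _ ≤ C + C * (n * (C * (t * (d * A)))) := by
          refine add_le_add ?_ h3
          rw [Pi.zero_apply, zero_sub, abs_neg]
          exact hv j
        _ ≤ C * (b * d) ^ 2 + C * n * C * t * A * d * (b * d) := by
          have g1 : 1 ≤ (b * d) ^ 2 := one_le_pow₀ hbd
          have g2 := mul_le_mul_of_nonneg_left g1 hC
          have g3 := mul_le_mul_of_nonneg_left hbd
            (show 0 ≤ C * n * C * t * A * d by positivity)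
          linarith
        _ = _ := by ring
    refine hmain.trans ?_
    have k1 : 0 ≤ d * e := by positivity
    have k2 : 0 ≤ d ^ 2 * e := by positivity
    have c1 : 0 ≤ C * n * t * (2 * C + 1) + C * n * t * A := by positivity
    have c2 : 0 ≤ C * b ^ 2 + C * n * C * t * A * b := by positivity
    have k3 : 0 ≤ d ^ 2 := by positivity
    have g1 := mul_nonneg c1 (add_nonneg (add_nonneg k1 k2) k3)
    have g2 := mul_nonneg c2 (add_nonneg k1 k2)
    linarith

/-! ### Measurability of matrix operations and plug-in weights. -/

section Measurability

variable {α : Type*} [MeasurableSpace α]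

/-- Cramer's rule, with `0⁻¹ = 0` in the determinant factor, is correct for singular matrices too,
so no case distinction is needed. -/
lemma measurable_matrix_inv {n : Type*} [Fintype n] [DecidableEq n] {A : α → Matrix n n ℝ}
    (hA : ∀ i j, Measurable fun a => A a i j) (i j : n) : Measurable fun a => (A a)⁻¹ i j := by
  have h0 : Measurable fun a => (fun i j => A a i j : n → n → ℝ) :=
    measurable_pi_iff.2 fun i => measurable_pi_iff.2 fun j => hA i j
  have hof : Continuous fun B : n → n → ℝ => Matrix.of B := continuous_id
  have h1' : Continuous fun B : n → n → ℝ => (Matrix.of B).det := hof.matrix_det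
  have h2' : Continuous fun B : n → n → ℝ => (Matrix.of B).adjugate i j :=
    hof.matrix_adjugate.matrix_elem i j
  have h1 := h1'.measurable
  have h2 := h2'.measurable
  have h3 : (fun a => (A a)⁻¹ i j) = fun a => (A a).det⁻¹ * (A a).adjugate i j := by
    funext a
    rw [inv_def, Matrix.smul_apply, Ring.inverse_eq_inv', smul_eq_mul]
  rw [h3]
  exact (h1.comp h0).inv.mul (h2.comp h0)

lemma measurable_mulVec {m n : Type*} [Fintype n] {A : α → Matrix m n ℝ} {v : α → n → ℝ}
    (hA : ∀ i j, Measurable fun a => A a i j) (hv : ∀ j, Measurable fun a => v a j) (i : m) :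
    Measurable fun a => (A a *ᵥ v a) i :=
  Finset.measurable_sum _ fun j _ => (hA i j).mul (hv j)

lemma measurable_matrix_mul {l m n : Type*} [Fintype m] {A : α → Matrix l m ℝ}
    {B : α → Matrix m n ℝ} (hA : ∀ i j, Measurable fun a => A a i j)
    (hB : ∀ i j, Measurable fun a => B a i j) (i : l) (j : n) :
    Measurable fun a => (A a * B a) i j :=
  Finset.measurable_sum _ fun k _ => (hA i k).mul (hB k j)

lemma measurable_snoc {v : α → Fin N → ℝ} {b : α → ℝ} (hv : ∀ j, Measurable fun a => v a j)
    (hb : Measurable b) (g : Fin (N + 1)) :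
    Measurable fun a => (Fin.snoc (α := fun _ => ℝ) (v a) (b a) g : ℝ) := by
  induction g using Fin.lastCases with
  | last => simpa using hb
  | cast j => simpa using hv j

lemma measurable_leastSquares {m : α → Fin (N + 2) → Fin (T + 2) → ℝ → ℝ} {x : α → ℝ}
    (hm : ∀ g t, Measurable fun a => m a g t (x a)) (g : Fin (N + 1)) :
    Measurable fun a => leastSquaresWeights (m a) g (x a) := by
  have hM : ∀ i j, Measurable fun a => weightMatrix (m a) (x a) i j :=
    fun i j => (hm _ _).sub (hm _ _)
  have hy : ∀ i, Measurable fun a => weightVector (m a) (x a) i := fun i => (hm _ _).sub (hm _ _)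
  have hv : ∀ j, Measurable fun a => (((weightMatrix (m a) (x a))ᵀ * weightMatrix (m a) (x a))⁻¹ *ᵥ
      ((weightMatrix (m a) (x a))ᵀ *ᵥ weightVector (m a) (x a))) j :=
    measurable_mulVec (measurable_matrix_inv (measurable_matrix_mul (fun i j => hM j i) hM))
      (measurable_mulVec (fun i j => hM j i) hy)
  exact measurable_snoc hv (measurable_const.sub (Finset.measurable_sum _ fun j _ => hv j)) g

end Measurability

/-! ### The linearized weights and their coefficients. -/

section Score

/-- The contrasts of the control groups with the last control group. -/
def contrastMatrix (z : Fin (N + 2) → Fin (T + 1) → ℝ) : Matrix (Fin (T + 1)) (Fin N) ℝ :=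
  Matrix.of fun t j => z j.castSucc.succ t - z (Fin.last (N + 1)) t

/-- The contrast of the treated group with the last control group. -/
def contrastVector (z : Fin (N + 2) → Fin (T + 1) → ℝ) : Fin (T + 1) → ℝ :=
  fun t => z 0 t - z (Fin.last (N + 1)) t

namespace Nuisance

variable (q : Nuisance N T)

/-- The derivative of the weights, except the last, in the outcome regressions. -/
noncomputable def weightDeriv (x : ℝ) (z : Fin (N + 2) → Fin (T + 1) → ℝ) : Fin N → ℝ :=
  ((weightMatrix q.m x)ᵀ * weightMatrix q.m x)⁻¹ *ᵥ ((weightMatrix q.m x)ᵀ *ᵥ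
    (contrastVector z - contrastMatrix z *ᵥ fun j => q.w j.castSucc x))

/-- The derivative of the `u`-weighted sum of the weights in the outcome regressions. -/
noncomputable def score (x : ℝ) (z : Fin (N + 2) → Fin (T + 1) → ℝ) : ℝ :=
  q.vecU x ⬝ᵥ Fin.snoc (α := fun _ => ℝ) (q.weightDeriv x z) (-∑ j, q.weightDeriv x z j)

lemma dotProduct_snoc (u : Fin (N + 1) → ℝ) (v : Fin N → ℝ) (b : ℝ) :
    u ⬝ᵥ Fin.snoc (α := fun _ => ℝ) v b = ∑ j, u j.castSucc * v j + u (Fin.last N) * b := by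
  rw [dotProduct, Fin.sum_univ_castSucc]
  simp

/-- The contrasts are linear in `z`, and the remaining factors do not depend on `z`. -/
lemma weightDeriv_sum {κ : Type*} (s : Finset κ) (x : ℝ) (a : κ → ℝ)
    (z : κ → Fin (N + 2) → Fin (T + 1) → ℝ) :
    q.weightDeriv x (∑ k ∈ s, a k • z k) = ∑ k ∈ s, a k • q.weightDeriv x (z k) := by
  classical
  induction s using Finset.induction_on with
  | empty =>
    have h1 : contrastVector (0 : Fin (N + 2) → Fin (T + 1) → ℝ) = 0 := by
      funext t; simp [contrastVector]
    have h2 : contrastMatrix (0 : Fin (N + 2) → Fin (T + 1) → ℝ) = 0 := by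
      ext t j; simp [contrastMatrix]
    simp [weightDeriv, h1, h2]
  | insert k s hk ih =>
    rw [Finset.sum_insert hk, Finset.sum_insert hk, ← ih]
    generalize ∑ k ∈ s, a k • z k = z'
    have h1 : contrastVector (a k • z k + z') = a k • contrastVector (z k) + contrastVector z' := by
      funext t; simp [contrastVector]; ring
    have h2 : contrastMatrix (a k • z k + z') = a k • contrastMatrix (z k) + contrastMatrix z' := by
      ext t j; simp [contrastMatrix]; ring
    simp only [weightDeriv, h1, h2, add_mulVec, smul_mulVec, ← mulVec_smul, ← mulVec_add]
    congr 2
    rw [mulVec_smul, smul_sub]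
    abel

lemma score_sum {κ : Type*} (s : Finset κ) (x : ℝ) (a : κ → ℝ)
    (z : κ → Fin (N + 2) → Fin (T + 1) → ℝ) :
    q.score x (∑ k ∈ s, a k • z k) = ∑ k ∈ s, a k * q.score x (z k) := by
  simp only [score, dotProduct_snoc, weightDeriv_sum, Finset.sum_apply, Pi.smul_apply, smul_eq_mul]
  rw [Finset.sum_comm (s := Finset.univ) (t := s)]
  simp only [Finset.mul_sum, mul_add, Finset.sum_add_distrib, mul_neg, Finset.sum_neg_distrib]
  rw [Finset.sum_comm (s := Finset.univ) (t := s)]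
  congr 1
  · exact Finset.sum_congr rfl fun k _ => Finset.sum_congr rfl fun j _ => by ring
  · exact congrArg Neg.neg
      (Finset.sum_congr rfl fun k _ => Finset.sum_congr rfl fun j _ => by ring)

/-- The coefficients of the linear functional `score`. -/
noncomputable def scoreCoef (k : Fin (N + 2) × Fin (T + 1)) (x : ℝ) : ℝ :=
  q.score x fun g t => if (g, t) = k then 1 else 0

/-- Expansion of `z` in the standard basis. It turns the derivative of the weights into finitely
many scalar functionals, one for each group and pre-treatment period, to which the Bahadur
representations apply separately. -/
lemma score_eq_sum (x : ℝ) (z : Fin (N + 2) → Fin (T + 1) → ℝ) :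
    q.score x z = ∑ k : Fin (N + 2) × Fin (T + 1), z k.1 k.2 * q.scoreCoef k x := by
  have h : z = ∑ k : Fin (N + 2) × Fin (T + 1),
      z k.1 k.2 • fun g t => if (g, t) = k then (1 : ℝ) else 0 := by
    funext g t
    simp only [Finset.sum_apply, Pi.smul_apply, smul_eq_mul, mul_ite, mul_one, mul_zero]
    rw [Finset.sum_ite_eq]
    simp
  nth_rewrite 1 [h]
  rw [score_sum]
  rfl

/-- The regularity of the nuisance functions at a covariate value. -/
structure RegularAt (C x : ℝ) : Prop where
  nonneg : 0 ≤ C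
  isUnit : IsUnit ((weightMatrix q.m x)ᵀ * weightMatrix q.m x).det
  inv_le : ∀ i j, |((weightMatrix q.m x)ᵀ * weightMatrix q.m x)⁻¹ i j| ≤ C
  matrix_le : ∀ t j, |weightMatrix q.m x t j| ≤ C
  w_le : ∀ g, |q.w g x| ≤ C
  w_sum : ∑ g, q.w g x = 1
  fit : (weightMatrix q.m x) *ᵥ (fun j => q.w j.castSucc x) = weightVector q.m x
  p_pos : ∀ g, 0 < q.p g x
  p_le : ∀ g, q.p g x ≤ 1
  p_inv_le : ∀ g, 1 / q.p g x ≤ C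
  bias_le : ∀ g : Fin (N + 1), |q.mDelta g.succ x - q.mΔ x| ≤ C
  m_le : ∀ g t, |q.m g t x| ≤ C

variable {q} {C x : ℝ}

lemma RegularAt.vecU_le (hx : q.RegularAt C x) (g : Fin (N + 1)) : |q.vecU x g| ≤ C := by
  rw [vecU, abs_mul, abs_of_pos (hx.p_pos 0)]
  exact (mul_le_of_le_one_left (abs_nonneg _) (hx.p_le 0)).trans (hx.bias_le g)

lemma RegularAt.r_nonneg (hx : q.RegularAt C x) (g : Fin (N + 1)) : 0 ≤ q.r g x :=
  div_nonneg (hx.p_pos 0).le (hx.p_pos _).le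

lemma RegularAt.r_le (hx : q.RegularAt C x) (g : Fin (N + 1)) : q.r g x ≤ C :=
  (div_le_div_of_nonneg_right (hx.p_le 0) (hx.p_pos _).le).trans (hx.p_inv_le _)

/-- The adjustment `ψ₂` is the derivative of the weights at the residuals. -/
lemma RegularAt.psi2_eq (π : ℝ) {o : Obs N T} (hx : q.RegularAt C o.x) :
    q.psi2 π o = -(1 / π) * q.score o.x fun g t => q.residual o g t.castSucc := by
  have h : q.vecP o = q.weightDeriv o.x fun g t => q.residual o g t.castSucc := by
    have hA : contrastMatrix (fun g t => q.residual o g t.castSucc) = q.matA o := rfl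
    have ha : contrastVector (fun g t => q.residual o g t.castSucc) = q.vecA o := rfl
    -- The exact fit identifies the population least-squares solution with the true weights.
    have hv : ((weightMatrix q.m o.x)ᵀ * weightMatrix q.m o.x)⁻¹ *ᵥ
        ((weightMatrix q.m o.x)ᵀ *ᵥ weightVector q.m o.x) = fun j => q.w j.castSucc o.x := by
      rw [← hx.fit, mulVec_mulVec, mulVec_mulVec, Matrix.mul_assoc, nonsing_inv_mul _ hx.isUnit,
        one_mulVec]
    simp only [vecP, weightDeriv, hv, hA, ha]
    rw [← mulVec_add, ← mulVec_neg, ← mulVec_add]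
    congr 1
    -- With `m₁ = M w` the second summand of `P(S)` cancels the `AᵀM` part of the third.
    rw [← hx.fit, add_mulVec, mulVec_sub, mulVec_mulVec, mulVec_mulVec]
    abel
  rw [psi2, h, score]

/-- The expansion of a `u`-weighted sum of plug-in weights. -/
lemma RegularAt.abs_sum_sub_score_le (hC : 0 ≤ C) : ∃ C' : ℝ, 0 ≤ C' ∧
    ∀ (q : Nuisance N T) (x : ℝ), q.RegularAt C x →
    ∀ (m' : Fin (N + 2) → Fin (T + 2) → ℝ → ℝ) (d e : ℝ),
      d = ∑ g, ∑ t, |m' g t x - q.m g t x| →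
      e = ∑ g, |leastSquaresWeights m' g x - q.w g x| →
      |∑ g, q.vecU x g * (leastSquaresWeights m' g x - q.w g x)
        - q.score x fun g t => m' g t.castSucc x - q.m g t.castSucc x| ≤
        C' * (d * e + d ^ 2 * e + d ^ 2) := by
  obtain ⟨C', hC', H⟩ := abs_leastSquares_sub_le (N := N) (T := T) hC
  -- There are `N` free weights, each multiplied by a difference of two entries of `u`. The factor
  -- four appears because the contrasts have errors up to `2 * d`, which enter squared.
  refine ⟨2 * N * C * (4 * C'), by positivity, ?_⟩
  intro q x hx m' d e hd he
  set v' : Fin N → ℝ := ((weightMatrix m' x)ᵀ * weightMatrix m' x)⁻¹ *ᵥ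
    ((weightMatrix m' x)ᵀ *ᵥ weightVector m' x) with hv'
  set v : Fin N → ℝ := fun j => q.w j.castSucc x with hv
  have hd0 : 0 ≤ d := by
    rw [hd]; exact Finset.sum_nonneg fun _ _ => Finset.sum_nonneg fun _ _ => abs_nonneg _
  have hdg : ∀ g t, |m' g t x - q.m g t x| ≤ d := by
    intro g t
    rw [hd]
    refine le_trans ?_ (Finset.single_le_sum (f := fun g => ∑ t, |m' g t x - q.m g t x|)
      (fun _ _ => Finset.sum_nonneg fun _ _ => abs_nonneg _) (Finset.mem_univ g))
    exact Finset.single_le_sum (f := fun t => |m' g t x - q.m g t x|)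
      (fun _ _ => abs_nonneg _) (Finset.mem_univ t)
  have h2d : ∀ g g' t, |(m' g t x - m' g' t x) - (q.m g t x - q.m g' t x)| ≤ 2 * d := by
    intro g g' t
    have : (m' g t x - m' g' t x) - (q.m g t x - q.m g' t x) =
      (m' g t x - q.m g t x) - (m' g' t x - q.m g' t x) := by ring
    rw [this]
    linarith [abs_sub (m' g t x - q.m g t x) (m' g' t x - q.m g' t x), hdg g t, hdg g' t]
  have hw' : ∀ j : Fin N, leastSquaresWeights m' j.castSucc x = v' j := fun j => by
    simp [leastSquaresWeights, hv']
  have hwl' : leastSquaresWeights m' (Fin.last N) x = 1 - ∑ j, v' j := by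
    simp [leastSquaresWeights, hv']
  have hwl : q.w (Fin.last N) x = 1 - ∑ j, v j := by
    have := hx.w_sum
    rw [Fin.sum_univ_castSucc] at this
    simp only [hv]
    linarith
  have he' : ∑ j, |v' j - v j| ≤ e := by
    rw [he, Fin.sum_univ_castSucc]
    simp only [hw']
    linarith [abs_nonneg (leastSquaresWeights m' (Fin.last N) x - q.w (Fin.last N) x)]
  have he0 : 0 ≤ ∑ j, |v' j - v j| := Finset.sum_nonneg fun _ _ => abs_nonneg _
  set z : Fin (N + 2) → Fin (T + 1) → ℝ :=
    fun g t => m' g t.castSucc x - q.m g t.castSucc x with hz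
  have hzM : contrastMatrix z = weightMatrix m' x - weightMatrix q.m x := by
    ext t j
    simp [contrastMatrix, weightMatrix, hz]
    ring
  have hzv : contrastVector z = weightVector m' x - weightVector q.m x := by
    funext t
    simp [contrastVector, weightVector, hz]
    ring
  have hj : ∀ j, |v' j - v j - q.weightDeriv x z j| ≤
      4 * C' * (d * e + d ^ 2 * e + d ^ 2) := by
    intro j
    have h1 := H (weightMatrix q.m x) (weightMatrix m' x) (weightVector q.m x)
      (weightVector m' x) v v' (2 * d) hx.isUnit hx.inv_le hx.matrix_le (fun j => hx.w_le _)
      hx.fit (fun t j => h2d _ _ _) (fun t => h2d _ _ _) rfl j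
    rw [weightDeriv, hzM, hzv]
    refine h1.trans ?_
    have hk1 := mul_le_mul_of_nonneg_left he' hd0
    have hk2 := mul_le_mul_of_nonneg_left he' (sq_nonneg d)
    have hk3 : 0 ≤ d * e := mul_nonneg hd0 (he0.trans he')
    have h3 : 2 * d * ∑ j, |v' j - v j| + (2 * d) ^ 2 * ∑ j, |v' j - v j| + (2 * d) ^ 2 ≤
        4 * (d * e + d ^ 2 * e + d ^ 2) := by
      nlinarith
    calc _ ≤ C' * (4 * (d * e + d ^ 2 * e + d ^ 2)) := mul_le_mul_of_nonneg_left h3 hC'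
      _ = _ := by ring
  -- Both weight vectors sum to one, so the error of the last weight is minus the sum of the others.
  have hsum : ∑ g, q.vecU x g * (leastSquaresWeights m' g x - q.w g x) - q.score x z =
      ∑ j : Fin N, (q.vecU x j.castSucc - q.vecU x (Fin.last N)) *
        (v' j - v j - q.weightDeriv x z j) := by
    rw [score, dotProduct_snoc, Fin.sum_univ_castSucc, hwl', hwl]
    simp only [hw', sub_mul, mul_sub, Finset.sum_sub_distrib, ← Finset.mul_sum]
    simp only [hv]
    ring
  rw [hsum]
  refine (Finset.abs_sum_le_sum_abs _ _).trans ?_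
  calc _ ≤ ∑ _j : Fin N, 2 * C * (4 * C' * (d * e + d ^ 2 * e + d ^ 2)) := by
        refine Finset.sum_le_sum fun j _ => ?_
        rw [abs_mul]
        refine mul_le_mul ?_ (hj j) (abs_nonneg _) (by positivity)
        linarith [abs_sub (q.vecU x j.castSucc) (q.vecU x (Fin.last N)),
          hx.vecU_le j.castSucc, hx.vecU_le (Fin.last N)]
    _ = _ := by
      rw [Finset.sum_const, Finset.card_univ, Fintype.card_fin, nsmul_eq_mul]
      ring

/-- Contrasts of an indicator array are at most one in absolute value; the constant multiplies the
entrywise bounds of the remaining factors. -/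
lemma RegularAt.abs_scoreCoef_le (hC : 0 ≤ C) : ∃ C' : ℝ, 0 ≤ C' ∧
    ∀ (q : Nuisance N T) (x : ℝ), q.RegularAt C x → ∀ k, |q.scoreCoef k x| ≤ C' := by
  refine ⟨N * (C * (C * (N * (C * ((T + 1 : ℕ) * (1 + 1 * (N * C))))))) +
    C * (N * (C * (N * (C * ((T + 1 : ℕ) * (1 + 1 * (N * C)))))) ), by positivity, ?_⟩
  intro q x hx k
  set z : Fin (N + 2) → Fin (T + 1) → ℝ := fun g t => if (g, t) = k then 1 else 0 with hz
  have h1 : ∀ g g' t, |z g t - z g' t| ≤ 1 := by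
    intro g g' t
    simp only [hz]
    split_ifs <;> norm_num
  have h2 : ∀ t, |(contrastVector z - contrastMatrix z *ᵥ fun j => q.w j.castSucc x) t| ≤
      1 + 1 * (N * C) := by
    intro t
    refine (abs_sub _ _).trans (add_le_add (h1 _ _ _) ?_)
    have := abs_mulVec_le_card (A := contrastMatrix z) (fun t j => h1 _ _ _) zero_le_one
      (fun j : Fin N => hx.w_le j.castSucc) t
    rwa [Fintype.card_fin] at this
  have h3 := abs_mulVec_le_card (A := (weightMatrix q.m x)ᵀ) (fun i j => hx.matrix_le j i) hC h2
  have h4 := abs_mulVec_le_card hx.inv_le hC h3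
  rw [Fintype.card_fin, Fintype.card_fin] at h4
  have h5 : ∀ j, |q.weightDeriv x z j| ≤ _ := h4
  rw [scoreCoef, score, dotProduct_snoc]
  refine (abs_add_le _ _).trans (add_le_add ?_ ?_)
  · refine (Finset.abs_sum_le_sum_abs _ _).trans ?_
    refine (Finset.sum_le_sum fun j _ => ?_).trans (b := ∑ _j : Fin N,
      (C * (C * (N * (C * ((T + 1 : ℕ) * (1 + 1 * (N * C)))))))) ?_
    · rw [abs_mul]
      exact mul_le_mul (hx.vecU_le _) (h5 j) (abs_nonneg _) hC
    · rw [Finset.sum_const, Finset.card_univ, Fintype.card_fin, nsmul_eq_mul]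
  · rw [abs_mul, abs_neg]
    refine mul_le_mul (hx.vecU_le _) ?_ (abs_nonneg _) hC
    refine (Finset.abs_sum_le_sum_abs _ _).trans ?_
    refine (Finset.sum_le_sum fun j _ => h5 j).trans ?_
    rw [Finset.sum_const, Finset.card_univ, Fintype.card_fin, nsmul_eq_mul]

lemma measurable_weightMatrix (hm : ∀ g t, Measurable (q.m g t)) (i : Fin (T + 1)) (j : Fin N) :
    Measurable fun x => weightMatrix q.m x i j := (hm _ _).sub (hm _ _)

lemma measurable_gram_inv (hm : ∀ g t, Measurable (q.m g t)) (i j : Fin N) :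
    Measurable fun x => ((weightMatrix q.m x)ᵀ * weightMatrix q.m x)⁻¹ i j :=
  measurable_matrix_inv (measurable_matrix_mul (fun i j => measurable_weightMatrix hm j i)
    (measurable_weightMatrix hm)) i j

lemma measurable_scoreCoef (hp : ∀ g, Measurable (q.p g)) (hm : ∀ g t, Measurable (q.m g t))
    (hmΔ : Measurable q.mΔ) (hw : ∀ g, Measurable (q.w g)) (k : Fin (N + 2) × Fin (T + 1)) :
    Measurable (q.scoreCoef k) := by
  have hu : ∀ g, Measurable fun x => q.vecU x g := fun g =>
    (hp 0).mul (((hm _ _).sub (hm _ _)).sub hmΔ)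
  have hd : ∀ z j, Measurable fun x => q.weightDeriv x z j := fun z =>
    measurable_mulVec (measurable_gram_inv hm)
      (measurable_mulVec (fun i j => measurable_weightMatrix hm j i) fun t =>
        measurable_const.sub (measurable_mulVec (A := fun _ => contrastMatrix z)
          (v := fun x j => q.w j.castSucc x) (fun _ _ => measurable_const) (fun j => hw _) t))
  have hz : ∀ z, Measurable fun x => q.score x z := fun z => by
    have hs : Measurable fun x => -∑ j, q.weightDeriv x z j :=
      (Finset.measurable_sum _ fun j _ => hd z j).neg
    have hsn := measurable_snoc (hd z) hs
    simp only [score, dotProduct]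
    exact Finset.measurable_sum _ fun g _ => (hu g).mul (hsn g)
  exact hz _

end Nuisance

end Score

end SyntheticDiD

namespace SyntheticDiD

/-! ### Regression functions and conditional moments. -/

section Regression

variable {Ω : Type*} [MeasurableSpace Ω] {μ : Measure Ω} {X Z Z' : Ω → ℝ} {f f' : ℝ → ℝ}

lemma IsRegression.sub (h : IsRegression μ X Z f) (h' : IsRegression μ X Z' f') :
    IsRegression μ X (fun ω => Z ω - Z' ω) fun x => f x - f' x := by
  refine ⟨h.1.sub h'.1, h.2.1.sub h'.2.1, ?_⟩
  filter_upwards [h.2.2, h'.2.2, condExp_sub h.2.1 h'.2.1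
    (MeasurableSpace.comap X inferInstance)] with ω h1 h2 h3
  rw [show (fun ω => Z ω - Z' ω) = Z - Z' from rfl, h3, Pi.sub_apply, ← h1, ← h2]

lemma isRegression_comp [IsFiniteMeasure μ] (hX : Measurable X) (hf : Measurable f)
    (hi : Integrable (fun ω => f (X ω)) μ) : IsRegression μ X (fun ω => f (X ω)) f := by
  refine ⟨hf, hi, ?_⟩
  have h := condExp_of_stronglyMeasurable (f := fun ω => f (X ω)) hX.comap_le
    (hf.comp (comap_measurable X)).stronglyMeasurable hi
  rw [h]

lemma IsRegression.congr_ae (h : IsRegression μ X Z f) (hZ : Z =ᵐ[μ] Z') :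
    IsRegression μ X Z' f :=
  ⟨h.1, h.2.1.congr hZ, h.2.2.trans (condExp_congr_ae hZ)⟩

lemma IsRegression.ae_eq (h : IsRegression μ X Z f) (h' : IsRegression μ X Z f') :
    ∀ᵐ ω ∂μ, f (X ω) = f' (X ω) := h.2.2.trans h'.2.2.symm

/-- Pull-out property of the conditional expectation, followed by integration. -/
lemma IsRegression.integral_mul [IsFiniteMeasure μ] (hX : Measurable X)
    (h : IsRegression μ X Z f) {b : ℝ → ℝ} (hb : Measurable b)
    (hi : Integrable (fun ω => b (X ω) * Z ω) μ) :
    ∫ ω, b (X ω) * Z ω ∂μ = ∫ ω, b (X ω) * f (X ω) ∂μ := by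
  have h1 : μ[fun ω => b (X ω) * Z ω | MeasurableSpace.comap X inferInstance] =ᵐ[μ]
      fun ω => b (X ω) * (μ[Z | MeasurableSpace.comap X inferInstance]) ω :=
    condExp_mul_of_stronglyMeasurable_left (f := fun ω => b (X ω))
      (hb.comp (comap_measurable X)).stronglyMeasurable hi h.2.1
  rw [← integral_condExp hX.comap_le (f := fun ω => b (X ω) * Z ω)]
  refine integral_congr_ae ?_
  filter_upwards [h1, h.2.2] with ω h2 h3
  rw [h2, h3]

/-- A bound on the conditional second moment bounds the regression function. -/
lemma IsRegression.abs_le [IsFiniteMeasure μ] (hX : Measurable X) (h : IsRegression μ X Z f)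
    (hZ : Integrable (fun ω => Z ω ^ 2) μ) {C : ℝ}
    (hC : ∀ᵐ ω ∂μ, (μ[fun ω => Z ω ^ 2 | MeasurableSpace.comap X inferInstance]) ω ≤ C) :
    ∀ᵐ ω ∂μ, |f (X ω)| ≤ (1 + C) / 2 := by
  set m : MeasurableSpace Ω := MeasurableSpace.comap X inferInstance with hm
  have hmle : m ≤ _ := hX.comap_le
  -- The inequality `|z| ≤ (1 + z²) / 2`, applied to `Z` and `-Z`, takes the place of conditional
  -- Jensen.
  have hi : Integrable (fun ω => (1 / 2 : ℝ) • (fun ω => 1 + Z ω ^ 2) ω) μ :=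
    (((integrable_const 1).add hZ).smul (1 / 2 : ℝ))
  have e1 : μ[fun ω => (1 / 2 : ℝ) • (fun ω => 1 + Z ω ^ 2) ω | m] =ᵐ[μ]
      fun ω => (1 / 2 : ℝ) * (1 + (μ[fun ω => Z ω ^ 2 | m]) ω) := by
    have h1 := condExp_smul (μ := μ) (1 / 2 : ℝ) (fun ω => 1 + Z ω ^ 2) m
    have h2 := condExp_add (μ := μ) (integrable_const (1 : ℝ)) hZ m
    filter_upwards [h1, h2] with ω h3 h4
    have h3' : (μ[fun ω => (1 / 2 : ℝ) • (fun ω => 1 + Z ω ^ 2) ω | m]) ω =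
      (1 / 2 : ℝ) • (μ[fun ω => 1 + Z ω ^ 2 | m]) ω := h3
    have h4' : (μ[fun ω => 1 + Z ω ^ 2 | m]) ω =
      (μ[fun _ => (1 : ℝ) | m]) ω + (μ[fun ω => Z ω ^ 2 | m]) ω := h4
    rw [h3', h4', condExp_const hmle, smul_eq_mul]
  have h1 : μ[Z | m] ≤ᵐ[μ] μ[fun ω => (1 / 2 : ℝ) • (fun ω => 1 + Z ω ^ 2) ω | m] :=
    condExp_mono h.2.1 hi (Eventually.of_forall fun ω => by
      simp only [smul_eq_mul]
      nlinarith [sq_nonneg (Z ω - 1)])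
  have h2 : μ[-Z | m] ≤ᵐ[μ] μ[fun ω => (1 / 2 : ℝ) • (fun ω => 1 + Z ω ^ 2) ω | m] :=
    condExp_mono h.2.1.neg hi (Eventually.of_forall fun ω => by
      simp only [smul_eq_mul, Pi.neg_apply]
      nlinarith [sq_nonneg (Z ω + 1)])
  filter_upwards [h.2.2, h1, h2, e1, hC, condExp_neg Z m (μ := μ)] with ω k1 k2 k3 k4 k5 k6
  rw [k4] at k2 k3
  rw [k6, Pi.neg_apply] at k3
  rw [k1, _root_.abs_le]
  change -((1 + C) / 2) ≤ (μ[Z | m]) ω ∧ (μ[Z | m]) ω ≤ (1 + C) / 2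
  constructor <;> linarith

/-- A bound on the conditional second moment bounds weighted second moments. -/
lemma lintegral_mul_sq_le [IsFiniteMeasure μ] (hX : Measurable X) (hZm : Measurable Z)
    (hZ : Integrable (fun ω => Z ω ^ 2) μ) {C : ℝ}
    (hC : ∀ᵐ ω ∂μ, (μ[fun ω => Z ω ^ 2 | MeasurableSpace.comap X inferInstance]) ω ≤ C)
    {b : ℝ → ℝ≥0∞} (hb : Measurable b) :
    ∫⁻ ω, b (X ω) * ‖Z ω‖ₑ ^ 2 ∂μ ≤ ENNReal.ofReal C * ∫⁻ ω, b (X ω) ∂μ := by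
  -- Weighting by `Z²` and pushing forward to the covariate gives a measure dominated by a multiple
  -- of its law. On sets this is the defining property of the conditional expectation, and the
  -- comparison of measures extends it to every nonnegative `b`.
  have hle : (μ.withDensity fun ω => ‖Z ω‖ₑ ^ 2).map X ≤ ENNReal.ofReal C • μ.map X := by
    refine Measure.le_iff.2 fun B hB => ?_
    rw [Measure.map_apply hX hB, withDensity_apply _ (hX hB), Measure.smul_apply,
      Measure.map_apply hX hB, smul_eq_mul]
    have h1 : ∫⁻ ω in X ⁻¹' B, ‖Z ω‖ₑ ^ 2 ∂μ =
        ENNReal.ofReal (∫ ω in X ⁻¹' B, Z ω ^ 2 ∂μ) := by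
      rw [ofReal_integral_eq_lintegral_ofReal hZ.integrableOn
        (Eventually.of_forall fun _ => sq_nonneg _)]
      refine lintegral_congr fun ω => ?_
      rw [← enorm_pow, Real.enorm_eq_ofReal (sq_nonneg _)]
    rw [h1, ← setIntegral_condExp hX.comap_le hZ ⟨B, hB, rfl⟩]
    calc _ ≤ ENNReal.ofReal (∫ _ω in X ⁻¹' B, C ∂μ) := by
          refine ENNReal.ofReal_le_ofReal (integral_mono_ae integrable_condExp.integrableOn
            (integrable_const _) (ae_restrict_of_ae hC))
      _ = ENNReal.ofReal C * μ (X ⁻¹' B) := by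
        rw [setIntegral_const, smul_eq_mul, mul_comm]
        by_cases h0 : 0 ≤ C
        · rw [ENNReal.ofReal_mul h0, ofReal_measureReal]
        · rw [not_le] at h0
          rw [ENNReal.ofReal_of_nonpos h0.le, ENNReal.ofReal_of_nonpos, zero_mul]
          exact mul_nonpos_of_nonpos_of_nonneg h0.le measureReal_nonneg
  calc ∫⁻ ω, b (X ω) * ‖Z ω‖ₑ ^ 2 ∂μ = ∫⁻ x, b x ∂(μ.withDensity fun ω => ‖Z ω‖ₑ ^ 2).map X := by
        rw [lintegral_map hb hX, lintegral_withDensity_eq_lintegral_mul _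
          (hZm.enorm.pow_const 2) (g := fun ω => b (X ω)) (hb.comp hX)]
        refine lintegral_congr fun ω => ?_
        rw [Pi.mul_apply, mul_comm]
    _ ≤ ∫⁻ x, b x ∂(ENNReal.ofReal C • μ.map X) := lintegral_mono' hle le_rfl
    _ = _ := by rw [lintegral_smul_measure, lintegral_map hb hX, smul_eq_mul]

end Regression

/-! ### Conditioning on the group. -/

section Groups

variable {Ω : Type*} [MeasurableSpace Ω] {P : Measure Ω} [IsProbabilityMeasure P] {N : ℕ}
  {G : Ω → Fin (N + 2)} {X : Ω → ℝ} {p : ℝ → ℝ} {g : Fin (N + 2)}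

/-- The propensity score is the density of the covariate within a group relative to its overall law;
integrals of functions of the covariate over a group become integrals weighted by `p`. -/
lemma map_restrict_group (hG : Measurable G) (hX : Measurable X)
    (hp : IsRegression P X ((G ⁻¹' {g}).indicator fun _ => 1) p)
    (hpos : ∀ᵐ ω ∂P, 0 < p (X ω)) :
    (P.restrict (G ⁻¹' {g})).map X = (P.map X).withDensity fun x => ENNReal.ofReal (p x) := by
  have hA : MeasurableSet (G ⁻¹' {g}) := hG (measurableSet_singleton g)
  ext B hB
  rw [Measure.map_apply hX hB, Measure.restrict_apply (hX hB), withDensity_apply _ hB,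
    setLIntegral_map hB hp.1.ennreal_ofReal hX]
  have hpi : Integrable (fun ω => p (X ω)) P := integrable_condExp.congr hp.2.2.symm
  rw [← ofReal_integral_eq_lintegral_ofReal hpi.integrableOn
    (ae_restrict_of_ae (hpos.mono fun ω h => h.le)),
    integral_congr_ae (ae_restrict_of_ae hp.2.2), setIntegral_condExp hX.comap_le hp.2.1
      ⟨B, hB, rfl⟩, setIntegral_indicator hA, setIntegral_const, smul_eq_mul, mul_one,
    ofReal_measureReal]

lemma regression_ind_le_one (hX : Measurable X)
    (hp : IsRegression P X ((G ⁻¹' {g}).indicator fun _ => 1) p) :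
    ∀ᵐ ω ∂P, p (X ω) ≤ 1 := by
  have h1 := condExp_mono (μ := P) (m := MeasurableSpace.comap X inferInstance) hp.2.1
    (integrable_const (1 : ℝ)) (Eventually.of_forall fun ω =>
      Set.indicator_le_self' (fun _ _ => zero_le_one) ω)
  rw [condExp_const hX.comap_le] at h1
  filter_upwards [hp.2.2, h1] with ω h2 h3
  rw [h2]
  exact h3

/-- The probability of the group is the integral of its propensity score, which overlap makes
positive. -/
lemma measure_group_ne_zero (hG : Measurable G) (hX : Measurable X)
    (hp : IsRegression P X ((G ⁻¹' {g}).indicator fun _ => 1) p)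
    (hpos : ∀ᵐ ω ∂P, 0 < p (X ω)) : P (G ⁻¹' {g}) ≠ 0 := by
  intro h0
  have h1 := congrArg (fun μ : Measure ℝ => μ Set.univ) (map_restrict_group hG hX hp hpos)
  simp only [Measure.map_apply hX .univ, Set.preimage_univ, Measure.restrict_apply_univ, h0,
    withDensity_apply _ MeasurableSet.univ, Measure.restrict_univ] at h1
  rw [lintegral_map hp.1.ennreal_ofReal hX] at h1
  have h2 := (lintegral_eq_zero_iff (hp.1.ennreal_ofReal.comp hX)).1 h1.symm
  have h3 : ∀ᵐ _ω ∂P, False := by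
    filter_upwards [h2, hpos] with ω h4 h5
    simp only [Function.comp_apply, Pi.zero_apply, ENNReal.ofReal_eq_zero] at h4
    linarith
  rw [ae_iff] at h3
  simp at h3

/-- A positive density can be inverted. This is how overlap carries statements that hold almost
surely within one group over to almost every covariate value. -/
lemma absolutelyContinuous_map_givenGroup (hG : Measurable G) (hX : Measurable X)
    (hp : IsRegression P X ((G ⁻¹' {g}).indicator fun _ => 1) p)
    (hpos : ∀ᵐ ω ∂P, 0 < p (X ω)) : P.map X ≪ (givenGroup P G g).map X := by
  have h1 : (givenGroup P G g).map X = (P (G ⁻¹' {g}))⁻¹ • (P.restrict (G ⁻¹' {g})).map X :=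
    Measure.map_smul ..
  rw [h1, map_restrict_group hG hX hp hpos]
  refine (withDensity_absolutelyContinuous' hp.1.ennreal_ofReal.aemeasurable ?_).trans
    (Measure.absolutelyContinuous_smul (ENNReal.inv_ne_zero.2 (measure_ne_top _ _)))
  have h2 : ∀ᵐ x ∂P.map X, 0 < p x :=
    (ae_map_iff hX.aemeasurable (measurableSet_lt measurable_const hp.1)).2 hpos
  filter_upwards [h2] with x hx
  simpa using hx

lemma ae_map_of_ae_givenGroup (hG : Measurable G) (hX : Measurable X)
    (hp : IsRegression P X ((G ⁻¹' {g}).indicator fun _ => 1) p)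
    (hpos : ∀ᵐ ω ∂P, 0 < p (X ω)) {s : ℝ → Prop} (hs : MeasurableSet {x | s x})
    (h : ∀ᵐ ω ∂(givenGroup P G g), s (X ω)) : ∀ᵐ x ∂P.map X, s x :=
  (absolutelyContinuous_map_givenGroup hG hX hp hpos).ae_le
    ((ae_map_iff hX.aemeasurable hs).2 h)

lemma integral_restrict_eq_integral_map (hG : Measurable G) (hX : Measurable X)
    (hp : IsRegression P X ((G ⁻¹' {g}).indicator fun _ => 1) p)
    (hpos : ∀ᵐ ω ∂P, 0 < p (X ω)) {b : ℝ → ℝ} (hb : Measurable b) :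
    ∫ ω in G ⁻¹' {g}, b (X ω) ∂P = ∫ x, b x * p x ∂P.map X := by
  rw [← integral_map (μ := P.restrict (G ⁻¹' {g})) hX.aemeasurable hb.aestronglyMeasurable,
    map_restrict_group hG hX hp hpos,
    integral_withDensity_eq_integral_toReal_smul hp.1.ennreal_ofReal (by simp)]
  have h2 : ∀ᵐ x ∂P.map X, 0 < p x :=
    (ae_map_iff hX.aemeasurable (measurableSet_lt measurable_const hp.1)).2 hpos
  refine integral_congr_ae ?_
  filter_upwards [h2] with x hx
  rw [ENNReal.toReal_ofReal hx.le, smul_eq_mul, mul_comm]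

omit [IsProbabilityMeasure P] in
instance : IsFiniteMeasure (givenGroup P G g) :=
  inferInstanceAs (IsFiniteMeasure (P[|G ⁻¹' {g}]))

lemma integrable_givenGroup_iff (h0 : P (G ⁻¹' {g}) ≠ 0) {Z : Ω → ℝ} :
    Integrable Z (givenGroup P G g) ↔ Integrable Z (P.restrict (G ⁻¹' {g})) := by
  have : givenGroup P G g = (P (G ⁻¹' {g}))⁻¹ • P.restrict (G ⁻¹' {g}) := rfl
  rw [this, integrable_smul_measure (ENNReal.inv_ne_zero.2 (measure_ne_top _ _))
    (ENNReal.inv_ne_top.2 h0)]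

omit [IsProbabilityMeasure P] in
lemma integral_givenGroup (Z : Ω → ℝ) :
    ∫ ω, Z ω ∂(givenGroup P G g) = (P.real (G ⁻¹' {g}))⁻¹ * ∫ ω in G ⁻¹' {g}, Z ω ∂P := by
  have : givenGroup P G g = (P (G ⁻¹' {g}))⁻¹ • P.restrict (G ⁻¹' {g}) := rfl
  rw [this, integral_smul_measure, ENNReal.toReal_inv, smul_eq_mul, measureReal_def]

omit [IsProbabilityMeasure P] in
lemma lintegral_givenGroup (Z : Ω → ℝ≥0∞) :
    ∫⁻ ω, Z ω ∂(givenGroup P G g) = (P (G ⁻¹' {g}))⁻¹ * ∫⁻ ω in G ⁻¹' {g}, Z ω ∂P := by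
  have : givenGroup P G g = (P (G ⁻¹' {g}))⁻¹ • P.restrict (G ⁻¹' {g}) := rfl
  rw [this, lintegral_smul_measure, smul_eq_mul]

/-- The normalizing probability of the group appears on both sides of the conditional identity and
cancels. -/
lemma IsRegression.setIntegral_mul (hG : Measurable G) (hX : Measurable X)
    (hp : IsRegression P X ((G ⁻¹' {g}).indicator fun _ => 1) p)
    (hpos : ∀ᵐ ω ∂P, 0 < p (X ω)) {Z : Ω → ℝ} {f b : ℝ → ℝ}
    (h : IsRegression (givenGroup P G g) X Z f) (hb : Measurable b)
    (hi : Integrable (fun ω => b (X ω) * Z ω) (P.restrict (G ⁻¹' {g}))) :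
    ∫ ω in G ⁻¹' {g}, b (X ω) * Z ω ∂P = ∫ x, b x * (p x * f x) ∂P.map X := by
  have h0 := measure_group_ne_zero hG hX hp hpos
  have h1 := h.integral_mul hX hb ((integrable_givenGroup_iff h0).2 hi)
  rw [integral_givenGroup, integral_givenGroup] at h1
  have h2 : (P.real (G ⁻¹' {g}))⁻¹ ≠ 0 :=
    inv_ne_zero (by rwa [measureReal_ne_zero_iff])
  rw [mul_left_cancel₀ h2 h1,
    integral_restrict_eq_integral_map hG hX hp hpos (b := fun x => b x * f x) (hb.mul h.1)]
  exact integral_congr_ae (Eventually.of_forall fun x => by dsimp only; ring)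

end Groups

end SyntheticDiD

namespace SyntheticDiD

variable {N T : ℕ}

/-- Moments of the law `Q` of an observation whose covariate has law `F`, in terms of the nuisance
functions `q`. -/
structure Population (Q : Measure (Obs N T)) (F : Measure ℝ) (q : Nuisance N T) (C : ℝ) :
    Prop where
  map_x : Q.map (fun o => o.x) = F
  measurable_p : ∀ g, Measurable (q.p g)
  measurable_m : ∀ g t, Measurable (q.m g t)
  measurable_mΔ : Measurable q.mΔ
  measurable_w : ∀ g, Measurable (q.w g)
  regular : ∀ᵐ x ∂F, q.RegularAt C x
  memLp_y : ∀ t, MemLp (fun o => o.y t) 2 Q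
  memLp_diff : ∀ g, MemLp (fun o => o.ind g * (o.dy - q.mΔ o.x)) 2 Q
  integral_ind : ∀ g b, Measurable b → ∫ o, b o.x * o.ind g ∂Q = ∫ x, b x * q.p g x ∂F
  integral_y : ∀ g t b, Measurable b → Integrable (fun o => b o.x * (o.ind g * o.y t)) Q →
    ∫ o, b o.x * (o.ind g * o.y t) ∂Q = ∫ x, b x * (q.p g x * q.m g t x) ∂F
  integral_diff : ∀ g b, Measurable b →
    Integrable (fun o => b o.x * (o.ind g * (o.dy - q.mΔ o.x))) Q →
    ∫ o, b o.x * (o.ind g * (o.dy - q.mΔ o.x)) ∂Q =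
      ∫ x, b x * (q.p g x * (q.mDelta g x - q.mΔ x)) ∂F
  lintegral_diff_sq : ∀ g (b : ℝ → ℝ≥0∞), Measurable b →
    ∫⁻ o, b o.x * ‖o.ind g * (o.dy - q.mΔ o.x)‖ₑ ^ 2 ∂Q ≤ ENNReal.ofReal C * ∫⁻ x, b x ∂F

/-! ### Uniform bounds from compactness and invertibility. -/

section Bounds

lemma exists_ae_bound {α ι : Type*} [MeasurableSpace α] [Finite ι] {μ : Measure α}
    {f : ι → α → ℝ} (h : ∀ i, ∃ C : ℝ, ∀ᵐ x ∂μ, f i x ≤ C) :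
    ∃ C : ℝ, ∀ᵐ x ∂μ, ∀ i, f i x ≤ C := by
  choose C hC using h
  have := Fintype.ofFinite ι
  refine ⟨∑ i, |C i|, ?_⟩
  rw [ae_all_iff]
  intro i
  filter_upwards [hC i] with x hx
  exact hx.trans ((le_abs_self _).trans
    (Finset.single_le_sum (f := fun i => |C i|) (fun _ _ => abs_nonneg _) (Finset.mem_univ i)))

/-- A singular Gram matrix would have the eigenvalue zero. -/
lemma isUnit_det_gram {m n : Type*} [Fintype m] [Fintype n] [DecidableEq n] {M : Matrix m n ℝ}
    {c : ℝ} (hc : 0 < c)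
    (h : ∀ lam : ℝ, Module.End.HasEigenvalue (Matrix.toLin' (Mᵀ * M)) lam → c < lam) :
    IsUnit (Mᵀ * M).det := by
  rw [isUnit_iff_ne_zero]
  intro h0
  obtain ⟨v, hv0, hv⟩ := exists_mulVec_eq_zero_iff.2 h0
  have h1 : Module.End.HasEigenvalue (Matrix.toLin' (Mᵀ * M)) 0 :=
    Module.End.hasEigenvalue_of_hasEigenvector (x := v)
      (Module.End.hasEigenvector_iff.2 ⟨Module.End.mem_eigenspace_iff.2 (by simp [hv]), hv0⟩)
  exact absurd (h 0 h1) (not_lt.2 hc.le)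

lemma continuousOn_matrix_inv {α n : Type*} [TopologicalSpace α] [Fintype n] [DecidableEq n]
    {A : α → Matrix n n ℝ} {s : Set α} (hA : ∀ i j, ContinuousOn (fun a => A a i j) s)
    (hdet : ∀ a ∈ s, IsUnit (A a).det) (i j : n) : ContinuousOn (fun a => (A a)⁻¹ i j) s := by
  have h0 : ContinuousOn (fun a => (fun i j => A a i j : n → n → ℝ)) s :=
    continuousOn_pi.2 fun i => continuousOn_pi.2 fun j => hA i j
  have hof : Continuous fun B : n → n → ℝ => Matrix.of B := continuous_id
  have h1 : Continuous fun B : n → n → ℝ => (Matrix.of B).det := hof.matrix_det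
  have h2 : Continuous fun B : n → n → ℝ => (Matrix.of B).adjugate i j :=
    hof.matrix_adjugate.matrix_elem i j
  have h3 : (fun a => (A a)⁻¹ i j) = fun a => (A a).det⁻¹ * (A a).adjugate i j := by
    funext a
    rw [inv_def, Matrix.smul_apply, Ring.inverse_eq_inv', smul_eq_mul]
  rw [h3]
  exact ((h1.comp_continuousOn h0).inv₀ fun a ha => (hdet a ha).ne_zero).mul
    (h2.comp_continuousOn h0)

/-- The inverse is continuous where the determinant does not vanish, hence bounded on a compact set.
-/
lemma exists_bound_gram_inv {q : Nuisance N T} {s : Set ℝ} (hs : IsCompact s)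
    (hm : ∀ g t, ContinuousOn (q.m g t) s)
    (hdet : ∀ x ∈ s, IsUnit ((weightMatrix q.m x)ᵀ * weightMatrix q.m x).det) :
    ∃ C : ℝ, ∀ x ∈ s, ∀ i j, |((weightMatrix q.m x)ᵀ * weightMatrix q.m x)⁻¹ i j| ≤ C := by
  have hM : ∀ t j, ContinuousOn (fun x => weightMatrix q.m x t j) s :=
    fun t j => (hm _ _).sub (hm _ _)
  have hMM : ∀ i j, ContinuousOn (fun x => ((weightMatrix q.m x)ᵀ * weightMatrix q.m x) i j) s := by
    intro i j
    simp only [Matrix.mul_apply, transpose_apply]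
    exact continuousOn_finsetSum _ fun k _ => (hM k i).mul (hM k j)
  have h1 := fun i j => hs.exists_bound_of_continuousOn (continuousOn_matrix_inv hMM hdet i j)
  choose C hC using h1
  refine ⟨∑ i, ∑ j, |C i j|, fun x hx i j => ?_⟩
  refine (hC i j x hx).trans ((le_abs_self _).trans ?_)
  refine le_trans ?_ (Finset.single_le_sum (f := fun i => ∑ j, |C i j|)
    (fun _ _ => Finset.sum_nonneg fun _ _ => abs_nonneg _) (Finset.mem_univ i))
  exact Finset.single_le_sum (f := fun j => |C i j|) (fun _ _ => abs_nonneg _) (Finset.mem_univ j)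

end Bounds

/-! ### Transfer from the probability space to the law of an observation. -/

section Observation

variable {Ω : Type*} [MeasurableSpace Ω] {P : Measure Ω}
  {Y0 Y1 : Fin (T + 2) → Ω → ℝ} {G : Ω → Fin (N + 2)} {X : Ω → ℝ}

lemma measurable_observedY (hY0 : ∀ t, Measurable (Y0 t)) (hY1 : ∀ t, Measurable (Y1 t))
    (hG : Measurable G) (t : Fin (T + 2)) : Measurable (observedY Y0 Y1 G t) := by
  have h1 : Measurable fun ω => if G ω = 0 then (1 : ℝ) else 0 :=
    (measurable_from_top (f := fun j : Fin (N + 2) => if j = 0 then (1 : ℝ) else 0)).comp hG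
  exact (h1.mul (hY1 t)).add ((measurable_const.sub h1).mul (hY0 t))

lemma measurable_observation (hY0 : ∀ t, Measurable (Y0 t)) (hY1 : ∀ t, Measurable (Y1 t))
    (hG : Measurable G) (hX : Measurable X) : Measurable (observation Y0 Y1 G X) :=
  (measurable_pi_iff.2 fun t => measurable_observedY hY0 hY1 hG t).prodMk (hG.prodMk hX)

omit [MeasurableSpace Ω] in
lemma observation_ind_mul (g : Fin (N + 2)) (H : Obs N T → ℝ) (ω : Ω) :
    (observation Y0 Y1 G X ω).ind g * H (observation Y0 Y1 G X ω) =
      (G ⁻¹' {g}).indicator (fun ω => H (observation Y0 Y1 G X ω)) ω := by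
  by_cases h : G ω = g <;> simp [Obs.ind, observation, h]

lemma integral_ind_mul (hob : Measurable (observation Y0 Y1 G X)) (hG : Measurable G)
    (g : Fin (N + 2)) {H : Obs N T → ℝ} (hH : Measurable H) :
    ∫ o, o.ind g * H o ∂(P.map (observation Y0 Y1 G X)) =
      ∫ ω in G ⁻¹' {g}, H (observation Y0 Y1 G X ω) ∂P := by
  have hgH : Measurable fun o : Obs N T => o.ind g * H o := (measurable_obs_ind g).mul hH
  rw [integral_map hob.aemeasurable hgH.aestronglyMeasurable,
    ← integral_indicator (hG (measurableSet_singleton g))]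
  exact integral_congr_ae (Eventually.of_forall fun ω => observation_ind_mul g H ω)

lemma integrable_ind_mul_iff (hob : Measurable (observation Y0 Y1 G X)) (hG : Measurable G)
    (g : Fin (N + 2)) {H : Obs N T → ℝ} (hH : Measurable H) :
    Integrable (fun o => o.ind g * H o) (P.map (observation Y0 Y1 G X)) ↔
      Integrable (fun ω => H (observation Y0 Y1 G X ω)) (P.restrict (G ⁻¹' {g})) := by
  have hgH : Measurable fun o : Obs N T => o.ind g * H o := (measurable_obs_ind g).mul hH
  rw [integrable_map_measure hgH.aestronglyMeasurable
    hob.aemeasurable, ← IntegrableOn, ← integrable_indicator_iff (hG (measurableSet_singleton g))]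
  exact integrable_congr (Eventually.of_forall fun ω => observation_ind_mul g H ω)

lemma lintegral_ind_mul_sq (hob : Measurable (observation Y0 Y1 G X)) (hG : Measurable G)
    (g : Fin (N + 2)) {H : Obs N T → ℝ} (hH : Measurable H) {b : Obs N T → ℝ≥0∞}
    (hb : Measurable b) :
    ∫⁻ o, b o * ‖o.ind g * H o‖ₑ ^ 2 ∂(P.map (observation Y0 Y1 G X)) =
      ∫⁻ ω in G ⁻¹' {g}, b (observation Y0 Y1 G X ω) * ‖H (observation Y0 Y1 G X ω)‖ₑ ^ 2 ∂P := by
  have hgH : Measurable fun o : Obs N T => o.ind g * H o := (measurable_obs_ind g).mul hH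
  have hgb : Measurable fun o : Obs N T => b o * ‖o.ind g * H o‖ₑ ^ 2 :=
    hb.mul (hgH.enorm.pow_const 2)
  rw [lintegral_map hgb hob,
    ← lintegral_indicator (hG (measurableSet_singleton g))]
  refine lintegral_congr fun ω => ?_
  rw [observation_ind_mul]
  by_cases h : ω ∈ G ⁻¹' {g} <;> simp [h]

lemma ae_givenGroup_of_ae {g : Fin (N + 2)} (hG : Measurable G) {s : Ω → Prop}
    (h : ∀ᵐ ω ∂P, G ω = g → s ω) : ∀ᵐ ω ∂(givenGroup P G g), s ω := by
  have h1 : ∀ᵐ ω ∂P.restrict (G ⁻¹' {g}), s ω := by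
    filter_upwards [ae_restrict_mem (hG (measurableSet_singleton g)), ae_restrict_of_ae h]
      with ω h2 h3
    exact h3 h2
  exact Measure.smul_absolutelyContinuous.ae_le h1

end Observation

/-! ### Population moments under the synthetic control assumption. -/

section Main

variable {Ω : Type*} [MeasurableSpace Ω] {P : Measure Ω} [IsProbabilityMeasure P]
  {Y0 Y1 : Fin (T + 2) → Ω → ℝ} {G : Ω → Fin (N + 2)} {X : Ω → ℝ} {q : Nuisance N T}

/-- Under the synthetic control assumption and no anticipation, the weights reproduce the
regressions of the treated group before treatment, and those of its untreated outcome after. -/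
lemma syntheticControl_ae (hG : Measurable G) (hX : Measurable X)
    (hNA : ∀ t : Fin (T + 1), Y1 t.castSucc =ᵐ[P] Y0 t.castSucc)
    (hp : ∀ g, IsRegression P X ((G ⁻¹' {g}).indicator fun _ => 1) (q.p g))
    (hm : ∀ g t, IsRegression (givenGroup P G g) X (observedY Y0 Y1 G t) (q.m g t))
    (hoverlap : ∀ g, ∀ᵐ ω ∂P, 0 < q.p g (X ω))
    (hSC : SyntheticControl P Y0 G X q.w) :
    ∃ f : ℝ → ℝ, IsRegression (givenGroup P G 0) X (Y0 (post T)) f ∧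
      ∀ᵐ x ∂P.map X, ∑ g, q.w g x = 1 ∧ f x = ∑ g, q.w g x * q.m g.succ (post T) x ∧
        ∀ t : Fin (T + 1), q.m 0 t.castSucc x = ∑ g, q.w g x * q.m g.succ t.castSucc x := by
  obtain ⟨m0, hm0, hw⟩ := hSC
  -- Regressions of the untreated and of the observed outcome agree wherever these coincide: for
  -- controls in every period, and for the treated group before treatment by no anticipation.
  have key : ∀ g t, (∀ᵐ ω ∂P, G ω = g → Y0 t ω = observedY Y0 Y1 G t ω) →
      ∀ᵐ x ∂P.map X, m0 g t x = q.m g t x := by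
    intro g t h
    have h1 : Y0 t =ᵐ[givenGroup P G g] observedY Y0 Y1 G t := ae_givenGroup_of_ae hG h
    exact ae_map_of_ae_givenGroup hG hX (hp g) (hoverlap g)
      (measurableSet_eq_fun (hm0 g t).1 (hm g t).1) (((hm0 g t).congr_ae h1).ae_eq (hm g t))
  have h1 : ∀ᵐ x ∂P.map X, ∀ (g : Fin (N + 1)) t, m0 g.succ t x = q.m g.succ t x := by
    rw [ae_all_iff]; intro g
    rw [ae_all_iff]; intro t
    refine key _ _ (Eventually.of_forall fun ω hω => ?_)
    simp [observedY, hω, Fin.succ_ne_zero]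
  have h2 : ∀ᵐ x ∂P.map X, ∀ t : Fin (T + 1), m0 0 t.castSucc x = q.m 0 t.castSucc x := by
    rw [ae_all_iff]; intro t
    refine key _ _ ?_
    filter_upwards [hNA t] with ω h3 hω
    simp [observedY, hω, h3]
  refine ⟨m0 0 (post T), hm0 0 _, ?_⟩
  filter_upwards [hw, h1, h2] with x hx k1 k2
  simp only [k1] at hx
  exact ⟨hx.1, hx.2 _, fun t => by rw [← k2, hx.2]⟩

/-- The exact fit behind the second-order expansion of the weights. The last weight is eliminated by
the sum condition, which produces the contrasts with the last control group. -/
lemma weightMatrix_mulVec_eq {x : ℝ} (h1 : ∑ g, q.w g x = 1)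
    (h2 : ∀ t : Fin (T + 1), q.m 0 t.castSucc x = ∑ g, q.w g x * q.m g.succ t.castSucc x) :
    (weightMatrix q.m x) *ᵥ (fun j => q.w j.castSucc x) = weightVector q.m x := by
  funext t
  have h3 := h2 t
  rw [Fin.sum_univ_castSucc] at h1 h3
  have h4 : (Fin.last N).succ = Fin.last (N + 1) := rfl
  rw [h4] at h3
  simp only [weightMatrix, weightVector, mulVec, dotProduct, Matrix.of_apply, sub_mul,
    Finset.sum_sub_distrib, ← Finset.mul_sum]
  have h5 : ∑ j : Fin N, q.w j.castSucc x = 1 - q.w (Fin.last N) x := by linarith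
  have h6 : ∑ j : Fin N, q.m j.castSucc.succ t.castSucc x * q.w j.castSucc x =
      ∑ j : Fin N, q.w j.castSucc x * q.m j.castSucc.succ t.castSucc x :=
    Finset.sum_congr rfl fun j _ => mul_comm _ _
  rw [h3, h5, h6]
  ring

-- The integrability of `mΔ` within a single group is deduced here: `mΔ` is the difference of the
-- outcome change and a square-integrable residual.
omit [IsProbabilityMeasure P] in
lemma isRegression_dy_sub [IsFiniteMeasure P] (hX : Measurable X)
    (hY0 : ∀ t, Measurable (Y0 t)) (hY1 : ∀ t, Measurable (Y1 t)) (hG : Measurable G)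
    (hm : ∀ g t, IsRegression (givenGroup P G g) X (observedY Y0 Y1 G t) (q.m g t))
    (hmΔ : Measurable q.mΔ) (g : Fin (N + 2))
    (hvar : Integrable (fun ω => ((observation Y0 Y1 G X ω).dy - q.mΔ (X ω)) ^ 2)
      (givenGroup P G g)) :
    IsRegression (givenGroup P G g) X (fun ω => (observation Y0 Y1 G X ω).dy - q.mΔ (X ω))
      fun x => q.mDelta g x - q.mΔ x := by
  have h1 : IsRegression (givenGroup P G g) X (fun ω => (observation Y0 Y1 G X ω).dy)
      (q.mDelta g) := (hm g (post T)).sub (hm g (pre T))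
  have hDm : Measurable fun ω => (observation Y0 Y1 G X ω).dy - q.mΔ (X ω) :=
    (measurable_obs_dy.comp (measurable_observation hY0 hY1 hG hX)).sub (hmΔ.comp hX)
  have h2 : Integrable (fun ω => (observation Y0 Y1 G X ω).dy - q.mΔ (X ω))
      (givenGroup P G g) :=
    ((memLp_two_iff_integrable_sq hDm.aestronglyMeasurable).2 hvar).integrable (by norm_num)
  have h3 : Integrable (fun ω => q.mΔ (X ω)) (givenGroup P G g) :=
    (h1.2.1.sub h2).congr (Eventually.of_forall fun ω => by simp)
  exact h1.sub (isRegression_comp hX hmΔ h3)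

/-- The regressions and the inverse Gram matrix are bounded by compactness, and the bias of `mΔ` in
the control groups by the conditional second moments. The conclusion holds for every larger constant
so that it can later be raised. -/
lemma exists_regularAt (hX : Measurable X)
    (hY0 : ∀ t, Measurable (Y0 t)) (hY1 : ∀ t, Measurable (Y1 t)) (hG : Measurable G)
    (hNA : ∀ t : Fin (T + 1), Y1 t.castSucc =ᵐ[P] Y0 t.castSucc)
    (hcomp : IsCompact (P.map X).support)
    (hp : ∀ g, IsRegression P X ((G ⁻¹' {g}).indicator fun _ => 1) (q.p g))
    (hm : ∀ g t, IsRegression (givenGroup P G g) X (observedY Y0 Y1 G t) (q.m g t))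
    (hmΔ : Measurable q.mΔ) (hw : ∀ g, Measurable (q.w g))
    (hoverlap : ∀ g, ∀ᵐ ω ∂P, 0 < q.p g (X ω))
    (hSC : SyntheticControl P Y0 G X q.w)
    (hvar : ∀ g, Integrable (fun ω => ((observation Y0 Y1 G X ω).dy - q.mΔ (X ω)) ^ 2)
        (givenGroup P G g) ∧
      ∃ C : ℝ, ∀ᵐ ω ∂(givenGroup P G g),
        ((givenGroup P G g)[fun ω => ((observation Y0 Y1 G X ω).dy - q.mΔ (X ω)) ^ 2 |
          MeasurableSpace.comap X inferInstance]) ω ≤ C)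
    (hpbdd : ∀ g, ∃ C : ℝ, ∀ᵐ ω ∂P, 1 / q.p g (X ω) ≤ C)
    (hwbdd : ∀ g, ∃ C : ℝ, ∀ᵐ ω ∂P, |q.w g (X ω)| ≤ C)
    (hmC : ∀ g t, ContinuousOn (q.m g t) (P.map X).support)
    (hM : ∀ x ∈ (P.map X).support,
      IsUnit ((weightMatrix q.m x)ᵀ * weightMatrix q.m x).det) :
    ∃ C : ℝ, ∀ C' ≥ C, ∀ᵐ x ∂P.map X, q.RegularAt C' x := by
  have hae : ∀ {s : ℝ → Prop}, MeasurableSet {x | s x} → (∀ᵐ ω ∂P, s (X ω)) →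
      ∀ᵐ x ∂P.map X, s x := fun hs h => (ae_map_iff hX.aemeasurable hs).2 h
  obtain ⟨f, -, hSCx⟩ := syntheticControl_ae hG hX hNA hp hm hoverlap hSC
  obtain ⟨Cp, hCp⟩ := exists_ae_bound (μ := P.map X) (f := fun g x => 1 / q.p g x) fun g => by
    obtain ⟨C, hC⟩ := hpbdd g
    exact ⟨C, hae (measurableSet_le (measurable_const.div (hp g).1) measurable_const) hC⟩
  obtain ⟨Cw, hCw⟩ := exists_ae_bound (μ := P.map X) (f := fun g x => |q.w g x|) fun g => by
    obtain ⟨C, hC⟩ := hwbdd g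
    exact ⟨C, hae (measurableSet_le ((hw g).abs) measurable_const) hC⟩
  have hsupp : ∀ᵐ x ∂P.map X, x ∈ (P.map X).support := Measure.support_mem_ae
  obtain ⟨Cm, hCm⟩ := exists_ae_bound (μ := P.map X)
    (f := fun (k : Fin (N + 2) × Fin (T + 2)) x => |q.m k.1 k.2 x|) fun k => by
    obtain ⟨C, hC⟩ := hcomp.exists_bound_of_continuousOn (hmC k.1 k.2)
    exact ⟨C, hsupp.mono fun x hx => hC x hx⟩
  obtain ⟨Cb, hCb⟩ := exists_ae_bound (μ := P.map X)
    (f := fun (g : Fin (N + 1)) x => |q.mDelta g.succ x - q.mΔ x|) fun g => by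
    obtain ⟨hi, C, hC⟩ := hvar g.succ
    have hreg := isRegression_dy_sub hX hY0 hY1 hG hm hmΔ g.succ hi
    exact ⟨(1 + C) / 2, ae_map_of_ae_givenGroup hG hX (hp _) (hoverlap _)
      (measurableSet_le hreg.1.abs measurable_const) (hreg.abs_le hX hi hC)⟩
  obtain ⟨Cg, hCg⟩ := exists_bound_gram_inv hcomp hmC hM
  have hpos : ∀ᵐ x ∂P.map X, ∀ g, 0 < q.p g x := ae_all_iff.2 fun g =>
    hae (measurableSet_lt measurable_const (hp g).1) (hoverlap g)
  have hle : ∀ᵐ x ∂P.map X, ∀ g, q.p g x ≤ 1 := ae_all_iff.2 fun g =>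
    hae (measurableSet_le (hp g).1 measurable_const) (regression_ind_le_one hX (hp g))
  refine ⟨|Cp| + |Cw| + 2 * |Cm| + |Cb| + |Cg|, fun C' hC' => ?_⟩
  have a1 := abs_nonneg Cp
  have a2 := abs_nonneg Cw
  have a3 := abs_nonneg Cm
  have a4 := abs_nonneg Cb
  have a5 := abs_nonneg Cg
  have b1 := le_abs_self Cp
  have b2 := le_abs_self Cw
  have b3 := le_abs_self Cm
  have b4 := le_abs_self Cb
  have b5 := le_abs_self Cg
  filter_upwards [hSCx, hCp, hCw, hsupp, hCm, hCb, hpos, hle] with x k1 k2 k3 k4 k5 k6 k7 k8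
  refine ⟨by linarith, hM x k4, fun i j => (hCg x k4 i j).trans (by linarith), fun t j => ?_,
    fun g => (k3 g).trans (by linarith), k1.1, weightMatrix_mulVec_eq k1.1 k1.2.2, k7, k8,
    fun g => (k2 g).trans (by linarith), fun g => (k6 g).trans (by linarith),
    fun g t => (k5 (g, t)).trans (by linarith)⟩
  refine (abs_sub _ _).trans ?_
  linarith [k5 (j.castSucc.succ, t.castSucc), k5 (Fin.last (N + 1), t.castSucc)]

/-- Condenses the assumptions on potential outcomes into moments of the law of an observation, the
form used in the expansion. -/
lemma exists_population (hX : Measurable X)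
    (hY0 : ∀ t, Measurable (Y0 t)) (hY1 : ∀ t, Measurable (Y1 t)) (hG : Measurable G)
    (hNA : ∀ t : Fin (T + 1), Y1 t.castSucc =ᵐ[P] Y0 t.castSucc)
    (hY : ∀ t, MemLp (observedY Y0 Y1 G t) 2 P)
    (hcomp : IsCompact (P.map X).support)
    (hp : ∀ g, IsRegression P X ((G ⁻¹' {g}).indicator fun _ => 1) (q.p g))
    (hm : ∀ g t, IsRegression (givenGroup P G g) X (observedY Y0 Y1 G t) (q.m g t))
    (hmΔ : Measurable q.mΔ) (hw : ∀ g, Measurable (q.w g))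
    (hoverlap : ∀ g, ∀ᵐ ω ∂P, 0 < q.p g (X ω))
    (hSC : SyntheticControl P Y0 G X q.w)
    (hvar : ∀ g, Integrable (fun ω => ((observation Y0 Y1 G X ω).dy - q.mΔ (X ω)) ^ 2)
        (givenGroup P G g) ∧
      ∃ C : ℝ, ∀ᵐ ω ∂(givenGroup P G g),
        ((givenGroup P G g)[fun ω => ((observation Y0 Y1 G X ω).dy - q.mΔ (X ω)) ^ 2 |
          MeasurableSpace.comap X inferInstance]) ω ≤ C)
    (hpbdd : ∀ g, ∃ C : ℝ, ∀ᵐ ω ∂P, 1 / q.p g (X ω) ≤ C)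
    (hwbdd : ∀ g, ∃ C : ℝ, ∀ᵐ ω ∂P, |q.w g (X ω)| ≤ C)
    (hmC : ∀ g t, ContinuousOn (q.m g t) (P.map X).support)
    (hM : ∀ x ∈ (P.map X).support,
      IsUnit ((weightMatrix q.m x)ᵀ * weightMatrix q.m x).det) :
    ∃ C : ℝ, Population (P.map (observation Y0 Y1 G X)) (P.map X) q C := by
  obtain ⟨C, hC⟩ := exists_regularAt hX hY0 hY1 hG hNA hcomp hp hm hmΔ hw hoverlap hSC hvar
    hpbdd hwbdd hmC hM
  choose hvi Cv hCv using hvar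
  -- One constant for pointwise regularity and for the conditional second moments of all groups.
  set C' : ℝ := |C| + ∑ g, |Cv g| with hC'
  have hob := measurable_observation hY0 hY1 hG hX
  have hreg := fun g => isRegression_dy_sub hX hY0 hY1 hG hm hmΔ g (hvi g)
  have hDm : Measurable fun o : Obs N T => o.dy - q.mΔ o.x :=
    measurable_obs_dy.sub (hmΔ.comp measurable_obs_x)
  have hne := fun g => measure_group_ne_zero hG hX (hp g) (hoverlap g)
  have hmapx : (P.map (observation Y0 Y1 G X)).map (fun o => o.x) = P.map X := by
    rw [Measure.map_map measurable_obs_x hob]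
    rfl
  refine ⟨C', hmapx, fun g => (hp g).1,
    fun g t => (hm g t).1, hmΔ, hw, hC C' ?_, ?_, ?_, ?_, ?_, ?_, ?_⟩
  · have : 0 ≤ ∑ g, |Cv g| := Finset.sum_nonneg fun _ _ => abs_nonneg _
    have := le_abs_self C
    simp only [ge_iff_le]
    linarith
  · intro t
    rw [memLp_map_measure_iff (measurable_obs_y t).aestronglyMeasurable hob.aemeasurable]
    exact hY t
  · intro g
    have hgD : Measurable fun o : Obs N T => o.ind g * (o.dy - q.mΔ o.x) :=
      (measurable_obs_ind g).mul hDm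
    rw [memLp_two_iff_integrable_sq hgD.aestronglyMeasurable]
    have h1 : (fun o : Obs N T => (o.ind g * (o.dy - q.mΔ o.x)) ^ 2) =
        fun o => o.ind g * (o.dy - q.mΔ o.x) ^ 2 := by
      funext o
      by_cases h : o.2.1 = g <;> simp [Obs.ind, h]
    rw [h1, integrable_ind_mul_iff hob hG g
      (H := fun o => (o.dy - q.mΔ o.x) ^ 2) (hDm.pow_const 2),
      ← integrable_givenGroup_iff (hne g)]
    exact hvi g
  · intro g b hb
    have h1 : (fun o : Obs N T => b o.x * o.ind g) = fun o => o.ind g * b o.x := by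
      funext o; rw [mul_comm]
    rw [h1, integral_ind_mul hob hG g (H := fun o => b o.x) (hb.comp measurable_obs_x)]
    exact integral_restrict_eq_integral_map hG hX (hp g) (hoverlap g) hb
  · intro g t b hb hi
    have h1 : (fun o : Obs N T => b o.x * (o.ind g * o.y t)) =
        fun o => o.ind g * (b o.x * o.y t) := by
      funext o; ring
    have hH : Measurable fun o : Obs N T => b o.x * o.y t :=
      (hb.comp measurable_obs_x).mul (measurable_obs_y t)
    rw [h1, integrable_ind_mul_iff hob hG g hH] at hi
    rw [h1, integral_ind_mul hob hG g hH]
    exact IsRegression.setIntegral_mul hG hX (hp g) (hoverlap g) (hm g t) hb hi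
  · intro g b hb hi
    have h1 : (fun o : Obs N T => b o.x * (o.ind g * (o.dy - q.mΔ o.x))) =
        fun o => o.ind g * (b o.x * (o.dy - q.mΔ o.x)) := by
      funext o; ring
    have hH : Measurable fun o : Obs N T => b o.x * (o.dy - q.mΔ o.x) :=
      (hb.comp measurable_obs_x).mul hDm
    rw [h1, integrable_ind_mul_iff hob hG g hH] at hi
    rw [h1, integral_ind_mul hob hG g hH]
    exact IsRegression.setIntegral_mul hG hX (hp g) (hoverlap g) (hreg g) hb hi
  · intro g b hb
    rw [lintegral_ind_mul_sq hob hG g hDm (b := fun o => b o.x) (hb.comp measurable_obs_x)]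
    have h1 := lintegral_mul_sq_le (μ := givenGroup P G g) hX
      (hDm.comp hob) (hvi g) (hCv g) hb
    rw [lintegral_givenGroup, lintegral_givenGroup, mul_left_comm] at h1
    -- The normalization by the probability of the group is cancelled from both sides.
    have h2 := (ENNReal.mul_le_mul_iff_right (ENNReal.inv_ne_zero.2 (measure_ne_top _ _))
      (ENNReal.inv_ne_top.2 (hne g))).1 h1
    refine h2.trans ?_
    gcongr
    · refine (le_abs_self _).trans ?_
      have h3 : |Cv g| ≤ ∑ g, |Cv g| := Finset.single_le_sum (f := fun g => |Cv g|)
        (fun _ _ => abs_nonneg _) (Finset.mem_univ g)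
      have := abs_nonneg C
      linarith
    · rw [lintegral_map hb hX]
      exact setLIntegral_le_lintegral _ _

end Main

end SyntheticDiD

namespace SyntheticDiD

variable {N T : ℕ}

/-! ### The adjustment for the first-step estimation. -/

namespace Nuisance

variable (q : Nuisance N T)

/-- The inverse-probability-weighted residual of the ratio of a control group. -/
noncomputable def ratioResidual (o : Obs N T) (g : Fin (N + 1)) : ℝ :=
  (o.ind 0 - q.r g o.x * o.ind g.succ) / q.p g.succ o.x

/-- The derivative of the mean of the moment function in the ratio of a control group. -/
def ratioCoef (g : Fin (N + 1)) (x : ℝ) : ℝ :=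
  q.w g x * q.p g.succ x * (q.mDelta g.succ x - q.mΔ x)

/-- The adjustment of the moment function for the estimation of the ratios and of the weights. -/
noncomputable def adjustment (o : Obs N T) : ℝ :=
  ∑ g, q.ratioCoef g o.x * q.ratioResidual o g +
    ∑ k : Fin (N + 2) × Fin (T + 1), q.scoreCoef k o.x * q.residual o k.1 k.2.castSucc

end Nuisance

/-- Allows the expansion to be carried out at `π = 1`; the estimated share returns only in the final
Slutsky argument. -/
lemma phi_eq (mΔ : ℝ → ℝ) (r w : Fin (N + 1) → ℝ → ℝ) (π : ℝ) (o : Obs N T) :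
    phi mΔ r w π o = π⁻¹ * phi mΔ r w 1 o := by
  simp only [phi, div_one, one_mul, one_div]
  ring

lemma Obs.ind_nonneg (o : Obs N T) (g : Fin (N + 2)) : 0 ≤ o.ind g := by
  rw [Obs.ind]; split_ifs <;> norm_num

lemma Obs.ind_le_one (o : Obs N T) (g : Fin (N + 2)) : o.ind g ≤ 1 := by
  rw [Obs.ind]; split_ifs <;> norm_num

lemma Obs.abs_ind_le_one (o : Obs N T) (g : Fin (N + 2)) : |o.ind g| ≤ 1 := by
  rw [abs_of_nonneg (o.ind_nonneg g)]; exact o.ind_le_one g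

/-! ### Moments of the residuals, the adjustment and the moment function. -/

namespace Population

variable {Q : Measure (Obs N T)} [IsProbabilityMeasure Q] {F : Measure ℝ} {q : Nuisance N T}
  {C : ℝ}

omit [IsProbabilityMeasure Q] in
lemma ae_obs (hQ : Population Q F q C) {s : ℝ → Prop} (h : ∀ᵐ x ∂F, s x) :
    ∀ᵐ o ∂Q, s o.x := by
  rw [← hQ.map_x] at h
  exact ae_of_ae_map measurable_obs_x.aemeasurable h

omit [IsProbabilityMeasure Q] in
lemma measurable_r (hQ : Population Q F q C) (g : Fin (N + 1)) : Measurable (q.r g) :=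
  (hQ.measurable_p 0).div (hQ.measurable_p _)

omit [IsProbabilityMeasure Q] in
lemma measurable_mDelta (hQ : Population Q F q C) (g : Fin (N + 2)) : Measurable (q.mDelta g) :=
  (hQ.measurable_m _ _).sub (hQ.measurable_m _ _)

omit [IsProbabilityMeasure Q] in
lemma measurable_diff (hQ : Population Q F q C) (g : Fin (N + 2)) :
    Measurable fun o : Obs N T => o.ind g * (o.dy - q.mΔ o.x) :=
  (measurable_obs_ind g).mul (measurable_obs_dy.sub (hQ.measurable_mΔ.comp measurable_obs_x))

omit [IsProbabilityMeasure Q] in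
lemma measurable_residual (hQ : Population Q F q C) (g : Fin (N + 2)) (t : Fin (T + 2)) :
    Measurable fun o => q.residual o g t :=
  ((measurable_obs_ind g).mul ((measurable_obs_y t).sub
    ((hQ.measurable_m g t).comp measurable_obs_x))).div
      ((hQ.measurable_p g).comp measurable_obs_x)

omit [IsProbabilityMeasure Q] in
lemma measurable_ratioResidual (hQ : Population Q F q C) (g : Fin (N + 1)) :
    Measurable fun o => q.ratioResidual o g :=
  ((measurable_obs_ind 0).sub (((hQ.measurable_r g).comp measurable_obs_x).mul
    (measurable_obs_ind _))).div ((hQ.measurable_p _).comp measurable_obs_x)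

omit [IsProbabilityMeasure Q] in
lemma measurable_ratioCoef (hQ : Population Q F q C) (g : Fin (N + 1)) :
    Measurable (q.ratioCoef g) :=
  ((hQ.measurable_w g).mul (hQ.measurable_p _)).mul
    ((hQ.measurable_mDelta _).sub hQ.measurable_mΔ)

omit [IsProbabilityMeasure Q] in
lemma measurable_scoreCoef (hQ : Population Q F q C) (k : Fin (N + 2) × Fin (T + 1)) :
    Measurable (q.scoreCoef k) :=
  Nuisance.measurable_scoreCoef hQ.measurable_p hQ.measurable_m hQ.measurable_mΔ hQ.measurable_w k

lemma memLp_ind (g : Fin (N + 2)) : MemLp (fun o : Obs N T => o.ind g) 2 Q :=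
  MemLp.of_bound (measurable_obs_ind g).aestronglyMeasurable 1
    (Eventually.of_forall fun o => o.abs_ind_le_one g)

omit [IsProbabilityMeasure Q] in
lemma memLp_comp_mul (hQ : Population Q F q C) {b : ℝ → ℝ} (hb : Measurable b) {B : ℝ}
    (hB : ∀ᵐ x ∂F, |b x| ≤ B) {f : Obs N T → ℝ} (hf : MemLp f 2 Q) :
    MemLp (fun o => b o.x * f o) 2 Q := by
  refine hf.of_le_mul (c := B)
    ((hb.comp measurable_obs_x).aestronglyMeasurable.mul hf.1) ?_
  filter_upwards [hQ.ae_obs hB] with o ho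
  rw [norm_mul]
  exact mul_le_mul_of_nonneg_right ho (norm_nonneg _)

omit [IsProbabilityMeasure Q] in
lemma abs_m_div_p_le (hQ : Population Q F q C) (g : Fin (N + 2)) (t : Fin (T + 2)) :
    ∀ᵐ x ∂F, |q.m g t x / q.p g x| ≤ C * C := by
  filter_upwards [hQ.regular] with x hx
  rw [div_eq_mul_one_div, abs_mul, abs_of_nonneg (one_div_nonneg.2 (hx.p_pos g).le)]
  exact mul_le_mul (hx.m_le g t) (hx.p_inv_le g) (one_div_nonneg.2 (hx.p_pos g).le) hx.nonneg

omit [IsProbabilityMeasure Q] in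
lemma abs_one_div_p_le (hQ : Population Q F q C) (g : Fin (N + 2)) :
    ∀ᵐ x ∂F, |1 / q.p g x| ≤ C := by
  filter_upwards [hQ.regular] with x hx
  rw [abs_of_nonneg (one_div_nonneg.2 (hx.p_pos g).le)]
  exact hx.p_inv_le g

omit [IsProbabilityMeasure Q] in
lemma abs_r_div_p_le (hQ : Population Q F q C) (g : Fin (N + 1)) :
    ∀ᵐ x ∂F, |q.r g x / q.p g.succ x| ≤ C * C := by
  filter_upwards [hQ.regular] with x hx
  rw [div_eq_mul_one_div, abs_mul, abs_of_nonneg (one_div_nonneg.2 (hx.p_pos _).le),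
    abs_of_nonneg (hx.r_nonneg g)]
  exact mul_le_mul (hx.r_le g) (hx.p_inv_le _) (one_div_nonneg.2 (hx.p_pos _).le) hx.nonneg

omit [IsProbabilityMeasure Q] in
lemma abs_ratioCoef_le (hQ : Population Q F q C) (g : Fin (N + 1)) :
    ∀ᵐ x ∂F, |q.ratioCoef g x| ≤ C * C := by
  filter_upwards [hQ.regular] with x hx
  rw [Nuisance.ratioCoef, abs_mul, abs_mul, abs_of_pos (hx.p_pos _)]
  refine mul_le_mul ?_ (hx.bias_le g) (abs_nonneg _) hx.nonneg
  exact (mul_le_of_le_one_right (abs_nonneg _) (hx.p_le _)).trans (hx.w_le g)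

lemma memLp_residual (hQ : Population Q F q C) (g : Fin (N + 2)) (t : Fin (T + 2)) :
    MemLp (fun o => q.residual o g t) 2 Q := by
  have h1 : MemLp (fun o : Obs N T => o.ind g * o.y t) 2 Q :=
    (hQ.memLp_y t).of_le ((measurable_obs_ind g).mul (measurable_obs_y t)).aestronglyMeasurable
      (Eventually.of_forall fun o => by
        rw [norm_mul]
        exact mul_le_of_le_one_left (norm_nonneg _) (o.abs_ind_le_one g))
  have h2 := hQ.memLp_comp_mul (b := fun x => 1 / q.p g x)
    (measurable_const.div (hQ.measurable_p g)) (hQ.abs_one_div_p_le g) h1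
  have h3 := hQ.memLp_comp_mul (b := fun x => q.m g t x / q.p g x)
    ((hQ.measurable_m g t).div (hQ.measurable_p g)) (hQ.abs_m_div_p_le g t) (memLp_ind g)
  refine (h2.sub h3).ae_eq (Eventually.of_forall fun o => ?_)
  simp only [Nuisance.residual, Pi.sub_apply]
  ring

lemma memLp_ratioResidual (hQ : Population Q F q C) (g : Fin (N + 1)) :
    MemLp (fun o => q.ratioResidual o g) 2 Q := by
  have h2 := hQ.memLp_comp_mul (b := fun x => 1 / q.p g.succ x)
    (measurable_const.div (hQ.measurable_p _)) (hQ.abs_one_div_p_le _) (memLp_ind 0)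
  have h3 := hQ.memLp_comp_mul (b := fun x => q.r g x / q.p g.succ x)
    ((hQ.measurable_r g).div (hQ.measurable_p _)) (hQ.abs_r_div_p_le g) (memLp_ind g.succ)
  refine (h2.sub h3).ae_eq (Eventually.of_forall fun o => ?_)
  simp only [Nuisance.ratioResidual, Pi.sub_apply]
  ring

/-- Conditional centring given the covariate, in the form of orthogonality to bounded functions of
it. It makes the adjustment centred and removes the smoothing bias. -/
lemma integral_residual (hQ : Population Q F q C) (g : Fin (N + 2)) (t : Fin (T + 2))
    {b : ℝ → ℝ} (hb : Measurable b) (hbB : ∃ B, ∀ᵐ x ∂F, |b x| ≤ B) :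
    ∫ o, b o.x * q.residual o g t ∂Q = 0 := by
  obtain ⟨B, hB⟩ := hbB
  have h1 : MemLp (fun o : Obs N T => o.ind g * o.y t) 2 Q :=
    (hQ.memLp_y t).of_le ((measurable_obs_ind g).mul (measurable_obs_y t)).aestronglyMeasurable
      (Eventually.of_forall fun o => by
        rw [norm_mul]
        exact mul_le_of_le_one_left (norm_nonneg _) (o.abs_ind_le_one g))
  have hb1 : Measurable fun x => b x * (1 / q.p g x) :=
    hb.mul (measurable_const.div (hQ.measurable_p g))
  have hb2 : Measurable fun x => b x * (q.m g t x / q.p g x) :=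
    hb.mul ((hQ.measurable_m g t).div (hQ.measurable_p g))
  have h2 := (hQ.memLp_comp_mul hb hB (hQ.memLp_comp_mul (b := fun x => 1 / q.p g x)
    (measurable_const.div (hQ.measurable_p g)) (hQ.abs_one_div_p_le g) h1)).integrable
      (by norm_num)
  have h3 := (hQ.memLp_comp_mul hb hB (hQ.memLp_comp_mul (b := fun x => q.m g t x / q.p g x)
    ((hQ.measurable_m g t).div (hQ.measurable_p g)) (hQ.abs_m_div_p_le g t)
      (memLp_ind g))).integrable (by norm_num)
  simp only [← mul_assoc] at h2 h3
  simp only [mul_assoc (b _ * (1 / _)) (Obs.ind _ _)] at h2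
  have e : ∀ o : Obs N T, b o.x * q.residual o g t =
      b o.x * (1 / q.p g o.x) * (o.ind g * o.y t) -
        b o.x * (q.m g t o.x / q.p g o.x) * o.ind g := by
    intro o
    simp only [Nuisance.residual]
    ring
  simp only [e]
  rw [integral_sub h2 h3, hQ.integral_y g t _ hb1 h2, hQ.integral_ind g _ hb2, sub_eq_zero]
  refine integral_congr_ae ?_
  filter_upwards [hQ.regular] with x hx
  have := (hx.p_pos g).ne'
  field_simp

/-- The conditional mean of the numerator is `p₀ - r_g p_g`, which is zero by the definition of the
ratio. -/
lemma integral_ratioResidual (hQ : Population Q F q C) (g : Fin (N + 1))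
    {b : ℝ → ℝ} (hb : Measurable b) (hbB : ∃ B, ∀ᵐ x ∂F, |b x| ≤ B) :
    ∫ o, b o.x * q.ratioResidual o g ∂Q = 0 := by
  obtain ⟨B, hB⟩ := hbB
  have hb1 : Measurable fun x => b x * (1 / q.p g.succ x) :=
    hb.mul (measurable_const.div (hQ.measurable_p _))
  have hb2 : Measurable fun x => b x * (q.r g x / q.p g.succ x) :=
    hb.mul ((hQ.measurable_r g).div (hQ.measurable_p _))
  have h2 := (hQ.memLp_comp_mul hb hB (hQ.memLp_comp_mul (b := fun x => 1 / q.p g.succ x)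
    (measurable_const.div (hQ.measurable_p _)) (hQ.abs_one_div_p_le _)
      (memLp_ind 0))).integrable (by norm_num)
  have h3 := (hQ.memLp_comp_mul hb hB (hQ.memLp_comp_mul (b := fun x => q.r g x / q.p g.succ x)
    ((hQ.measurable_r g).div (hQ.measurable_p _)) (hQ.abs_r_div_p_le g)
      (memLp_ind g.succ))).integrable (by norm_num)
  simp only [← mul_assoc] at h2 h3
  have e : ∀ o : Obs N T, b o.x * q.ratioResidual o g =
      b o.x * (1 / q.p g.succ o.x) * o.ind 0 -
        b o.x * (q.r g o.x / q.p g.succ o.x) * o.ind g.succ := by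
    intro o
    simp only [Nuisance.ratioResidual]
    ring
  simp only [e]
  rw [integral_sub h2 h3, hQ.integral_ind 0 _ hb1, hQ.integral_ind g.succ _ hb2, sub_eq_zero]
  refine integral_congr_ae ?_
  filter_upwards [hQ.regular] with x hx
  have := (hx.p_pos g.succ).ne'
  rw [Nuisance.r]
  field_simp

omit [IsProbabilityMeasure Q] in
lemma exists_abs_scoreCoef_le (hQ : Population Q F q C) (hC : 0 ≤ C) :
    ∃ B, ∀ k, ∀ᵐ x ∂F, |q.scoreCoef k x| ≤ B := by
  obtain ⟨B, -, hB⟩ := Nuisance.RegularAt.abs_scoreCoef_le (N := N) (T := T) hC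
  exact ⟨B, fun k => hQ.regular.mono fun x hx => hB q x hx k⟩

lemma memLp_adjustment (hQ : Population Q F q C) (hC : 0 ≤ C) :
    MemLp (fun o => q.adjustment o) 2 Q := by
  obtain ⟨B, hB⟩ := hQ.exists_abs_scoreCoef_le hC
  refine MemLp.add (memLp_finsetSum _ fun g _ => ?_) (memLp_finsetSum _ fun k _ => ?_)
  · exact hQ.memLp_comp_mul (hQ.measurable_ratioCoef g) (hQ.abs_ratioCoef_le g)
      (hQ.memLp_ratioResidual g)
  · exact hQ.memLp_comp_mul (hQ.measurable_scoreCoef k) (hB k) (hQ.memLp_residual _ _)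

lemma integral_adjustment (hQ : Population Q F q C) (hC : 0 ≤ C) :
    ∫ o, q.adjustment o ∂Q = 0 := by
  obtain ⟨B, hB⟩ := hQ.exists_abs_scoreCoef_le hC
  have h1 := fun g => (hQ.memLp_comp_mul (hQ.measurable_ratioCoef g) (hQ.abs_ratioCoef_le g)
      (hQ.memLp_ratioResidual g)).integrable (by norm_num)
  have h2 := fun k : Fin (N + 2) × Fin (T + 1) => (hQ.memLp_comp_mul (hQ.measurable_scoreCoef k)
    (hB k) (hQ.memLp_residual k.1 k.2.castSucc)).integrable (by norm_num)
  simp only [Nuisance.adjustment]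
  rw [integral_add (integrable_finsetSum _ fun g _ => h1 g)
    (integrable_finsetSum _ fun k _ => h2 k), integral_finsetSum _ fun g _ => h1 g,
    integral_finsetSum _ fun k _ => h2 k]
  rw [Finset.sum_eq_zero fun g _ => hQ.integral_ratioResidual g (hQ.measurable_ratioCoef g)
    ⟨_, hQ.abs_ratioCoef_le g⟩, Finset.sum_eq_zero fun k _ => hQ.integral_residual k.1
      k.2.castSucc (hQ.measurable_scoreCoef k) ⟨_, hB k⟩, add_zero]

omit [IsProbabilityMeasure Q] in
/-- The influence function is the scaled sum of the centred moment function and the adjustment. -/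
lemma psiSC_ae_eq (hQ : Population Q F q C) (π θ : ℝ) : ∀ᵐ o ∂Q, q.psiSC π θ o =
    π⁻¹ * (phi q.mΔ q.r q.w 1 o - θ * o.ind 0 - q.adjustment o) := by
  filter_upwards [hQ.ae_obs hQ.regular] with o ho
  have h1 : q.psi1 π o = -π⁻¹ * ∑ g, q.ratioCoef g o.x * q.ratioResidual o g := by
    rw [Nuisance.psi1, one_div]
    congr 1
    refine Finset.sum_congr rfl fun g _ => ?_
    rw [Nuisance.ratioCoef, Nuisance.ratioResidual]
    have := (ho.p_pos g.succ).ne'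
    field_simp
  have h2 : q.psi2 π o = -π⁻¹ * ∑ k : Fin (N + 2) × Fin (T + 1),
      q.scoreCoef k o.x * q.residual o k.1 k.2.castSucc := by
    rw [ho.psi2_eq, Nuisance.score_eq_sum, one_div]
    congr 1
    exact Finset.sum_congr rfl fun k _ => mul_comm _ _
  rw [Nuisance.psiSC, h1, h2, Nuisance.psiPT, phi_eq, Nuisance.adjustment]
  ring

omit [IsProbabilityMeasure Q] in
lemma memLp_phi (hQ : Population Q F q C) : MemLp (fun o => phi q.mΔ q.r q.w 1 o) 2 Q := by
  have h1 : ∀ g : Fin (N + 1), MemLp (fun o : Obs N T =>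
      (q.w g o.x * q.r g o.x) * (o.ind g.succ * (o.dy - q.mΔ o.x))) 2 Q := fun g =>
    hQ.memLp_comp_mul (b := fun x => q.w g x * q.r g x) (B := C * C)
      ((hQ.measurable_w g).mul (hQ.measurable_r g)) (by
        filter_upwards [hQ.regular] with x hx
        rw [abs_mul, abs_of_nonneg (hx.r_nonneg g)]
        exact mul_le_mul (hx.w_le g) (hx.r_le g) (hx.r_nonneg g) hx.nonneg) (hQ.memLp_diff _)
  refine ((hQ.memLp_diff 0).sub (memLp_finsetSum Finset.univ fun g _ => h1 g)).ae_eq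
    (Eventually.of_forall fun o => ?_)
  simp only [phi, Pi.sub_apply, div_one, one_mul, mul_assoc]

/-- The mean of the moment function at the true nuisance functions. -/
lemma integral_phi (hQ : Population Q F q C) :
    Integrable (fun x => q.p 0 x * (q.mDelta 0 x - q.mΔ x)) F → IsFiniteMeasure F →
    ∫ o, phi q.mΔ q.r q.w 1 o ∂Q =
      ∫ x, q.p 0 x * (q.mDelta 0 x - ∑ g, q.w g x * q.mDelta g.succ x) ∂F := by
  -- The bias bound of `RegularAt` concerns control groups, so integrability for the treated group
  -- is a separate hypothesis.
  intro hi0 hF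
  have h1 : ∀ g : Fin (N + 1), MemLp (fun o : Obs N T =>
      (q.w g o.x * q.r g o.x) * (o.ind g.succ * (o.dy - q.mΔ o.x))) 2 Q := fun g =>
    hQ.memLp_comp_mul (b := fun x => q.w g x * q.r g x) (B := C * C)
      ((hQ.measurable_w g).mul (hQ.measurable_r g)) (by
        filter_upwards [hQ.regular] with x hx
        rw [abs_mul, abs_of_nonneg (hx.r_nonneg g)]
        exact mul_le_mul (hx.w_le g) (hx.r_le g) (hx.r_nonneg g) hx.nonneg) (hQ.memLp_diff _)
  have hi1 := fun g => (h1 g).integrable (by norm_num)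
  have hi2 := (hQ.memLp_diff 0).integrable (by norm_num)
  have e0 := hQ.integral_diff 0 (fun _ => 1) measurable_const (by simpa using hi2)
  simp only [one_mul] at e0
  have e1 := fun g : Fin (N + 1) => hQ.integral_diff g.succ (fun x => q.w g x * q.r g x)
    ((hQ.measurable_w g).mul (hQ.measurable_r g)) (hi1 g)
  simp only [phi, div_one, one_mul, mul_assoc] at e1 hi1 ⊢
  rw [integral_sub hi2 (integrable_finsetSum _ fun g _ => hi1 g),
    integral_finsetSum _ fun g _ => hi1 g, e0]
  simp only [e1]
  have hi3 : ∀ g : Fin (N + 1), Integrable (fun x => q.w g x * (q.r g x *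
      (q.p g.succ x * (q.mDelta g.succ x - q.mΔ x)))) F := by
    intro g
    refine Integrable.of_bound (C := C * (C * C)) (Measurable.aestronglyMeasurable ?_) ?_
    · exact (hQ.measurable_w g).mul ((hQ.measurable_r g).mul ((hQ.measurable_p _).mul
        ((hQ.measurable_mDelta _).sub hQ.measurable_mΔ)))
    · filter_upwards [hQ.regular] with x hx
      have hC := hx.nonneg
      rw [Real.norm_eq_abs, abs_mul, abs_mul, abs_mul, abs_of_nonneg (hx.r_nonneg g),
        abs_of_pos (hx.p_pos _)]
      refine mul_le_mul (hx.w_le g) (mul_le_mul (hx.r_le g) ?_ ?_ hC) ?_ hC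
      · exact (mul_le_of_le_one_left (abs_nonneg _) (hx.p_le _)).trans (hx.bias_le g)
      · exact mul_nonneg (hx.p_pos _).le (abs_nonneg _)
      · exact mul_nonneg (hx.r_nonneg g) (mul_nonneg (hx.p_pos _).le (abs_nonneg _))
  rw [← integral_finsetSum _ fun g _ => hi3 g,
    ← integral_sub hi0 (integrable_finsetSum _ fun g _ => hi3 g)]
  refine integral_congr_ae ?_
  filter_upwards [hQ.regular] with x hx
  -- Since `r_g p_g = p₀` and the weights sum to one, `mΔ` drops out of the mean.
  have e2 : ∀ g : Fin (N + 1), q.w g x * (q.r g x *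
      (q.p g.succ x * (q.mDelta g.succ x - q.mΔ x))) =
      q.p 0 x * (q.w g x * q.mDelta g.succ x) - q.p 0 x * q.mΔ x * q.w g x := by
    intro g
    rw [Nuisance.r]
    have := (hx.p_pos g.succ).ne'
    field_simp
  simp only [e2, Finset.sum_sub_distrib, ← Finset.mul_sum, hx.w_sum]
  ring

end Population

/-! ### Identification of the average effect on the treated. -/

section Identification

variable {Ω : Type*} [MeasurableSpace Ω] {P : Measure Ω} [IsProbabilityMeasure P]
  {Y0 Y1 : Fin (T + 2) → Ω → ℝ} {G : Ω → Fin (N + 2)} {X : Ω → ℝ} {q : Nuisance N T} {C : ℝ}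

/-- The moment function identifies the average effect on the treated. -/
lemma integral_phi_eq_att (hX : Measurable X)
    (hY0 : ∀ t, Measurable (Y0 t)) (hY1 : ∀ t, Measurable (Y1 t)) (hG : Measurable G)
    (hNA : ∀ t : Fin (T + 1), Y1 t.castSucc =ᵐ[P] Y0 t.castSucc)
    (hp : ∀ g, IsRegression P X ((G ⁻¹' {g}).indicator fun _ => 1) (q.p g))
    (hm : ∀ g t, IsRegression (givenGroup P G g) X (observedY Y0 Y1 G t) (q.m g t))
    (hmΔ : Measurable q.mΔ)
    (hoverlap : ∀ g, ∀ᵐ ω ∂P, 0 < q.p g (X ω))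
    (hSC : SyntheticControl P Y0 G X q.w)
    (hvar : Integrable (fun ω => ((observation Y0 Y1 G X ω).dy - q.mΔ (X ω)) ^ 2)
      (givenGroup P G 0))
    (hQ : Population (P.map (observation Y0 Y1 G X)) (P.map X) q C) :
    ∫ o, phi q.mΔ q.r q.w 1 o ∂(P.map (observation Y0 Y1 G X)) =
      P.real (G ⁻¹' {0}) * att P Y0 Y1 G := by
  have hob := measurable_observation hY0 hY1 hG hX
  have : IsProbabilityMeasure (P.map (observation Y0 Y1 G X)) :=
    Measure.isProbabilityMeasure_map hob.aemeasurable
  have : IsProbabilityMeasure (P.map X) := Measure.isProbabilityMeasure_map hX.aemeasurable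
  have h0 := measure_group_ne_zero hG hX (hp 0) (hoverlap 0)
  have hreg := isRegression_dy_sub (P := P) hX hY0 hY1 hG hm hmΔ 0 hvar
  obtain ⟨f, hf, hSCx⟩ := syntheticControl_ae hG hX hNA hp hm hoverlap hSC
  -- Integrability within the treated group is carried over by its density, the propensity score.
  have hint : Integrable (fun x => q.p 0 x * (q.mDelta 0 x - q.mΔ x)) (P.map X) := by
    have h1 : Integrable (fun ω => (fun x => q.mDelta 0 x - q.mΔ x) (X ω))
        (P.restrict (G ⁻¹' {0})) :=
      (integrable_givenGroup_iff h0).1 (integrable_condExp.congr hreg.2.2.symm)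
    have h2 := (integrable_map_measure (μ := P.restrict (G ⁻¹' {0}))
      hreg.1.aestronglyMeasurable hX.aemeasurable).2 h1
    rw [map_restrict_group hG hX (hp 0) (hoverlap 0),
      integrable_withDensity_iff_integrable_smul' (hp 0).1.ennreal_ofReal (by simp)] at h2
    refine h2.congr ?_
    filter_upwards [hQ.regular] with x hx
    rw [ENNReal.toReal_ofReal (hx.p_pos 0).le, smul_eq_mul]
  rw [hQ.integral_phi hint inferInstance]
  have hreg2 := (hm 0 (post T)).sub hf
  have h3 := IsRegression.setIntegral_mul hG hX (hp 0) (hoverlap 0) hreg2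
    (b := fun _ => 1) measurable_const (by
      simpa using (integrable_givenGroup_iff h0).1 hreg2.2.1)
  simp only [one_mul] at h3
  -- In the last pre-treatment period the weighted control regressions equal that of the treated
  -- group and cancel; in the final period they equal the regression of its untreated outcome.
  have h4 : ∫ x, q.p 0 x * (q.mDelta 0 x - ∑ g, q.w g x * q.mDelta g.succ x) ∂P.map X =
      ∫ x, q.p 0 x * (q.m 0 (post T) x - f x) ∂P.map X := by
    refine integral_congr_ae ?_
    filter_upwards [hSCx] with x hx
    have h5 := hx.2.2 (Fin.last T)
    have h6 : pre T = (Fin.last T).castSucc := rfl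
    simp only [Nuisance.mDelta, mul_sub, Finset.sum_sub_distrib, h6, ← h5, hx.2.1]
    ring
  rw [h4, ← h3, att, integral_givenGroup, mul_inv_cancel_left₀
    (by rwa [measureReal_ne_zero_iff])]
  refine integral_congr_ae ?_
  filter_upwards [ae_restrict_mem (hG (measurableSet_singleton (0 : Fin (N + 2))))] with ω hω
  have : G ω = 0 := hω
  simp [observedY, this]

end Identification

end SyntheticDiD

namespace SyntheticDiD

variable {N T : ℕ}

/-! ### Cauchy–Schwarz in extended norms. -/

section Hoelder

variable {α : Type*} [MeasurableSpace α] {μ : Measure α}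

/-- The Cauchy–Schwarz inequality. -/
lemma lintegral_enorm_mul_enorm_le {f g : α → ℝ} (hf : AEStronglyMeasurable f μ)
    (hg : AEStronglyMeasurable g μ) :
    ∫⁻ x, ‖f x‖ₑ * ‖g x‖ₑ ∂μ ≤ eLpNorm f 2 μ * eLpNorm g 2 μ := by
  have h := eLpNorm_smul_le_mul_eLpNorm (p := 2) (q := 2) (r := 1) hg hf
  rw [eLpNorm_one_eq_lintegral_enorm] at h
  simpa [enorm_mul] using h

lemma ae_enorm_le_eLpNorm_top (f : α → ℝ) : ∀ᵐ x ∂μ, ‖f x‖ₑ ≤ eLpNorm f ∞ μ := by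
  rw [eLpNorm_exponent_top]
  exact ae_le_eLpNormEssSup

lemma lintegral_enorm_sq_eq (f : α → ℝ) : ∫⁻ x, ‖f x‖ₑ ^ 2 ∂μ = eLpNorm f 2 μ ^ 2 := by
  rw [eLpNorm_eq_lintegral_rpow_enorm_toReal (by norm_num) (by norm_num)]
  rw [← ENNReal.rpow_natCast, ← ENNReal.rpow_mul]
  norm_num

end Hoelder

/-! ### Sums over a fold of functions estimated without it. -/

section CrossFit

variable {Ω : Type*} [MeasurableSpace Ω] {P : Measure Ω} {Z Z' W : ℕ → Ω → ℝ≥0∞}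

lemma BoundedInProb.negligible_top (hW : BoundedInProb P W) :
    Negligible P fun k ω => if W k ω = ∞ then ∞ else 0 := by
  intro ε hε
  rw [ENNReal.tendsto_nhds_zero]
  intro η hη
  obtain ⟨C, hC, h⟩ := hW η hη.ne'
  filter_upwards [h] with k hk
  refine (measure_mono fun ω hω => ?_).trans hk
  simp only [Set.mem_ofPred_eq] at hω ⊢
  split_ifs at hω with h1
  · rw [h1]; exact lt_top_iff_ne_top.2 hC
  · exact absurd (le_antisymm hω zero_le) hε

/-- A quantity bounded in probability is infinite only with vanishing probability. Hence
deterministic bounds that presuppose finite norms of the estimation errors may be used without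
assuming these norms finite almost surely. -/
lemma Negligible.mono_of_ne_top (hZ : Negligible P Z) (hW : BoundedInProb P W)
    (h : ∀ᶠ k in atTop, ∀ᵐ ω ∂P, W k ω ≠ ∞ → Z' k ω ≤ Z k ω) : Negligible P Z' := by
  refine (hZ.add hW.negligible_top).mono_ae (h.mono fun k hk => hk.mono fun ω hω => ?_)
  by_cases h1 : W k ω = ∞
  · simp [h1]
  · simpa [h1] using hω h1

variable [IsProbabilityMeasure P] {Q : Measure (Obs N T)} [IsProbabilityMeasure Q]
  {S : ℕ → Ω → Obs N T} {L : ℕ}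

lemma ofReal_inv_sqrt_sq_mul_card_le (fold : ∀ k : ℕ, Fin (L * k) → Fin L)
    (hfold : ∀ k ℓ, (Finset.univ.filter fun i => fold k i = ℓ).card = k) (ℓ : Fin L) (k : ℕ) :
    ENNReal.ofReal (√((L * k : ℕ) : ℝ))⁻¹ ^ 2 *
      ((Finset.univ.filter fun i => fold k i = ℓ).card : ℝ≥0∞) ≤ 1 := by
  have hL : 1 ≤ L := ℓ.pos
  rw [hfold, ← ENNReal.ofReal_pow (by positivity), ← ENNReal.ofReal_natCast,
    ← ENNReal.ofReal_mul (by positivity), ENNReal.ofReal_le_one, inv_pow,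
    Real.sq_sqrt (by positivity)]
  rcases Nat.eq_zero_or_pos k with rfl | hk
  · simp
  have hk' : (0 : ℝ) < k := by exact_mod_cast hk
  have hL' : (1 : ℝ) ≤ L := by exact_mod_cast hL
  rw [inv_mul_le_iff₀ (by positivity)]
  push_cast
  nlinarith

lemma ofReal_inv_sqrt_mul_card_le (fold : ∀ k : ℕ, Fin (L * k) → Fin L)
    (hfold : ∀ k ℓ, (Finset.univ.filter fun i => fold k i = ℓ).card = k) (ℓ : Fin L) (k : ℕ) :
    ENNReal.ofReal (√((L * k : ℕ) : ℝ))⁻¹ *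
      ((Finset.univ.filter fun i => fold k i = ℓ).card : ℝ≥0∞) ≤
      ENNReal.ofReal √((L * k : ℕ) : ℝ) := by
  have hL : 1 ≤ L := ℓ.pos
  rw [hfold, ← ENNReal.ofReal_natCast, ← ENNReal.ofReal_mul (by positivity)]
  refine ENNReal.ofReal_le_ofReal ?_
  rcases Nat.eq_zero_or_pos k with rfl | hk
  · simp
  have hk' : (0 : ℝ) < k := by exact_mod_cast hk
  have hL' : (1 : ℝ) ≤ L := by exact_mod_cast hL
  have hn : (0 : ℝ) < ((L * k : ℕ) : ℝ) := by push_cast; positivity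
  rw [inv_mul_le_iff₀ (by positivity), Real.mul_self_sqrt hn.le]
  push_cast
  nlinarith

/-- Centred sums over a fold of functions that are estimated without that fold. -/
lemma negligible_centered_fold_sum (hS : ∀ i, Measurable (S i)) (hindep : iIndepFun S P)
    (hlaw : ∀ i, P.map (S i) = Q) (fold : ∀ k : ℕ, Fin (L * k) → Fin L)
    (hfold : ∀ k ℓ, (Finset.univ.filter fun i => fold k i = ℓ).card = k) (ℓ : Fin L)
    {F : Measure ℝ} {f : Obs N T → ℝ} (hf : Measurable f) {B : ℝ≥0∞} (hB : B ≠ ∞)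
    (hfB : ∀ b : ℝ → ℝ≥0∞, Measurable b → ∫⁻ o, b o.x * ‖f o‖ₑ ^ 2 ∂Q ≤ B * ∫⁻ x, b x ∂F)
    {D : ∀ k : ℕ, (Train (fold k) ℓ → Obs N T) → ℝ → ℝ}
    (hD : ∀ k, Measurable (Function.uncurry (D k)))
    (hneg : Negligible P fun k ω => eLpNorm (D k (train (fold k) ℓ fun i => S i ω)) 2 F) :
    Negligible P fun k ω => ENNReal.ofReal (√((L * k : ℕ) : ℝ))⁻¹ *
      ‖∑ i with fold k i = ℓ, (D k (train (fold k) ℓ fun i => S i ω) (S i ω).x * f (S i ω)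
        - ∫ o, D k (train (fold k) ℓ fun i => S i ω) o.x * f o ∂Q)‖ₑ := by
  refine negligible_centered_sum (P := P) (Q := Q)
    (α := fun k => Train (fold k) ℓ → Obs N T) (ι := fun k => Fin (L * k))
    (τ := fun k ω => train (fold k) ℓ fun i => S i ω) (V := fun k i => S i)
    (f := fun k s o => D k s o.x * f o)
    (fun k => Finset.univ.filter fun i => fold k i = ℓ)
    (fun k => measurable_train hS _ _) (fun k i => hS _)
    (fun k i hi => map_train_prodMk hS hindep hlaw _ _ (Finset.mem_filter.1 hi).2)
    (fun k i hi j hj hij => map_train_prodMk_prodMk hS hindep hlaw _ _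
      (Finset.mem_filter.1 hi).2 (Finset.mem_filter.1 hj).2 hij)
    (fun k => ((hD k).comp (measurable_fst.prodMk (measurable_obs_x.comp measurable_snd))).mul
      (hf.comp measurable_snd))
    (ofReal_inv_sqrt_sq_mul_card_le fold hfold ℓ) ?_
  -- The conditional second moment is at most `B` times the squared norm of `D`, so consistency
  -- without a rate suffices.
  have h2 := (hneg.boundedInProb.mul_negligible hneg).const_mul hB
  refine h2.mono fun k ω => ?_
  have hm : Measurable (D k (train (fold k) ℓ fun i => S i ω)) :=
    (hD k).comp measurable_prodMk_left
  rw [← sq, ← lintegral_enorm_sq_eq]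
  refine le_trans (le_of_eq ?_) (hfB (fun x => ‖D k (train (fold k) ℓ fun i => S i ω) x‖ₑ ^ 2)
    (hm.enorm.pow_const 2))
  simp only [enorm_mul, mul_pow]

/-- Sums over a fold of products of errors of estimates that are computed without that fold. -/
lemma negligible_fold_sum (hS : ∀ i, Measurable (S i)) (hindep : iIndepFun S P)
    (hlaw : ∀ i, P.map (S i) = Q) (fold : ∀ k : ℕ, Fin (L * k) → Fin L)
    (hfold : ∀ k ℓ, (Finset.univ.filter fun i => fold k i = ℓ).card = k) (ℓ : Fin L)
    {F : Measure ℝ} (hQF : Q.map (fun o => o.x) = F)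
    {D : ∀ k : ℕ, (Train (fold k) ℓ → Obs N T) → ℝ → ℝ}
    (hD : ∀ k, Measurable (Function.uncurry (D k))) {f : Obs N T → ℝ} (hf : Measurable f)
    (hf1 : ∀ o, |f o| ≤ 1)
    (hneg : Negligible P fun k ω => ENNReal.ofReal √((L * k : ℕ) : ℝ) *
      ∫⁻ x, ‖D k (train (fold k) ℓ fun i => S i ω) x‖ₑ ∂F) :
    Negligible P fun k ω => ENNReal.ofReal (√((L * k : ℕ) : ℝ))⁻¹ *
      ‖∑ i with fold k i = ℓ, D k (train (fold k) ℓ fun i => S i ω) (S i ω).x * f (S i ω)‖ₑ := by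
  have hL : 1 ≤ L := ℓ.pos
  have h := negligible_sum_of_lintegral (P := P) (Q := Q)
    (α := fun k => Train (fold k) ℓ → Obs N T) (ι := fun k => Fin (L * k))
    (τ := fun k ω => train (fold k) ℓ fun i => S i ω) (V := fun k i => S i)
    (f := fun k s o => ‖D k s o.x * f o‖ₑ)
    (fun k => Finset.univ.filter fun i => fold k i = ℓ)
    (fun k => measurable_train hS _ _) (fun k i => hS _)
    (fun k i hi => map_train_prodMk hS hindep hlaw _ _ (Finset.mem_filter.1 hi).2)
    (fun k => (((hD k).comp (measurable_fst.prodMk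
      (measurable_obs_x.comp measurable_snd))).mul (hf.comp measurable_snd)).enorm)
    (ofReal_inv_sqrt_mul_card_le fold hfold ℓ)
    (by
      filter_upwards [eventually_gt_atTop 0] with k hk
      refine ⟨?_, ENNReal.ofReal_ne_top⟩
      rw [ne_eq, ENNReal.ofReal_eq_zero, not_le, Real.sqrt_pos]
      exact_mod_cast Nat.mul_pos hL hk)
    (hneg.mono fun k ω => by
      have hm : Measurable (D k (train (fold k) ℓ fun i => S i ω)) :=
        (hD k).comp measurable_prodMk_left
      gcongr
      rw [← hQF, lintegral_map hm.enorm measurable_obs_x]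
      refine lintegral_mono fun o => ?_
      rw [enorm_mul]
      refine mul_le_of_le_one_right zero_le ?_
      rw [Real.enorm_eq_ofReal_abs, ENNReal.ofReal_le_one]
      exact hf1 o)
  refine h.mono fun k ω => ?_
  gcongr
  exact enorm_sum_le _ _

end CrossFit

end SyntheticDiD

/-! ### Expansion of the moment function and of its conditional mean. -/

namespace SyntheticDiD

variable {N T : ℕ}

/-- True by construction of the last weight, also where the Gram matrix is singular. This makes the
mean insensitive to the error of `mΔ`. -/
lemma sum_leastSquaresWeights (m : Fin (N + 2) → Fin (T + 2) → ℝ → ℝ) (x : ℝ) :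
    ∑ g, leastSquaresWeights m g x = 1 := by
  rw [Fin.sum_univ_castSucc]
  simp [leastSquaresWeights]

/-- Expansion of the moment function in the nuisance functions. -/
lemma phi_sub_phi (mΔ mΔ' : ℝ → ℝ) (r r' w w' : Fin (N + 1) → ℝ → ℝ) (o : Obs N T) :
    phi mΔ' r' w' 1 o - phi mΔ r w 1 o =
      (∑ g, w' g o.x * (r' g o.x - r g o.x) * (mΔ' o.x - mΔ o.x) * o.ind g.succ)
      - (mΔ' o.x - mΔ o.x) * o.ind 0
      + (∑ g, w' g o.x * r g o.x * (mΔ' o.x - mΔ o.x) * o.ind g.succ)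
      - (∑ g, w' g o.x * (r' g o.x - r g o.x) * (o.ind g.succ * (o.dy - mΔ o.x)))
      - ∑ g, (w' g o.x - w g o.x) * r g o.x * (o.ind g.succ * (o.dy - mΔ o.x)) := by
  simp only [phi, div_one, one_mul]
  have : (∑ g : Fin (N + 1), w' g o.x * r' g o.x * o.ind g.succ * (o.dy - mΔ' o.x))
      - (∑ g : Fin (N + 1), w g o.x * r g o.x * o.ind g.succ * (o.dy - mΔ o.x)) =
      -(∑ g, w' g o.x * (r' g o.x - r g o.x) * (mΔ' o.x - mΔ o.x) * o.ind g.succ)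
      - (∑ g, w' g o.x * r g o.x * (mΔ' o.x - mΔ o.x) * o.ind g.succ)
      + (∑ g, w' g o.x * (r' g o.x - r g o.x) * (o.ind g.succ * (o.dy - mΔ o.x)))
      + ∑ g, (w' g o.x - w g o.x) * r g o.x * (o.ind g.succ * (o.dy - mΔ o.x)) := by
    rw [← Finset.sum_neg_distrib, ← Finset.sum_sub_distrib, ← Finset.sum_sub_distrib,
      ← Finset.sum_add_distrib, ← Finset.sum_add_distrib]
    refine Finset.sum_congr rfl fun g _ => ?_
    ring
  linear_combination -this

namespace Population

variable {Q : Measure (Obs N T)} [IsProbabilityMeasure Q] {F : Measure ℝ} [IsProbabilityMeasure F]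
  {q : Nuisance N T} {C : ℝ}

omit [IsProbabilityMeasure Q] [IsProbabilityMeasure F] in
lemma memLp_comp_x (hQ : Population Q F q C) {b : ℝ → ℝ} (hb : MemLp b 2 F) :
    MemLp (fun o => b o.x) 2 Q := by
  rw [← hQ.map_x] at hb
  exact hb.comp_of_map measurable_obs_x.aemeasurable

omit [IsProbabilityMeasure Q] [IsProbabilityMeasure F] in
lemma integral_mul_diff (hQ : Population Q F q C) {b : ℝ → ℝ} (hbm : Measurable b)
    (hb : MemLp b 2 F) (g : Fin (N + 2)) :
    ∫ o, b o.x * (o.ind g * (o.dy - q.mΔ o.x)) ∂Q =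
      ∫ x, b x * (q.p g x * (q.mDelta g x - q.mΔ x)) ∂F :=
  hQ.integral_diff g b hbm ((hQ.memLp_comp_x hb).integrable_mul (hQ.memLp_diff g))

/-- The mean of the linear part of the expansion of the moment function. -/
lemma enorm_mean_expansion_le (hC : 0 ≤ C) : ∃ B : ℝ≥0∞, B ≠ ∞ ∧
    ∀ (Q : Measure (Obs N T)) (q : Nuisance N T), Population Q F q C →
    ∀ (mΔ' : ℝ → ℝ) (r' w' : Fin (N + 1) → ℝ → ℝ) (m' : Fin (N + 2) → Fin (T + 2) → ℝ → ℝ),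
    (∀ g x, w' g x = leastSquaresWeights m' g x) →
    MemLp (mΔ' - q.mΔ) 2 F → (∀ g, MemLp (r' g - q.r g) 2 F) →
    (∀ g t, MemLp (m' g t - q.m g t) 2 F) → (∀ g, MemLp (w' g) ∞ F) →
    Measurable mΔ' → (∀ g, Measurable (r' g)) → (∀ g, Measurable (w' g)) →
    ‖-(∫ o, (mΔ' o.x - q.mΔ o.x) * o.ind 0 ∂Q)
      + (∑ g, ∫ o, w' g o.x * q.r g o.x * (mΔ' o.x - q.mΔ o.x) * o.ind g.succ ∂Q)
      - (∑ g, ∫ o, w' g o.x * (r' g o.x - q.r g o.x) * (o.ind g.succ * (o.dy - q.mΔ o.x)) ∂Q)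
      - (∑ g, ∫ o, (w' g o.x - q.w g o.x) * q.r g o.x * (o.ind g.succ * (o.dy - q.mΔ o.x)) ∂Q)
      + ((∑ g, ∫ x, q.ratioCoef g x * (r' g x - q.r g x) ∂F)
        + ∑ k : Fin (N + 2) × Fin (T + 1), ∫ x, q.scoreCoef k x *
          (m' k.1 k.2.castSucc x - q.m k.1 k.2.castSucc x) ∂F)‖ₑ ≤
    B * ((∑ g, eLpNorm (w' g - q.w g) 2 F * eLpNorm (r' g - q.r g) 2 F)
      + (∑ g, ∑ t, eLpNorm (m' g t - q.m g t) 2 F) * (∑ g, eLpNorm (w' g - q.w g) 2 F)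
      + (∑ g, eLpNorm (w' g) ∞ F + 1) * (∑ g, ∑ t, eLpNorm (m' g t - q.m g t) 2 F) ^ 2) := by
  obtain ⟨C', hC', H⟩ := Nuisance.RegularAt.abs_sum_sub_score_le (N := N) (T := T) hC
  refine ⟨ENNReal.ofReal C + ENNReal.ofReal C' * (1 + (N + 1) * ENNReal.ofReal C),
    by finiteness, ?_⟩
  intro Q q hQ mΔ' r' w' m' hw' hΔ hr hm hw hΔm hrm hwm
  have hwsum : ∀ x, ∑ g, w' g x = 1 := fun x => by
    simp only [hw', sum_leastSquaresWeights]
  -- This bound supplies integrability only and does not enter the constant, which has to be uniform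
  -- in the population.
  obtain ⟨B, hB⟩ := hQ.exists_abs_scoreCoef_le hC
  have bdd : ∀ {b f : ℝ → ℝ} {B : ℝ}, Measurable b → (∀ᵐ x ∂F, |b x| ≤ B) → MemLp f 2 F →
      MemLp (fun x => b x * f x) 2 F := fun hb hB hf =>
    hf.of_le_mul (hb.aestronglyMeasurable.mul hf.1) (hB.mono fun x hx => by
      rw [norm_mul]; exact mul_le_mul_of_nonneg_right hx (norm_nonneg _))
  have hp1 : ∀ g, ∀ᵐ x ∂F, |q.p g x| ≤ 1 := fun g => hQ.regular.mono fun x hx => by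
    rw [abs_of_pos (hx.p_pos g)]; exact hx.p_le g
  have hrC : ∀ g, ∀ᵐ x ∂F, |q.r g x| ≤ C := fun g => hQ.regular.mono fun x hx => by
    rw [abs_of_nonneg (hx.r_nonneg g)]; exact hx.r_le g
  have hwC : ∀ g, ∀ᵐ x ∂F, |q.w g x| ≤ C := fun g => hQ.regular.mono fun x hx => hx.w_le g
  have hw2 : ∀ g, MemLp (fun x => q.w g x) 2 F := fun g =>
    MemLp.of_bound (hQ.measurable_w g).aestronglyMeasurable C (hwC g)
  have hdw : ∀ g, MemLp (w' g - q.w g) 2 F := fun g =>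
    ((hw g).mono_exponent le_top).sub (hw2 g)
  have hwr : ∀ g, MemLp (fun x => w' g x * (r' g x - q.r g x)) 2 F := fun g =>
    (hr g).mul (hw g)
  have hwd : ∀ g, MemLp (fun x => w' g x * (mΔ' x - q.mΔ x)) 2 F := fun g =>
    hΔ.mul (hw g)
  have hdwr : ∀ g, MemLp (fun x => (w' g x - q.w g x) * q.r g x) 2 F := fun g =>
    (bdd (hQ.measurable_r g) (hrC g) (hdw g)).ae_eq (Eventually.of_forall fun x => by
      simp [mul_comm])
  have hpb : ∀ g : Fin (N + 1), ∀ᵐ x ∂F, |q.p g.succ x * (q.mDelta g.succ x - q.mΔ x)| ≤ C :=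
    fun g => hQ.regular.mono fun x hx => by
      rw [abs_mul, abs_of_pos (hx.p_pos _)]
      exact (mul_le_of_le_one_left (abs_nonneg _) (hx.p_le _)).trans (hx.bias_le g)
  have hpbm : ∀ g : Fin (N + 1), Measurable fun x =>
      q.p g.succ x * (q.mDelta g.succ x - q.mΔ x) := fun g =>
    (hQ.measurable_p _).mul ((hQ.measurable_mDelta _).sub hQ.measurable_mΔ)
  -- the means of the single terms
  have m1 : ∫ o, (mΔ' o.x - q.mΔ o.x) * o.ind 0 ∂Q = ∫ x, (mΔ' x - q.mΔ x) * q.p 0 x ∂F :=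
    hQ.integral_ind 0 (fun x => mΔ' x - q.mΔ x) (hΔm.sub hQ.measurable_mΔ)
  have m2 : ∀ g : Fin (N + 1),
      ∫ o, w' g o.x * q.r g o.x * (mΔ' o.x - q.mΔ o.x) * o.ind g.succ ∂Q =
        ∫ x, q.p 0 x * (w' g x * (mΔ' x - q.mΔ x)) ∂F := fun g => by
    rw [hQ.integral_ind g.succ (fun x => w' g x * q.r g x * (mΔ' x - q.mΔ x))
      (((hwm g).mul (hQ.measurable_r g)).mul (hΔm.sub hQ.measurable_mΔ))]
    refine integral_congr_ae (hQ.regular.mono fun x hx => ?_)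
    have := (hx.p_pos g.succ).ne'
    simp only [Nuisance.r]
    field_simp
  have m3 : ∀ g : Fin (N + 1), ∫ o, w' g o.x * (r' g o.x - q.r g o.x) *
      (o.ind g.succ * (o.dy - q.mΔ o.x)) ∂Q = ∫ x, q.p g.succ x *
        (q.mDelta g.succ x - q.mΔ x) * (w' g x * (r' g x - q.r g x)) ∂F := fun g => by
    rw [hQ.integral_mul_diff (b := fun x => w' g x * (r' g x - q.r g x))
      ((hwm g).mul ((hrm g).sub (hQ.measurable_r g))) (hwr g)]
    simp only [mul_comm]
  have m4 : ∀ g : Fin (N + 1), ∫ o, (w' g o.x - q.w g o.x) * q.r g o.x *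
      (o.ind g.succ * (o.dy - q.mΔ o.x)) ∂Q = ∫ x, q.p g.succ x *
        (q.mDelta g.succ x - q.mΔ x) * ((w' g x - q.w g x) * q.r g x) ∂F := fun g => by
    rw [hQ.integral_mul_diff (b := fun x => (w' g x - q.w g x) * q.r g x)
      (((hwm g).sub (hQ.measurable_w g)).mul (hQ.measurable_r g)) (hdwr g)]
    simp only [mul_comm]
  -- integrability
  have i1 : Integrable (fun x => (mΔ' x - q.mΔ x) * q.p 0 x) F :=
    ((bdd (hQ.measurable_p 0) (hp1 0) hΔ).integrable (by norm_num)).congr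
      (Eventually.of_forall fun x => by simp [mul_comm])
  have i2 : ∀ g, Integrable (fun x => q.p 0 x * (w' g x * (mΔ' x - q.mΔ x))) F := fun g =>
    (bdd (hQ.measurable_p 0) (hp1 0) (hwd g)).integrable (by norm_num)
  have i3 : ∀ g : Fin (N + 1), Integrable (fun x => q.p g.succ x *
      (q.mDelta g.succ x - q.mΔ x) * (w' g x * (r' g x - q.r g x))) F := fun g =>
    (bdd (hpbm g) (hpb g) (hwr g)).integrable (by norm_num)
  have i4 : ∀ g : Fin (N + 1), Integrable (fun x => q.p g.succ x *
      (q.mDelta g.succ x - q.mΔ x) * ((w' g x - q.w g x) * q.r g x)) F := fun g =>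
    (bdd (hpbm g) (hpb g) (hdwr g)).integrable (by norm_num)
  have i5 : ∀ g, Integrable (fun x => q.ratioCoef g x * (r' g x - q.r g x)) F := fun g =>
    (bdd (hQ.measurable_ratioCoef g) (hQ.abs_ratioCoef_le g) (hr g)).integrable (by norm_num)
  have i6 : ∀ k : Fin (N + 2) × Fin (T + 1), Integrable (fun x => q.scoreCoef k x *
      (m' k.1 k.2.castSucc x - q.m k.1 k.2.castSucc x)) F := fun k =>
    (bdd (hQ.measurable_scoreCoef k) (hB k) (hm _ _)).integrable (by norm_num)
  have j2 := integrable_finsetSum Finset.univ fun g _ => i2 g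
  have j3 := integrable_finsetSum Finset.univ fun g _ => i3 g
  have j4 := integrable_finsetSum Finset.univ fun g _ => i4 g
  have j5 := integrable_finsetSum Finset.univ fun g _ => i5 g
  have j6 := integrable_finsetSum Finset.univ fun k _ => i6 k
  have k1 : Integrable (fun x => -((mΔ' x - q.mΔ x) * q.p 0 x)) F := i1.neg
  have k2 : Integrable (fun x => -((mΔ' x - q.mΔ x) * q.p 0 x)
      + ∑ g, q.p 0 x * (w' g x * (mΔ' x - q.mΔ x))) F := k1.add j2
  have k3 : Integrable (fun x => -((mΔ' x - q.mΔ x) * q.p 0 x)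
      + (∑ g, q.p 0 x * (w' g x * (mΔ' x - q.mΔ x)))
      - ∑ g : Fin (N + 1), q.p g.succ x * (q.mDelta g.succ x - q.mΔ x) *
        (w' g x * (r' g x - q.r g x))) F := k2.sub j3
  have k4 : Integrable (fun x => -((mΔ' x - q.mΔ x) * q.p 0 x)
      + (∑ g, q.p 0 x * (w' g x * (mΔ' x - q.mΔ x)))
      - (∑ g : Fin (N + 1), q.p g.succ x * (q.mDelta g.succ x - q.mΔ x) *
        (w' g x * (r' g x - q.r g x)))
      - ∑ g : Fin (N + 1), q.p g.succ x * (q.mDelta g.succ x - q.mΔ x) *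
        ((w' g x - q.w g x) * q.r g x)) F := k3.sub j4
  have k5 : Integrable (fun x => (∑ g, q.ratioCoef g x * (r' g x - q.r g x))
      + ∑ k : Fin (N + 2) × Fin (T + 1), q.scoreCoef k x *
        (m' k.1 k.2.castSucc x - q.m k.1 k.2.castSucc x)) F := j5.add j6
  simp only [m1, m2, m3, m4]
  rw [← integral_neg, ← integral_finsetSum _ fun g _ => i2 g,
    ← integral_finsetSum _ fun g _ => i3 g, ← integral_finsetSum _ fun g _ => i4 g,
    ← integral_finsetSum _ fun g _ => i5 g, ← integral_finsetSum _ fun k _ => i6 k,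
    ← integral_add k1 j2, ← integral_sub k2 j3, ← integral_sub k3 j4, ← integral_add j5 j6,
    ← integral_add k4 k5]
  refine (enorm_integral_le_lintegral_enorm _).trans ?_
  set d : ℝ → ℝ := fun x => ∑ g, ∑ t, |m' g t x - q.m g t x| with hd
  set e : ℝ → ℝ := fun x => ∑ g, |w' g x - q.w g x| with he
  set A : ℝ≥0∞ := ∑ g, eLpNorm (w' g) ∞ F with hA
  have hdL : MemLp d 2 F := memLp_finsetSum _ fun g _ => memLp_finsetSum _ fun t _ => (hm g t).abs
  have heL : MemLp e 2 F := memLp_finsetSum _ fun g _ => (hdw g).abs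
  have hd2 : eLpNorm d 2 F ≤ ∑ g, ∑ t, eLpNorm (m' g t - q.m g t) 2 F := by
    have h1 : d = ∑ g, ∑ t, fun x => |m' g t x - q.m g t x| := by
      funext x
      simp only [hd, Finset.sum_apply]
    rw [h1]
    refine (eLpNorm_sum_le (fun g _ => Finset.aestronglyMeasurable_sum _ fun t _ =>
      (hm g t).abs.1) (by norm_num)).trans (Finset.sum_le_sum fun g _ => ?_)
    refine (eLpNorm_sum_le (fun t _ => (hm g t).abs.1) (by norm_num)).trans
      (Finset.sum_le_sum fun t _ => ?_)
    exact (eLpNorm_norm (m' g t - q.m g t)).le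
  have he2 : eLpNorm e 2 F ≤ ∑ g, eLpNorm (w' g - q.w g) 2 F := by
    have h1 : e = ∑ g, fun x => |w' g x - q.w g x| := by
      funext x
      simp only [he, Finset.sum_apply]
    rw [h1]
    refine (eLpNorm_sum_le (fun g _ => (hdw g).abs.1) (by norm_num)).trans
      (Finset.sum_le_sum fun g _ => ?_)
    exact (eLpNorm_norm (w' g - q.w g)).le
  -- The essential bound of the weights absorbs one factor of the cubic term `d ^ 2 * e`, which is
  -- thereby reduced to `d ^ 2`.
  have heA : ∀ᵐ x ∂F, ‖e x‖ₑ ≤ A + (N + 1) * ENNReal.ofReal C := by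
    filter_upwards [hQ.regular, ae_all_iff.2 fun g => ae_enorm_le_eLpNorm_top (μ := F) (w' g)]
      with x hx hwx
    refine (enorm_sum_le _ _).trans ?_
    calc _ ≤ ∑ g : Fin (N + 1), (eLpNorm (w' g) ∞ F + ENNReal.ofReal C) := by
          refine Finset.sum_le_sum fun g _ => ?_
          rw [Real.enorm_abs]
          refine enorm_sub_le.trans (add_le_add (hwx g) ?_)
          rw [Real.enorm_eq_ofReal_abs]
          exact ENNReal.ofReal_le_ofReal (hx.w_le g)
      _ = _ := by
          rw [Finset.sum_add_distrib]
          simp [hA]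
  calc _ ≤ ∫⁻ x, (ENNReal.ofReal C * (∑ g, ‖w' g x - q.w g x‖ₑ * ‖r' g x - q.r g x‖ₑ) +
        ENNReal.ofReal C' * (‖d x‖ₑ * ‖e x‖ₑ +
          (A + (N + 1) * ENNReal.ofReal C + 1) * (‖d x‖ₑ * ‖d x‖ₑ))) ∂F := by
        refine lintegral_mono_ae ?_
        filter_upwards [hQ.regular, heA] with x hx hex
        have hH := H q x hx m' (d x) (e x) rfl (by simp only [he, hw'])
        simp only [← hw'] at hH
        have hd0 : 0 ≤ d x :=
          Finset.sum_nonneg fun _ _ => Finset.sum_nonneg fun _ _ => abs_nonneg _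
        have he0 : 0 ≤ e x := Finset.sum_nonneg fun _ _ => abs_nonneg _
        -- The estimated weights sum to one, so the two terms in the error of `mΔ` cancel exactly.
        have e1 : ∑ g, q.p 0 x * (w' g x * (mΔ' x - q.mΔ x)) = (mΔ' x - q.mΔ x) * q.p 0 x := by
          rw [← Finset.mul_sum, ← Finset.sum_mul, hwsum]
          ring
        -- Replacing the estimated weight by the true one costs a product of two errors.
        have e2 : ∑ g : Fin (N + 1), q.p g.succ x * (q.mDelta g.succ x - q.mΔ x) *
            (w' g x * (r' g x - q.r g x)) = (∑ g, q.ratioCoef g x * (r' g x - q.r g x)) +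
            ∑ g : Fin (N + 1), q.p g.succ x * (q.mDelta g.succ x - q.mΔ x) *
              ((w' g x - q.w g x) * (r' g x - q.r g x)) := by
          rw [← Finset.sum_add_distrib]
          refine Finset.sum_congr rfl fun g _ => ?_
          rw [Nuisance.ratioCoef]
          ring
        -- Here `p_g r_g = p₀` turns the coefficient into `u`.
        have e3 : ∑ g : Fin (N + 1), q.p g.succ x * (q.mDelta g.succ x - q.mΔ x) *
            ((w' g x - q.w g x) * q.r g x) = ∑ g, q.vecU x g * (w' g x - q.w g x) := by
          refine Finset.sum_congr rfl fun g _ => ?_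
          rw [Nuisance.r, Nuisance.vecU]
          have := (hx.p_pos g.succ).ne'
          field_simp
        have e4 : ∑ k : Fin (N + 2) × Fin (T + 1), q.scoreCoef k x *
            (m' k.1 k.2.castSucc x - q.m k.1 k.2.castSucc x) =
            q.score x fun g t => m' g t.castSucc x - q.m g t.castSucc x := by
          rw [Nuisance.score_eq_sum]
          exact Finset.sum_congr rfl fun k _ => mul_comm _ _
        have e5 : ∀ a b c c' u : ℝ, -a + a - (b + c) - u + (b + c') = -c - (u - c') :=
          fun a b c c' u => by ring
        rw [e1, e2, e3, e4, e5]
        refine enorm_sub_le.trans (add_le_add ?_ ?_)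
        · rw [enorm_neg, Finset.mul_sum]
          refine (enorm_sum_le _ _).trans (Finset.sum_le_sum fun g _ => ?_)
          rw [enorm_mul, enorm_mul (w' g x - q.w g x)]
          gcongr
          rw [Real.enorm_eq_ofReal_abs, abs_mul, abs_of_pos (hx.p_pos _)]
          exact ENNReal.ofReal_le_ofReal
            ((mul_le_of_le_one_left (abs_nonneg _) (hx.p_le _)).trans (hx.bias_le g))
        · rw [Real.enorm_eq_ofReal_abs]
          refine (ENNReal.ofReal_le_ofReal hH).trans ?_
          rw [ENNReal.ofReal_mul hC', add_assoc,
            ENNReal.ofReal_add (by positivity) (by positivity),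
            ENNReal.ofReal_add (by positivity) (by positivity), ENNReal.ofReal_mul hd0,
            ENNReal.ofReal_mul (by positivity), ENNReal.ofReal_pow hd0,
            ← Real.enorm_of_nonneg hd0, ← Real.enorm_of_nonneg he0, ← sq, add_mul _ 1, one_mul,
            mul_comm (‖d x‖ₑ ^ 2)]
          gcongr
    _ = ENNReal.ofReal C * (∑ g, ∫⁻ x, ‖w' g x - q.w g x‖ₑ * ‖r' g x - q.r g x‖ₑ ∂F) +
        ENNReal.ofReal C' * ((∫⁻ x, ‖d x‖ₑ * ‖e x‖ₑ ∂F) +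
          (A + (N + 1) * ENNReal.ofReal C + 1) * ∫⁻ x, ‖d x‖ₑ * ‖d x‖ₑ ∂F) := by
        have hdm : AEMeasurable (fun x => ‖d x‖ₑ) F := hdL.1.enorm
        have hem : AEMeasurable (fun x => ‖e x‖ₑ) F := heL.1.enorm
        have hg : ∀ g, AEMeasurable (fun x => ‖w' g x - q.w g x‖ₑ * ‖r' g x - q.r g x‖ₑ) F :=
          fun g => (hdw g).1.enorm.mul (hr g).1.enorm
        have hde : AEMeasurable (fun x => ‖d x‖ₑ * ‖e x‖ₑ) F := hdm.mul hem
        have hdd : AEMeasurable (fun x => ‖d x‖ₑ * ‖d x‖ₑ) F := hdm.mul hdm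
        rw [lintegral_add_left' ((Finset.aemeasurable_fun_sum _ fun g _ => hg g).const_mul _),
          lintegral_const_mul' _ _ ENNReal.ofReal_ne_top,
          lintegral_const_mul' _ _ ENNReal.ofReal_ne_top, lintegral_add_left' hde,
          lintegral_finsetSum' _ fun g _ => hg g, lintegral_const_mul'' _ hdd]
    _ ≤ ENNReal.ofReal C * (∑ g, eLpNorm (w' g - q.w g) 2 F * eLpNorm (r' g - q.r g) 2 F) +
        ENNReal.ofReal C' * ((∑ g, ∑ t, eLpNorm (m' g t - q.m g t) 2 F) *
            (∑ g, eLpNorm (w' g - q.w g) 2 F) +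
          (A + (N + 1) * ENNReal.ofReal C + 1) *
            ((∑ g, ∑ t, eLpNorm (m' g t - q.m g t) 2 F) *
            (∑ g, ∑ t, eLpNorm (m' g t - q.m g t) 2 F))) := by
        gcongr with g
        · exact lintegral_enorm_mul_enorm_le (hdw g).1 (hr g).1
        · exact (lintegral_enorm_mul_enorm_le hdL.1 heL.1).trans (mul_le_mul' hd2 he2)
        · exact (lintegral_enorm_mul_enorm_le hdL.1 hdL.1).trans (mul_le_mul' hd2 hd2)
    _ ≤ _ := by
        generalize (∑ g, ∑ t, eLpNorm (m' g t - q.m g t) 2 F) = a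
        generalize (∑ g, eLpNorm (w' g - q.w g) 2 F) = b
        generalize (∑ g, eLpNorm (w' g - q.w g) 2 F * eLpNorm (r' g - q.r g) 2 F) = c
        generalize ENNReal.ofReal C = z
        generalize ENNReal.ofReal C' = z'
        have h1 : (A + (N + 1) * z + 1) ≤ (1 + (N + 1) * z) * (A + 1) := by
          calc _ ≤ A + (N + 1) * z + 1 + (N + 1) * z * A := le_self_add
            _ = _ := by ring
        calc _ ≤ z * c + z' * (a * b + ((1 + (N + 1) * z) * (A + 1)) * (a * a)) := by gcongr
          -- The added terms are nonnegative and complete the expression to a product with the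
          -- single constant.
          _ ≤ z * c + z' * (a * b + ((1 + (N + 1) * z) * (A + 1)) * (a * a)) +
              (z * (a * b + (A + 1) * a ^ 2) + z' * (1 + (N + 1) * z) * c
                + z' * (N + 1) * z * (a * b)) := le_self_add
          _ = _ := by ring

end Population

end SyntheticDiD

/-! ### The sampling design and the first-step conditions. -/

namespace SyntheticDiD

variable {N T : ℕ}

section Average

variable {ι κ : Type*} [Fintype ι]

lemma average_add (s : ι → Obs N T) (f g : Obs N T → ℝ) :
    average s (fun o => f o + g o) = average s f + average s g := by
  simp only [average, Finset.sum_add_distrib, mul_add]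

lemma average_sum (s : ι → Obs N T) (a : Finset κ) (f : κ → Obs N T → ℝ) :
    average s (fun o => ∑ j ∈ a, f j o) = ∑ j ∈ a, average s (f j) := by
  simp only [average]
  rw [Finset.sum_comm, Finset.mul_sum]

end Average

variable {Ω : Type*} [MeasurableSpace Ω]

/-- A random sample `S` from `Q`, split into `L` folds of equal size, whose covariate has density
`fX` and compact support, together with a kernel `K` and a bandwidth `h`. -/
structure Design (P : Measure Ω) (Q : Measure (Obs N T)) (F : Measure ℝ) (S : ℕ → Ω → Obs N T)
    {L : ℕ} (fold : ∀ k : ℕ, Fin (L * k) → Fin L) (fX K : ℝ → ℝ) (h : ℕ → ℝ) : Prop where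
  measurable : ∀ i, Measurable (S i)
  indep : iIndepFun S P
  law : ∀ i, P.map (S i) = Q
  two_le : 2 ≤ L
  card_fold : ∀ k ℓ, (Finset.univ.filter fun i => fold k i = ℓ).card = k
  measurable_density : Measurable fX
  density_nonneg : ∀ x, 0 ≤ fX x
  density : F = volume.withDensity fun x => ENNReal.ofReal (fX x)
  compact : IsCompact F.support
  map_x : Q.map (fun o => o.x) = F
  measurable_kernel : Measurable K
  integrable_kernel : Integrable K
  kernel_nonneg : ∀ u, 0 ≤ K u
  integral_kernel : ∫ u, K u = 1
  bandwidth_pos : ∀ n, 0 < h n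
  bandwidth_tendsto : Tendsto h atTop (𝓝 0)

/-- The rate conditions on the first-step estimators of a fold. -/
structure FirstStep (P : Measure Ω) (F : Measure ℝ) (q : Nuisance N T) (S : ℕ → Ω → Obs N T)
    {L : ℕ} (fold : ∀ k : ℕ, Fin (L * k) → Fin L) (fX K : ℝ → ℝ) (h : ℕ → ℝ) (ℓ : Fin L)
    (e : ∀ k : ℕ, Estimators (Train (fold k) ℓ) N T) : Prop where
  measurable : ∀ k, (e k).IsMeasurable
  bounded_w : ∀ g, BoundedInProb P fun k ω =>
    eLpNorm ((e k).w g (train (fold k) ℓ fun i => S i ω)) ∞ F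
  error_mΔ : Negligible P fun k ω =>
    eLpNorm ((e k).mΔ (train (fold k) ℓ fun i => S i ω) - q.mΔ) 2 F
  error_prod : ∀ g, Negligible P fun k ω => ENNReal.ofReal √((L * k : ℕ) : ℝ) *
    (eLpNorm ((e k).r g (train (fold k) ℓ fun i => S i ω) - q.r g) 2 F *
      eLpNorm ((e k).mΔ (train (fold k) ℓ fun i => S i ω) - q.mΔ) 2 F)
  error_m : ∀ g t, Negligible P fun k ω => ENNReal.ofReal √√((L * k : ℕ) : ℝ) *
    eLpNorm ((e k).m g t (train (fold k) ℓ fun i => S i ω) - q.m g t) 2 F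
  error_r : ∀ g, Negligible P fun k ω => ENNReal.ofReal √√((L * k : ℕ) : ℝ) *
    eLpNorm ((e k).r g (train (fold k) ℓ fun i => S i ω) - q.r g) 2 F
  error_w : ∀ g, Negligible P fun k ω => ENNReal.ofReal √√((L * k : ℕ) : ℝ) *
    eLpNorm ((e k).w g (train (fold k) ℓ fun i => S i ω) - q.w g) 2 F
  bahadur_r : ∀ g, Negligible P fun k ω => ENNReal.ofReal √((L * k : ℕ) : ℝ) *
    eLpNorm (fun x => (e k).r g (train (fold k) ℓ fun i => S i ω) x - q.r g x
      - ratioBahadur q fX K (h (L * k)) g (train (fold k) ℓ fun i => S i ω) x) 1 F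
  bahadur_m : ∀ g (t : Fin (T + 1)), Negligible P fun k ω => ENNReal.ofReal √((L * k : ℕ) : ℝ) *
    eLpNorm (fun x => (e k).m g t.castSucc (train (fold k) ℓ fun i => S i ω) x - q.m g t.castSucc x
      - outcomeBahadur q fX K (h (L * k)) g t.castSucc (train (fold k) ℓ fun i => S i ω) x) 1 F

variable {P : Measure Ω} [IsProbabilityMeasure P] {Q : Measure (Obs N T)} [IsProbabilityMeasure Q]
  {F : Measure ℝ} [IsProbabilityMeasure F] {q : Nuisance N T} {C : ℝ} {S : ℕ → Ω → Obs N T} {L : ℕ}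
  {fold : ∀ k : ℕ, Fin (L * k) → Fin L} {fX K : ℝ → ℝ} {h : ℕ → ℝ} {ℓ : Fin L}
  {e : ∀ k : ℕ, Estimators (Train (fold k) ℓ) N T}

namespace Design

omit [IsProbabilityMeasure P] [IsProbabilityMeasure Q] [IsProbabilityMeasure F] in
lemma ae_sample (hd : Design P Q F S fold fX K h) {s : ℝ → Prop} (hs : ∀ᵐ x ∂F, s x) :
    ∀ᵐ ω ∂P, ∀ i, s (S i ω).x := by
  rw [ae_all_iff]
  intro i
  rw [← hd.map_x, ← hd.law i] at hs
  exact ae_of_ae_map (hd.measurable i).aemeasurable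
    (ae_of_ae_map measurable_obs_x.aemeasurable hs)

omit [IsProbabilityMeasure F] in
/-- A root-`n` weighted integral of an estimation error with a Bahadur representation is
asymptotically linear; the weight function is bounded almost everywhere. -/
lemma negligible_integral_sub_average_of_ae (hd : Design P Q F S fold fX K h) (ℓ : Fin L)
    {c : ℝ → ℝ} {B : ℝ} (hc : Measurable c) (hB : ∀ᵐ x ∂F, |c x| ≤ B) {Z : Obs N T → ℝ}
    (hZm : Measurable Z) (hZ2 : MemLp Z 2 Q)
    (hZ0 : ∀ b : ℝ → ℝ, Measurable b → (∃ C, ∀ᵐ x ∂F, |b x| ≤ C) → ∫ o, b o.x * Z o ∂Q = 0)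
    {D : ∀ k : ℕ, (Train (fold k) ℓ → Obs N T) → ℝ → ℝ} (hD : ∀ k s, Measurable (D k s))
    (hrem : Negligible P fun k ω => ENNReal.ofReal √((L * k : ℕ) : ℝ) *
      eLpNorm (fun x => D k (train (fold k) ℓ fun i => S i ω) x
        - average (train (fold k) ℓ fun i => S i ω)
            fun o => K ((o.x - x) / h (L * k)) / h (L * k) / fX x * Z o) 1 F) :
    Negligible P fun k ω => ENNReal.ofReal √((L * k : ℕ) : ℝ) *
      ‖∫ x, c x * D k (train (fold k) ℓ fun i => S i ω) x ∂F
        - average (train (fold k) ℓ fun i => S i ω) (fun o => c o.x * Z o)‖ₑ := by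
  -- Cutting `c` off outside this set of full measure makes it bounded everywhere, Lebesgue
  -- integrable by the compactness of the support, and zero where the density vanishes.
  set A : Set ℝ := F.support ∩ {x | fX x ≠ 0} ∩ {x | |c x| ≤ B} with hA
  have hAm : MeasurableSet A :=
    (hd.compact.isClosed.measurableSet.inter
      (hd.measurable_density (measurableSet_singleton (0 : ℝ))).compl).inter
      (measurableSet_le hc.abs measurable_const)
  have hAF : ∀ᵐ x ∂F, x ∈ A := by
    have h1 : ∀ᵐ x ∂F, fX x ≠ 0 := by
      rw [hd.density, ae_withDensity_iff hd.measurable_density.ennreal_ofReal]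
      refine Eventually.of_forall fun x hx h0 => hx ?_
      rw [h0, ENNReal.ofReal_zero]
    filter_upwards [h1, hB, Measure.support_mem_ae] with x h1 h2 h3
    exact ⟨⟨h3, h1⟩, h2⟩
  have hcA : ∀ᵐ x ∂F, A.indicator c x = c x := hAF.mono fun x hx => Set.indicator_of_mem hx c
  have hcB : ∀ x, |A.indicator c x| ≤ |B| := by
    intro x
    by_cases hx : x ∈ A
    · rw [Set.indicator_of_mem hx]
      exact (show |c x| ≤ B from hx.2).trans (le_abs_self B)
    · simp [Set.indicator_of_notMem hx]
  have hci : Integrable (A.indicator c) := by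
    refine (integrable_indicator_iff hAm).2 ?_
    refine Measure.integrableOn_of_bounded (M := B) ?_ hc.aestronglyMeasurable ?_
    · exact ((measure_mono fun x hx => hx.1.1).trans_lt hd.compact.measure_lt_top).ne
    · filter_upwards [ae_restrict_mem hAm] with x hx
      exact hx.2
  have h1 := negligible_integral_sub_average hd.measurable hd.indep hd.law hd.two_le fold
    hd.card_fold ℓ hd.measurable_density hd.density_nonneg hd.density hd.map_x
    hd.measurable_kernel hd.integrable_kernel hd.kernel_nonneg hd.integral_kernel
    (hc.indicator hAm) hcB hci
    (fun x hx => Set.indicator_of_notMem (fun hxA => hxA.1.2 hx) c)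
    hd.bandwidth_pos hd.bandwidth_tendsto hZm hZ2
    (fun b hb hbC => hZ0 b hb (hbC.imp fun C hC => Eventually.of_forall hC)) hD hrem
  refine h1.mono_ae (Eventually.of_forall fun k => ?_)
  -- Almost surely the cut-off is invisible at every sample point, so neither the integral nor the
  -- average changes.
  filter_upwards [hd.ae_sample hcA] with ω hω
  refine le_of_eq ?_
  congr 3
  · exact integral_congr_ae (hcA.mono fun x hx => by simp only [hx])
  · simp only [average, train, hω]

end Design

namespace FirstStep

omit [IsProbabilityMeasure P] [IsProbabilityMeasure F] in
lemma measurable_w (hf : FirstStep P F q S fold fX K h ℓ e) (k : ℕ) (g : Fin (N + 1)) :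
    Measurable (Function.uncurry ((e k).w g)) :=
  measurable_leastSquares (m := fun a : (Train (fold k) ℓ → Obs N T) × ℝ =>
    fun g t => (e k).m g t a.1) (x := fun a => a.2) (fun g t => (hf.measurable k).2.1 g t) g

end FirstStep

end SyntheticDiD

/-! ### Asymptotic linearity of the conditional mean. -/

namespace SyntheticDiD

variable {N T : ℕ}

lemma ofReal_mul_enorm {a : ℝ} (ha : 0 ≤ a) (x : ℝ) : ENNReal.ofReal a * ‖x‖ₑ = ‖a * x‖ₑ := by
  rw [enorm_mul, Real.enorm_of_nonneg ha]

variable {Ω : Type*} [MeasurableSpace Ω]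

section Enorm

variable {P : Measure Ω} {f g : ℕ → Ω → ℝ}

lemma Negligible.enorm_add (hf : Negligible P fun k ω => ‖f k ω‖ₑ)
    (hg : Negligible P fun k ω => ‖g k ω‖ₑ) : Negligible P fun k ω => ‖f k ω + g k ω‖ₑ :=
  (hf.add hg).mono fun _ _ => enorm_add_le _ _

lemma Negligible.enorm_sub (hf : Negligible P fun k ω => ‖f k ω‖ₑ)
    (hg : Negligible P fun k ω => ‖g k ω‖ₑ) : Negligible P fun k ω => ‖f k ω - g k ω‖ₑ :=
  (hf.add hg).mono fun _ _ => enorm_sub_le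

lemma negligible_enorm_sum {ι : Type*} (s : Finset ι) {f : ι → ℕ → Ω → ℝ}
    (hf : ∀ i, Negligible P fun k ω => ‖f i k ω‖ₑ) :
    Negligible P fun k ω => ‖∑ i ∈ s, f i k ω‖ₑ :=
  (negligible_sum s fun i _ => hf i).mono fun _ _ => enorm_sum_le _ _

end Enorm

/-- The mean of the part of the expansion of the moment function that is linear in the estimation
errors. -/
noncomputable def Nuisance.expansionMean (q : Nuisance N T) (Q : Measure (Obs N T)) (mΔ' : ℝ → ℝ)
    (r' w' : Fin (N + 1) → ℝ → ℝ) : ℝ :=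
  -(∫ o, (mΔ' o.x - q.mΔ o.x) * o.ind 0 ∂Q)
    + (∑ g, ∫ o, w' g o.x * q.r g o.x * (mΔ' o.x - q.mΔ o.x) * o.ind g.succ ∂Q)
    - (∑ g, ∫ o, w' g o.x * (r' g o.x - q.r g o.x) * (o.ind g.succ * (o.dy - q.mΔ o.x)) ∂Q)
    - (∑ g, ∫ o, (w' g o.x - q.w g o.x) * q.r g o.x * (o.ind g.succ * (o.dy - q.mΔ o.x)) ∂Q)

/-- Expansion of the sum of the moment function over a finite set of observations. -/
lemma sum_phi_sub_phi {ι : Type*} (q : Nuisance N T) (Q : Measure (Obs N T)) (mΔ' : ℝ → ℝ)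
    (r' w' : Fin (N + 1) → ℝ → ℝ) (s : Finset ι) (z : ι → Obs N T) :
    ∑ i ∈ s, (phi mΔ' r' w' 1 (z i) - phi q.mΔ q.r q.w 1 (z i)) =
      s.card * q.expansionMean Q mΔ' r' w'
      + (∑ g, ∑ i ∈ s, w' g (z i).x * (r' g (z i).x - q.r g (z i).x) *
          (mΔ' (z i).x - q.mΔ (z i).x) * (z i).ind g.succ)
      - (∑ i ∈ s, ((mΔ' (z i).x - q.mΔ (z i).x) * (z i).ind 0
          - ∫ o, (mΔ' o.x - q.mΔ o.x) * o.ind 0 ∂Q))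
      + (∑ g, ∑ i ∈ s, (w' g (z i).x * q.r g (z i).x * (mΔ' (z i).x - q.mΔ (z i).x) *
          (z i).ind g.succ
          - ∫ o, w' g o.x * q.r g o.x * (mΔ' o.x - q.mΔ o.x) * o.ind g.succ ∂Q))
      - (∑ g, ∑ i ∈ s, (w' g (z i).x * (r' g (z i).x - q.r g (z i).x) *
          ((z i).ind g.succ * ((z i).dy - q.mΔ (z i).x))
          - ∫ o, w' g o.x * (r' g o.x - q.r g o.x) * (o.ind g.succ * (o.dy - q.mΔ o.x)) ∂Q))
      - (∑ g, ∑ i ∈ s, ((w' g (z i).x - q.w g (z i).x) * q.r g (z i).x *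
          ((z i).ind g.succ * ((z i).dy - q.mΔ (z i).x))
          - ∫ o, (w' g o.x - q.w g o.x) * q.r g o.x * (o.ind g.succ * (o.dy - q.mΔ o.x)) ∂Q)) := by
  have h : ∀ (f : Fin (N + 1) → ι → ℝ) (c : Fin (N + 1) → ℝ),
      ∑ g, ∑ i ∈ s, (f g i - c g) = (∑ i ∈ s, ∑ g, f g i) - s.card * ∑ g, c g := by
    intro f c
    simp only [Finset.sum_sub_distrib, Finset.sum_const, nsmul_eq_mul, Finset.mul_sum]
    rw [Finset.sum_comm]
  simp only [phi_sub_phi, h]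
  simp only [Finset.sum_sub_distrib, Finset.sum_add_distrib, Finset.sum_const, nsmul_eq_mul,
    Nuisance.expansionMean]
  rw [Finset.sum_comm (s := s) (t := Finset.univ)]
  ring

variable {P : Measure Ω} [IsProbabilityMeasure P] {Q : Measure (Obs N T)} [IsProbabilityMeasure Q]
  {F : Measure ℝ} [IsProbabilityMeasure F] {q : Nuisance N T} {C : ℝ} {S : ℕ → Ω → Obs N T} {L : ℕ}
  {fold : ∀ k : ℕ, Fin (L * k) → Fin L} {fX K : ℝ → ℝ} {h : ℕ → ℝ} {ℓ : Fin L}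
  {e : ∀ k : ℕ, Estimators (Train (fold k) ℓ) N T}

namespace FirstStep

omit [IsProbabilityMeasure F] in
/-- Linear functionals of the estimation errors are asymptotically equivalent to the training
average of the adjustment. -/
lemma negligible_linear (hf : FirstStep P F q S fold fX K h ℓ e)
    (hd : Design P Q F S fold fX K h) (hQ : Population Q F q C) (hC : 0 ≤ C) :
    Negligible P fun k ω => ENNReal.ofReal √((L * k : ℕ) : ℝ) *
      ‖((∑ g, ∫ x, q.ratioCoef g x *
          ((e k).r g (train (fold k) ℓ fun i => S i ω) x - q.r g x) ∂F)
        + ∑ j : Fin (N + 2) × Fin (T + 1), ∫ x, q.scoreCoef j x *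
          ((e k).m j.1 j.2.castSucc (train (fold k) ℓ fun i => S i ω) x
            - q.m j.1 j.2.castSucc x) ∂F)
        - average (train (fold k) ℓ fun i => S i ω) fun o => q.adjustment o‖ₑ := by
  obtain ⟨B, hB⟩ := hQ.exists_abs_scoreCoef_le hC
  have h1 : ∀ g, Negligible P fun k ω => ENNReal.ofReal √((L * k : ℕ) : ℝ) *
      ‖∫ x, q.ratioCoef g x * ((e k).r g (train (fold k) ℓ fun i => S i ω) x - q.r g x) ∂F
        - average (train (fold k) ℓ fun i => S i ω)
          fun o => q.ratioCoef g o.x * q.ratioResidual o g‖ₑ := fun g =>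
    hd.negligible_integral_sub_average_of_ae ℓ (hQ.measurable_ratioCoef g) (hQ.abs_ratioCoef_le g)
      (hQ.measurable_ratioResidual g) (hQ.memLp_ratioResidual g)
      (fun b hb hbB => hQ.integral_ratioResidual g hb hbB)
      (D := fun k s x => (e k).r g s x - q.r g x)
      (fun k s => (((hf.measurable k).1 g).comp measurable_prodMk_left).sub (hQ.measurable_r g))
      (hf.bahadur_r g)
  have h2 : ∀ j : Fin (N + 2) × Fin (T + 1),
      Negligible P fun k ω => ENNReal.ofReal √((L * k : ℕ) : ℝ) *
      ‖∫ x, q.scoreCoef j x * ((e k).m j.1 j.2.castSucc (train (fold k) ℓ fun i => S i ω) x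
          - q.m j.1 j.2.castSucc x) ∂F
        - average (train (fold k) ℓ fun i => S i ω)
          fun o => q.scoreCoef j o.x * q.residual o j.1 j.2.castSucc‖ₑ := fun j =>
    hd.negligible_integral_sub_average_of_ae ℓ (hQ.measurable_scoreCoef j) (hB j)
      (hQ.measurable_residual _ _) (hQ.memLp_residual _ _)
      (fun b hb hbB => hQ.integral_residual _ _ hb hbB)
      (D := fun k s x => (e k).m j.1 j.2.castSucc s x - q.m j.1 j.2.castSucc x)
      (fun k s => (((hf.measurable k).2.1 _ _).comp measurable_prodMk_left).sub
        (hQ.measurable_m _ _))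
      (hf.bahadur_m j.1 j.2)
  refine ((negligible_sum Finset.univ fun g _ => h1 g).add
    (negligible_sum Finset.univ fun j _ => h2 j)).mono fun k ω => ?_
  rw [← Finset.mul_sum, ← Finset.mul_sum, ← mul_add]
  gcongr
  have e1 : (average (train (fold k) ℓ fun i => S i ω) fun o => q.adjustment o) =
      (∑ g, average (train (fold k) ℓ fun i => S i ω)
        fun o => q.ratioCoef g o.x * q.ratioResidual o g) +
      ∑ j : Fin (N + 2) × Fin (T + 1), average (train (fold k) ℓ fun i => S i ω)
          fun o => q.scoreCoef j o.x * q.residual o j.1 j.2.castSucc := by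
    rw [← average_sum, ← average_sum, ← average_add]
    rfl
  rw [e1, add_sub_add_comm, ← Finset.sum_sub_distrib, ← Finset.sum_sub_distrib]
  exact (enorm_add_le _ _).trans (add_le_add (enorm_sum_le _ _) (enorm_sum_le _ _))

-- The normalization is at least one as soon as `k` is positive, so it may be dropped.
omit [IsProbabilityMeasure P] in
lemma negligible_of_rate {Z : ℕ → Ω → ℝ≥0∞} (hL : 1 ≤ L)
    (hZ : Negligible P fun k ω => ENNReal.ofReal √√((L * k : ℕ) : ℝ) * Z k ω) :
    Negligible P Z := by
  refine hZ.mono_ae ?_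
  filter_upwards [eventually_gt_atTop 0] with k hk
  refine Eventually.of_forall fun ω => le_mul_of_one_le_left zero_le ?_
  rw [ENNReal.one_le_ofReal, Real.one_le_sqrt, Real.one_le_sqrt]
  exact_mod_cast Nat.mul_pos hL hk

/-- With `a` the fourth root of the sample size, the root-n factor is shared equally between the two
errors of each product. -/
lemma mul_rate_eq {ι κ₁ κ₂ : Type*} [Fintype ι] [Fintype κ₁] [Fintype κ₂] (a B y : ℝ≥0∞)
    (u v : ι → ℝ≥0∞) (z : κ₁ → κ₂ → ℝ≥0∞) :
    a * a * (B * ((∑ g, u g * v g) + (∑ g, ∑ t, z g t) * (∑ g, u g)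
      + y * (∑ g, ∑ t, z g t) ^ 2)) =
    B * ((∑ g, a * u g * (a * v g)) + (∑ g, ∑ t, a * z g t) * (∑ g, a * u g)
      + y * ((∑ g, ∑ t, a * z g t) * (∑ g, ∑ t, a * z g t))) := by
  have e2 : ∑ g, a * u g * (a * v g) = a * a * ∑ g, u g * v g := by
    rw [Finset.mul_sum]
    exact Finset.sum_congr rfl fun g _ => by ring
  simp only [e2, ← Finset.mul_sum]
  ring

omit [IsProbabilityMeasure P] [IsProbabilityMeasure Q] [IsProbabilityMeasure F] in
/-- Bound for the mean of the expansion of the moment function, for given training data. -/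
lemma enorm_mean_add_average_le (hf : FirstStep P F q S fold fX K h ℓ e)
    (hQ : Population Q F q C) {B : ℝ≥0∞}
    (hmean : ∀ (mΔ' : ℝ → ℝ) (r' w' : Fin (N + 1) → ℝ → ℝ)
      (m' : Fin (N + 2) → Fin (T + 2) → ℝ → ℝ),
      (∀ g x, w' g x = leastSquaresWeights m' g x) →
      MemLp (mΔ' - q.mΔ) 2 F → (∀ g, MemLp (r' g - q.r g) 2 F) →
      (∀ g t, MemLp (m' g t - q.m g t) 2 F) → (∀ g, MemLp (w' g) ∞ F) →
      Measurable mΔ' → (∀ g, Measurable (r' g)) → (∀ g, Measurable (w' g)) →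
      ‖q.expansionMean Q mΔ' r' w' + ((∑ g, ∫ x, q.ratioCoef g x * (r' g x - q.r g x) ∂F)
        + ∑ k : Fin (N + 2) × Fin (T + 1), ∫ x, q.scoreCoef k x *
          (m' k.1 k.2.castSucc x - q.m k.1 k.2.castSucc x) ∂F)‖ₑ ≤
      B * ((∑ g, eLpNorm (w' g - q.w g) 2 F * eLpNorm (r' g - q.r g) 2 F)
        + (∑ g, ∑ t, eLpNorm (m' g t - q.m g t) 2 F) * (∑ g, eLpNorm (w' g - q.w g) 2 F)
        + (∑ g, eLpNorm (w' g) ∞ F + 1) * (∑ g, ∑ t, eLpNorm (m' g t - q.m g t) 2 F) ^ 2))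
    (k : ℕ) (s : Train (fold k) ℓ → Obs N T) (y a : ℝ≥0∞)
    (hΔ : eLpNorm ((e k).mΔ s - q.mΔ) 2 F ≠ ∞) (hr : ∀ g, eLpNorm ((e k).r g s - q.r g) 2 F ≠ ∞)
    (hm : ∀ g t, eLpNorm ((e k).m g t s - q.m g t) 2 F ≠ ∞)
    (hw : ∀ g, eLpNorm ((e k).w g s) ∞ F ≠ ∞) (hy : y = a * a) :
    y * ‖q.expansionMean Q ((e k).mΔ s) (fun g => (e k).r g s) (fun g => (e k).w g s)
        + average s fun o => q.adjustment o‖ₑ ≤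
      B * ((∑ g, a * eLpNorm ((e k).w g s - q.w g) 2 F * (a * eLpNorm ((e k).r g s - q.r g) 2 F))
        + (∑ g, ∑ t, a * eLpNorm ((e k).m g t s - q.m g t) 2 F) *
          (∑ g, a * eLpNorm ((e k).w g s - q.w g) 2 F)
        + (∑ g, eLpNorm ((e k).w g s) ∞ F + 1) *
          ((∑ g, ∑ t, a * eLpNorm ((e k).m g t s - q.m g t) 2 F) *
            (∑ g, ∑ t, a * eLpNorm ((e k).m g t s - q.m g t) 2 F)))
      + y * ‖((∑ g, ∫ x, q.ratioCoef g x * ((e k).r g s x - q.r g x) ∂F)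
        + ∑ j : Fin (N + 2) × Fin (T + 1), ∫ x, q.scoreCoef j x *
          ((e k).m j.1 j.2.castSucc s x - q.m j.1 j.2.castSucc x) ∂F)
        - average s fun o => q.adjustment o‖ₑ := by
  have mr : ∀ g, Measurable ((e k).r g s) := fun g =>
    ((hf.measurable k).1 g).of_uncurry_left
  have mm : ∀ g t, Measurable ((e k).m g t s) := fun g t =>
    ((hf.measurable k).2.1 g t).of_uncurry_left
  have mΔ : Measurable ((e k).mΔ s) := (hf.measurable k).2.2.of_uncurry_left
  have mw : ∀ g, Measurable ((e k).w g s) := fun g =>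
    (hf.measurable_w k g).of_uncurry_left
  have key := hmean ((e k).mΔ s) (fun g => (e k).r g s) (fun g => (e k).w g s)
    (fun g t => (e k).m g t s) (fun g x => rfl)
    ⟨(mΔ.sub hQ.measurable_mΔ).aestronglyMeasurable, lt_top_iff_ne_top.2 hΔ⟩
    (fun g => ⟨((mr g).sub (hQ.measurable_r g)).aestronglyMeasurable,
      lt_top_iff_ne_top.2 (hr g)⟩)
    (fun g t => ⟨((mm g t).sub (hQ.measurable_m g t)).aestronglyMeasurable,
      lt_top_iff_ne_top.2 (hm g t)⟩)
    (fun g => ⟨(mw g).aestronglyMeasurable, lt_top_iff_ne_top.2 (hw g)⟩) mΔ mr mw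
  -- Here `b` is the sum of the linear functionals: it is close to minus the mean by the expansion,
  -- and to the training average by the Bahadur representations.
  have e1 : ∀ a b c : ℝ, a + c = (a + b) - (b - c) := fun a b c => by ring
  rw [e1 _ ((∑ g, ∫ x, q.ratioCoef g x * ((e k).r g s x - q.r g x) ∂F)
        + ∑ j : Fin (N + 2) × Fin (T + 1), ∫ x, q.scoreCoef j x *
          ((e k).m j.1 j.2.castSucc s x - q.m j.1 j.2.castSucc x) ∂F)]
  refine (mul_le_mul_right enorm_sub_le _).trans ?_
  rw [mul_add]
  refine add_le_add ((mul_le_mul_right key _).trans (le_of_eq ?_)) le_rfl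
  exact hy ▸ mul_rate_eq _ _ _ _ _ _

/-- The mean of the moment function at the estimates is asymptotically linear. -/
lemma negligible_mean (hf : FirstStep P F q S fold fX K h ℓ e)
    (hd : Design P Q F S fold fX K h) (hQ : Population Q F q C) (hC : 0 ≤ C) :
    Negligible P fun k ω => ENNReal.ofReal √((L * k : ℕ) : ℝ) *
      ‖q.expansionMean Q ((e k).mΔ (train (fold k) ℓ fun i => S i ω))
          (fun g => (e k).r g (train (fold k) ℓ fun i => S i ω))
          (fun g => (e k).w g (train (fold k) ℓ fun i => S i ω))
        + average (train (fold k) ℓ fun i => S i ω) fun o => q.adjustment o‖ₑ := by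
  have hL : 1 ≤ L := ℓ.pos
  obtain ⟨B, hB, hmean⟩ := Population.enorm_mean_expansion_le (N := N) (T := T) (F := F) hC
  have nr := negligible_sum Finset.univ fun g _ =>
    ((hf.error_w g).boundedInProb.mul_negligible (hf.error_r g))
  have nm := negligible_sum Finset.univ fun g _ =>
    negligible_sum Finset.univ fun t _ => hf.error_m g t
  have nw := negligible_sum Finset.univ fun g _ => hf.error_w g
  have bw := (BoundedInProb.sum Finset.univ fun g _ => hf.bounded_w g)
  -- The norms whose finiteness the deterministic bound presupposes, collected into one quantity
  -- bounded in probability.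
  have bW := (bw.add hf.error_mΔ.boundedInProb).add
    ((negligible_sum Finset.univ fun g _ => negligible_of_rate hL (hf.error_r g)).add
      (negligible_sum Finset.univ fun g _ => negligible_sum Finset.univ fun t _ =>
        negligible_of_rate hL (hf.error_m g t))).boundedInProb
  have main := (nr.add (nm.boundedInProb.mul_negligible nw)).add
    ((bw.add (boundedInProb_const 1 ENNReal.one_ne_top)).mul_negligible
      (nm.boundedInProb.mul_negligible nm))
  refine ((main.const_mul hB).add (hf.negligible_linear hd hQ hC)).mono_of_ne_top bW
    (Eventually.of_forall fun k => Eventually.of_forall fun ω htop => ?_)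
  simp only [ne_eq, ENNReal.add_eq_top, not_or, ENNReal.sum_eq_top, Finset.mem_univ, true_and,
    not_exists] at htop
  refine enorm_mean_add_average_le hf hQ (hmean Q q hQ) k (train (fold k) ℓ fun i => S i ω) _ _
    htop.1.2 htop.2.1 htop.2.2 htop.1.1 ?_
  rw [← ENNReal.ofReal_mul (by positivity), Real.mul_self_sqrt (by positivity)]

end FirstStep

end SyntheticDiD

/-! ### The terms of the expansion over a fold. -/

namespace SyntheticDiD

variable {N T : ℕ} {Ω : Type*} [MeasurableSpace Ω]
  {P : Measure Ω} [IsProbabilityMeasure P] {Q : Measure (Obs N T)} [IsProbabilityMeasure Q]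
  {F : Measure ℝ} [IsProbabilityMeasure F] {q : Nuisance N T} {C : ℝ} {S : ℕ → Ω → Obs N T} {L : ℕ}
  {fold : ∀ k : ℕ, Fin (L * k) → Fin L} {fX K : ℝ → ℝ} {h : ℕ → ℝ} {ℓ : Fin L}
  {e : ∀ k : ℕ, Estimators (Train (fold k) ℓ) N T}

namespace Population

omit [IsProbabilityMeasure Q] [IsProbabilityMeasure F] in
lemma lintegral_ind_sq_le (hQ : Population Q F q C) (g : Fin (N + 2)) {b : ℝ → ℝ≥0∞}
    (hb : Measurable b) : ∫⁻ o, b o.x * ‖o.ind g‖ₑ ^ 2 ∂Q ≤ 1 * ∫⁻ x, b x ∂F := by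
  rw [one_mul, ← hQ.map_x, lintegral_map hb measurable_obs_x]
  refine lintegral_mono fun o => mul_le_of_le_one_right zero_le ?_
  refine pow_le_one₀ zero_le ?_
  rw [Real.enorm_eq_ofReal_abs, ENNReal.ofReal_le_one]
  exact o.abs_ind_le_one g

omit [IsProbabilityMeasure Q] [IsProbabilityMeasure F] in
lemma eLpNorm_mul_r_le (hQ : Population Q F q C) (g : Fin (N + 1)) (f : ℝ → ℝ) :
    eLpNorm (fun x => f x * q.r g x) 2 F ≤ ENNReal.ofReal C * eLpNorm f 2 F := by
  refine eLpNorm_le_mul_eLpNorm_of_ae_le_mul ?_ 2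
  filter_upwards [hQ.regular] with x hx
  rw [norm_mul, mul_comm, Real.norm_of_nonneg (hx.r_nonneg g)]
  exact mul_le_mul_of_nonneg_right (hx.r_le g) (norm_nonneg _)

end Population

lemma eLpNorm_mul_le_top_mul {α : Type*} [MeasurableSpace α] {μ : Measure α} (f : α → ℝ)
    {g : α → ℝ} (hg : AEStronglyMeasurable g μ) :
    eLpNorm (fun x => f x * g x) 2 μ ≤ eLpNorm f ∞ μ * eLpNorm g 2 μ :=
  eLpNorm_smul_le_eLpNorm_top_mul_eLpNorm 2 hg f

namespace FirstStep

omit [IsProbabilityMeasure F] in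
/-- The part of the expansion that is of third order in the estimates. -/
lemma negligible_rest (hf : FirstStep P F q S fold fX K h ℓ e)
    (hd : Design P Q F S fold fX K h) (hQ : Population Q F q C) (g : Fin (N + 1)) :
    Negligible P fun k ω => ENNReal.ofReal (√((L * k : ℕ) : ℝ))⁻¹ *
      ‖∑ i with fold k i = ℓ, (e k).w g (train (fold k) ℓ fun i => S i ω) (S i ω).x *
        ((e k).r g (train (fold k) ℓ fun i => S i ω) (S i ω).x - q.r g (S i ω).x) *
        ((e k).mΔ (train (fold k) ℓ fun i => S i ω) (S i ω).x - q.mΔ (S i ω).x) *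
        (S i ω).ind g.succ‖ₑ := by
  refine negligible_fold_sum hd.measurable hd.indep hd.law fold hd.card_fold ℓ hd.map_x
    (D := fun k s x => (e k).w g s x * ((e k).r g s x - q.r g x) * ((e k).mΔ s x - q.mΔ x))
    (f := fun o => o.ind g.succ)
    (fun k => ((hf.measurable_w k g).mul (((hf.measurable k).1 g).sub
      ((hQ.measurable_r g).comp measurable_snd))).mul
        ((hf.measurable k).2.2.sub (hQ.measurable_mΔ.comp measurable_snd)))
    (measurable_obs_ind _) (fun o => o.abs_ind_le_one _) ?_
  -- The weight is taken out by its essential bound; Cauchy–Schwarz leaves the product of the two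
  -- error norms, to which the product rate applies.
  refine ((hf.bounded_w g).mul_negligible (hf.error_prod g)).mono fun k ω => ?_
  set s := train (fold k) ℓ fun i => S i ω
  rw [mul_left_comm]
  gcongr
  have mr : AEStronglyMeasurable ((e k).r g s - q.r g) F :=
    (((hf.measurable k).1 g).of_uncurry_left.sub (hQ.measurable_r g)).aestronglyMeasurable
  have mΔ : AEStronglyMeasurable ((e k).mΔ s - q.mΔ) F :=
    ((hf.measurable k).2.2.of_uncurry_left.sub hQ.measurable_mΔ).aestronglyMeasurable
  calc _ ≤ ∫⁻ x, eLpNorm ((e k).w g s) ∞ F *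
        (‖((e k).r g s - q.r g) x‖ₑ * ‖((e k).mΔ s - q.mΔ) x‖ₑ) ∂F := by
        refine lintegral_mono_ae ?_
        filter_upwards [ae_enorm_le_eLpNorm_top (μ := F) ((e k).w g s)] with x hx
        rw [mul_assoc, enorm_mul, enorm_mul]
        exact mul_le_mul_left hx _
    _ = eLpNorm ((e k).w g s) ∞ F *
        ∫⁻ x, ‖((e k).r g s - q.r g) x‖ₑ * ‖((e k).mΔ s - q.mΔ) x‖ₑ ∂F :=
        lintegral_const_mul'' _ (mr.enorm.mul mΔ.enorm)
    _ ≤ _ := by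
        gcongr
        exact lintegral_enorm_mul_enorm_le mr mΔ

-- This lemma and the next three treat the conditionally centred terms. In each, a vanishing
-- function of the covariate multiplies a factor with bounded conditional second moment, so
-- consistency is enough.
omit [IsProbabilityMeasure F] in
lemma negligible_centered_mΔ (hf : FirstStep P F q S fold fX K h ℓ e)
    (hd : Design P Q F S fold fX K h) (hQ : Population Q F q C) :
    Negligible P fun k ω => ENNReal.ofReal (√((L * k : ℕ) : ℝ))⁻¹ *
      ‖∑ i with fold k i = ℓ,
        (((e k).mΔ (train (fold k) ℓ fun i => S i ω) (S i ω).x - q.mΔ (S i ω).x) * (S i ω).ind 0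
        - ∫ o, ((e k).mΔ (train (fold k) ℓ fun i => S i ω) o.x - q.mΔ o.x) * o.ind 0 ∂Q)‖ₑ :=
  negligible_centered_fold_sum hd.measurable hd.indep hd.law fold hd.card_fold ℓ
    (measurable_obs_ind 0) ENNReal.one_ne_top (fun _ hb => hQ.lintegral_ind_sq_le 0 hb)
    (D := fun k s x => (e k).mΔ s x - q.mΔ x)
    (fun k => (hf.measurable k).2.2.sub (hQ.measurable_mΔ.comp measurable_snd)) hf.error_mΔ

omit [IsProbabilityMeasure F] in
lemma negligible_centered_w_mul_mΔ (hf : FirstStep P F q S fold fX K h ℓ e)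
    (hd : Design P Q F S fold fX K h) (hQ : Population Q F q C) (g : Fin (N + 1)) :
    Negligible P fun k ω => ENNReal.ofReal (√((L * k : ℕ) : ℝ))⁻¹ *
      ‖∑ i with fold k i = ℓ,
        ((e k).w g (train (fold k) ℓ fun i => S i ω) (S i ω).x * q.r g (S i ω).x *
          ((e k).mΔ (train (fold k) ℓ fun i => S i ω) (S i ω).x - q.mΔ (S i ω).x) *
          (S i ω).ind g.succ
        - ∫ o, (e k).w g (train (fold k) ℓ fun i => S i ω) o.x * q.r g o.x *
          ((e k).mΔ (train (fold k) ℓ fun i => S i ω) o.x - q.mΔ o.x) * o.ind g.succ ∂Q)‖ₑ := by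
  refine negligible_centered_fold_sum hd.measurable hd.indep hd.law fold hd.card_fold ℓ
    (measurable_obs_ind g.succ) ENNReal.one_ne_top (fun _ hb => hQ.lintegral_ind_sq_le g.succ hb)
    (D := fun k s x => (e k).w g s x * q.r g x * ((e k).mΔ s x - q.mΔ x))
    (fun k => ((hf.measurable_w k g).mul ((hQ.measurable_r g).comp measurable_snd)).mul
      ((hf.measurable k).2.2.sub (hQ.measurable_mΔ.comp measurable_snd))) ?_
  refine (((hf.bounded_w g).mul_negligible hf.error_mΔ).const_mul
    (c := ENNReal.ofReal C) ENNReal.ofReal_ne_top).mono fun k ω => ?_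
  set s := train (fold k) ℓ fun i => S i ω
  simp only [mul_right_comm _ (q.r g _)]
  refine (hQ.eLpNorm_mul_r_le g _).trans ?_
  gcongr
  exact eLpNorm_mul_le_top_mul _
    ((hf.measurable k).2.2.of_uncurry_left.sub hQ.measurable_mΔ).aestronglyMeasurable

omit [IsProbabilityMeasure F] in
lemma negligible_centered_r (hf : FirstStep P F q S fold fX K h ℓ e)
    (hd : Design P Q F S fold fX K h) (hQ : Population Q F q C) (g : Fin (N + 1)) :
    Negligible P fun k ω => ENNReal.ofReal (√((L * k : ℕ) : ℝ))⁻¹ *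
      ‖∑ i with fold k i = ℓ,
        ((e k).w g (train (fold k) ℓ fun i => S i ω) (S i ω).x *
          ((e k).r g (train (fold k) ℓ fun i => S i ω) (S i ω).x - q.r g (S i ω).x) *
          ((S i ω).ind g.succ * ((S i ω).dy - q.mΔ (S i ω).x))
        - ∫ o, (e k).w g (train (fold k) ℓ fun i => S i ω) o.x *
          ((e k).r g (train (fold k) ℓ fun i => S i ω) o.x - q.r g o.x) *
          (o.ind g.succ * (o.dy - q.mΔ o.x)) ∂Q)‖ₑ := by
  refine negligible_centered_fold_sum hd.measurable hd.indep hd.law fold hd.card_fold ℓ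
    (hQ.measurable_diff g.succ) ENNReal.ofReal_ne_top
    (fun b hb => hQ.lintegral_diff_sq g.succ b hb)
    (D := fun k s x => (e k).w g s x * ((e k).r g s x - q.r g x))
    (fun k => (hf.measurable_w k g).mul
      (((hf.measurable k).1 g).sub ((hQ.measurable_r g).comp measurable_snd))) ?_
  refine ((hf.bounded_w g).mul_negligible
    (negligible_of_rate ℓ.pos (hf.error_r g))).mono fun k ω => ?_
  exact eLpNorm_mul_le_top_mul _
    (((hf.measurable k).1 g).of_uncurry_left.sub (hQ.measurable_r g)).aestronglyMeasurable

omit [IsProbabilityMeasure F] in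
lemma negligible_centered_w (hf : FirstStep P F q S fold fX K h ℓ e)
    (hd : Design P Q F S fold fX K h) (hQ : Population Q F q C) (g : Fin (N + 1)) :
    Negligible P fun k ω => ENNReal.ofReal (√((L * k : ℕ) : ℝ))⁻¹ *
      ‖∑ i with fold k i = ℓ,
        (((e k).w g (train (fold k) ℓ fun i => S i ω) (S i ω).x - q.w g (S i ω).x) *
          q.r g (S i ω).x * ((S i ω).ind g.succ * ((S i ω).dy - q.mΔ (S i ω).x))
        - ∫ o, ((e k).w g (train (fold k) ℓ fun i => S i ω) o.x - q.w g o.x) * q.r g o.x *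
          (o.ind g.succ * (o.dy - q.mΔ o.x)) ∂Q)‖ₑ := by
  refine negligible_centered_fold_sum hd.measurable hd.indep hd.law fold hd.card_fold ℓ
    (hQ.measurable_diff g.succ) ENNReal.ofReal_ne_top
    (fun b hb => hQ.lintegral_diff_sq g.succ b hb)
    (D := fun k s x => ((e k).w g s x - q.w g x) * q.r g x)
    (fun k => ((hf.measurable_w k g).sub ((hQ.measurable_w g).comp measurable_snd)).mul
      ((hQ.measurable_r g).comp measurable_snd)) ?_
  refine ((negligible_of_rate ℓ.pos (hf.error_w g)).const_mul
    (c := ENNReal.ofReal C) ENNReal.ofReal_ne_top).mono fun k ω => ?_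
  exact hQ.eLpNorm_mul_r_le g _

/-- Asymptotic expansion of the cross-fitted moment function over a fold. -/
lemma negligible_fold_expansion (hf : FirstStep P F q S fold fX K h ℓ e)
    (hd : Design P Q F S fold fX K h) (hQ : Population Q F q C) (hC : 0 ≤ C) :
    Negligible P fun k ω => ‖(√((L * k : ℕ) : ℝ))⁻¹ * (∑ i with fold k i = ℓ,
        (phi ((e k).mΔ (train (fold k) ℓ fun i => S i ω))
          (fun g => (e k).r g (train (fold k) ℓ fun i => S i ω))
          (fun g => (e k).w g (train (fold k) ℓ fun i => S i ω)) 1 (S i ω)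
          - phi q.mΔ q.r q.w 1 (S i ω)))
      + √((L * k : ℕ) : ℝ) / L * average (train (fold k) ℓ fun i => S i ω)
        fun o => q.adjustment o‖ₑ := by
  have h0 := hf.negligible_mean hd hQ hC
  have h1 := hf.negligible_rest hd hQ
  have h2 := hf.negligible_centered_mΔ hd hQ
  have h3 := hf.negligible_centered_w_mul_mΔ hd hQ
  have h4 := hf.negligible_centered_r hd hQ
  have h5 := hf.negligible_centered_w hd hQ
  have hpos : ∀ k : ℕ, 0 ≤ (√((L * k : ℕ) : ℝ))⁻¹ := fun k => by positivity
  simp only [ofReal_mul_enorm (hpos _)] at h1 h2 h3 h4 h5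
  simp only [ofReal_mul_enorm (Real.sqrt_nonneg _)] at h0
  have h6 := ((((((h0.const_mul (c := ‖(L : ℝ)⁻¹‖ₑ) enorm_ne_top).mono (fun k ω =>
    (enorm_mul _ _).le)).enorm_add (negligible_enorm_sum Finset.univ h1)).enorm_sub h2).enorm_add
    (negligible_enorm_sum Finset.univ h3)).enorm_sub
    (negligible_enorm_sum Finset.univ h4)).enorm_sub (negligible_enorm_sum Finset.univ h5)
  refine h6.mono fun k ω => le_of_eq ?_
  congr 1
  rw [sum_phi_sub_phi q Q, hd.card_fold]
  have hL : (L : ℝ) ≠ 0 := by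
    have := ℓ.pos
    positivity
  -- A fold carries the share `1 / L` of the sample, which is the weight of its conditional mean.
  have e1 : (√((L * k : ℕ) : ℝ))⁻¹ * (k : ℝ) = √((L * k : ℕ) : ℝ) / L := by
    rcases Nat.eq_zero_or_pos k with rfl | hk
    · simp
    have hn : (0 : ℝ) < ((L * k : ℕ) : ℝ) := by
      exact_mod_cast Nat.mul_pos ℓ.pos hk
    rw [eq_div_iff hL, inv_mul_eq_div, div_mul_eq_mul_div, div_eq_iff (Real.sqrt_pos.2 hn).ne',
      Real.mul_self_sqrt hn.le]
    push_cast
    ring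
  simp only [← Finset.mul_sum]
  simp only [mul_add, mul_sub, ← mul_assoc, e1]
  ring

end FirstStep

end SyntheticDiD

/-! ### Aggregation over the folds. -/

namespace SyntheticDiD

variable {N T : ℕ} {Ω : Type*} [MeasurableSpace Ω]
  {P : Measure Ω} {Q : Measure (Obs N T)}
  {F : Measure ℝ} {q : Nuisance N T} {C : ℝ} {S : ℕ → Ω → Obs N T} {L : ℕ}
  {fold : ∀ k : ℕ, Fin (L * k) → Fin L} {fX K : ℝ → ℝ} {h : ℕ → ℝ}

/-- Every observation belongs to all training samples but one. -/
lemma sum_average_train (hL : 2 ≤ L) {k : ℕ} {fold : Fin (L * k) → Fin L}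
    (hfold : ∀ ℓ, (Finset.univ.filter fun i => fold i = ℓ).card = k) (s : ℕ → Obs N T)
    (f : Obs N T → ℝ) :
    ∑ ℓ, √((L * k : ℕ) : ℝ) / L * average (train fold ℓ s) f =
      (√((L * k : ℕ) : ℝ))⁻¹ * ∑ i : Fin (L * k), f (s i) := by
  rcases Nat.eq_zero_or_pos k with rfl | hk
  · have h0 : ((L * 0 : ℕ) : ℝ) = 0 := by simp
    simp only [h0, Real.sqrt_zero, zero_div, zero_mul, _root_.inv_zero, Finset.sum_const_zero]
  have hL1 : (0 : ℝ) < L - 1 := by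
    have : (2 : ℝ) ≤ L := by exact_mod_cast hL
    linarith
  have hL0 : (0 : ℝ) < L := by linarith
  have hk' : (0 : ℝ) < k := by exact_mod_cast hk
  have hn : (0 : ℝ) < ((L * k : ℕ) : ℝ) := by push_cast; positivity
  -- Each observation is counted `L - 1` times, which cancels against the training size `(L - 1) k`.
  have h1 : ∑ ℓ, ∑ i : Train fold ℓ, f (train fold ℓ s i) =
      (L - 1) * ∑ i : Fin (L * k), f (s i) := by
    have h2 : ∀ ℓ, ∑ i : Train fold ℓ, f (train fold ℓ s i) =
        (∑ i : Fin (L * k), f (s i)) - ∑ i : Fin (L * k), if fold i = ℓ then f (s i) else 0 := by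
      intro ℓ
      rw [← Finset.sum_sub_distrib]
      refine (Finset.sum_subtype (p := fun i => fold i ≠ ℓ)
        (Finset.univ.filter fun i => fold i ≠ ℓ) (by simp) (fun i => f (s i))).symm.trans ?_
      rw [Finset.sum_filter]
      refine Finset.sum_congr rfl fun i _ => ?_
      split_ifs <;> simp_all
    simp only [h2, Finset.sum_sub_distrib]
    rw [Finset.sum_comm (s := Finset.univ) (t := Finset.univ)
      (f := fun ℓ i => if fold i = ℓ then f (s i) else 0)]
    simp only [Finset.sum_const, Finset.card_univ, Fintype.card_fin, nsmul_eq_mul,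
      Finset.sum_ite_eq, Finset.mem_univ, if_true]
    ring
  rw [← Finset.mul_sum]
  have hcard : ∀ ℓ, (Fintype.card (Train fold ℓ) : ℝ) = (L - 1) * k :=
    fun ℓ => card_train (hfold ℓ)
  simp only [average, hcard]
  rw [← Finset.mul_sum, h1]
  have hs := Real.sqrt_pos.2 hn
  have hss : √((L * k : ℕ) : ℝ) * √((L * k : ℕ) : ℝ) = L * k := by
    rw [Real.mul_self_sqrt hn.le]; push_cast; ring
  field_simp
  rw [sq, hss]

variable [IsProbabilityMeasure P] [IsProbabilityMeasure Q] [IsProbabilityMeasure F]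
  {e : ∀ (k : ℕ) (ℓ : Fin L), Estimators (Train (fold k) ℓ) N T}

/-- Asymptotic expansion of the cross-fitted moment function. -/
lemma negligible_expansion (hf : ∀ ℓ, FirstStep P F q S fold fX K h ℓ fun k => e k ℓ)
    (hd : Design P Q F S fold fX K h) (hQ : Population Q F q C) (hC : 0 ≤ C) :
    Negligible P fun k ω => ‖(√((L * k : ℕ) : ℝ))⁻¹ * (∑ ℓ, ∑ i with fold k i = ℓ,
        phi ((e k ℓ).mΔ (train (fold k) ℓ fun i => S i ω))
          (fun g => (e k ℓ).r g (train (fold k) ℓ fun i => S i ω))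
          (fun g => (e k ℓ).w g (train (fold k) ℓ fun i => S i ω)) 1 (S i ω))
      - (√((L * k : ℕ) : ℝ))⁻¹ * ∑ i : Fin (L * k),
        (phi q.mΔ q.r q.w 1 (S i ω) - q.adjustment (S i ω))‖ₑ := by
  refine (negligible_enorm_sum Finset.univ fun ℓ =>
    (hf ℓ).negligible_fold_expansion hd hQ hC).mono fun k ω => le_of_eq ?_
  congr 1
  rw [Finset.sum_add_distrib, sum_average_train hd.two_le (hd.card_fold k), ← Finset.mul_sum]
  simp only [Finset.sum_sub_distrib]
  rw [Finset.sum_fiberwise]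
  ring

/-- Isolates the estimated share. The identity survives a share of zero, because division by zero
gives zero on both sides. -/
lemma thetaHat_eq {n : ℕ} (fold : Fin n → Fin L) (e : ∀ ℓ, Estimators (Train fold ℓ) N T)
    (s : ℕ → Obs N T) : thetaHat fold e s = (piHat n s)⁻¹ * ((n : ℝ)⁻¹ * ∑ ℓ : Fin L,
      ∑ i : Fin n with fold i = ℓ, phi ((e ℓ).mΔ (train fold ℓ s))
        (fun g => (e ℓ).r g (train fold ℓ s)) (fun g => (e ℓ).w g (train fold ℓ s)) 1 (s i)) := by
  rw [thetaHat, one_div]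
  simp only [phi_eq _ _ _ (piHat n s), ← Finset.mul_sum]
  ring

lemma measurable_phi {α : Type*} [MeasurableSpace α] {mΔ : α → ℝ → ℝ}
    {r w : Fin (N + 1) → α → ℝ → ℝ}
    {o : α → Obs N T} (ho : Measurable o) (hm : Measurable (Function.uncurry mΔ))
    (hr : ∀ g, Measurable (Function.uncurry (r g)))
    (hw : ∀ g, Measurable (Function.uncurry (w g))) :
    Measurable fun a => phi (mΔ a) (fun g => r g a) (fun g => w g a) 1 (o a) := by
  have hx : Measurable fun a => (a, (o a).x) := measurable_id.prodMk (measurable_obs_x.comp ho)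
  have hdy : Measurable fun a => (o a).dy - mΔ a (o a).x :=
    (measurable_obs_dy.comp ho).sub (hm.comp hx)
  have hi := fun g : Fin (N + 2) => (measurable_obs_ind g).comp ho
  refine ((hi 0).div_const 1 |>.mul hdy).sub (Measurable.const_mul
    (Finset.measurable_sum _ fun g _ => ?_) _)
  exact ((((hw g).comp hx).mul ((hr g).comp hx)).mul (hi _)).mul hdy

lemma measurable_piHat (hS : ∀ i, Measurable (S i)) (n : ℕ) :
    Measurable fun ω => piHat n fun i => S i ω := by
  simp only [piHat]
  have h := fun i : Fin n => (measurable_obs_ind (N := N) (T := T) 0).comp (hS i)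
  exact (Finset.measurable_fun_sum Finset.univ fun i _ => h i).div_const _

omit [IsProbabilityMeasure P] [IsProbabilityMeasure F] in
lemma measurable_thetaHat (hf : ∀ ℓ, FirstStep P F q S fold fX K h ℓ fun k => e k ℓ)
    (hS : ∀ i, Measurable (S i)) (k : ℕ) :
    Measurable fun ω => thetaHat (fold k) (e k) fun i => S i ω := by
  simp only [thetaHat_eq]
  refine (measurable_piHat hS _).inv.mul (Measurable.const_mul
    (Finset.measurable_sum _ fun ℓ _ => Finset.measurable_sum _ fun i _ => ?_) _)
  have ht : Measurable fun ω => train (fold k) ℓ fun i => S i ω := measurable_train hS _ _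
  have hu : Measurable fun p : Ω × ℝ => ((train (fold k) ℓ fun i => S i p.1), p.2) :=
    (ht.comp measurable_fst).prodMk measurable_snd
  have hr : ∀ g, Measurable (Function.uncurry fun ω =>
      (e k ℓ).r g (train (fold k) ℓ fun i => S i ω)) := fun g =>
    (((hf ℓ).measurable k).1 g).comp hu
  have hΔ : Measurable (Function.uncurry fun ω =>
      (e k ℓ).mΔ (train (fold k) ℓ fun i => S i ω)) := ((hf ℓ).measurable k).2.2.comp hu
  have hm : ∀ g t, Measurable fun p : Ω × ℝ =>
      (e k ℓ).m g t (train (fold k) ℓ fun i => S i p.1) p.2 := fun g t =>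
    (((hf ℓ).measurable k).2.1 g t).comp hu
  have hw : ∀ g, Measurable (Function.uncurry fun ω =>
      (e k ℓ).w g (train (fold k) ℓ fun i => S i ω)) := fun g =>
    measurable_leastSquares (m := fun (p : Ω × ℝ) g t => (e k ℓ).m g t
      (train (fold k) ℓ fun i => S i p.1)) (x := Prod.snd) hm g
  exact measurable_phi (hS i) hΔ hr hw

end SyntheticDiD

/-! ### Central limit theorem and Slutsky argument. -/

namespace SyntheticDiD

variable {N T : ℕ} {Ω : Type*} [MeasurableSpace Ω]
  {P : Measure Ω} [IsProbabilityMeasure P] {Q : Measure (Obs N T)} [IsProbabilityMeasure Q]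
  {F : Measure ℝ} [IsProbabilityMeasure F] {q : Nuisance N T} {C : ℝ} {S : ℕ → Ω → Obs N T} {L : ℕ}
  {fold : ∀ k : ℕ, Fin (L * k) → Fin L} {fX K : ℝ → ℝ} {h : ℕ → ℝ}
  {e : ∀ (k : ℕ) (ℓ : Fin L), Estimators (Train (fold k) ℓ) N T}

omit [IsProbabilityMeasure Q] in
/-- The central limit theorem for the values of a function of an i.i.d. sample. -/
lemma tendstoInDistribution_sum (hS : ∀ i, Measurable (S i)) (hindep : iIndepFun S P)
    (hlaw : ∀ i, P.map (S i) = Q) {f : Obs N T → ℝ} (hfm : Measurable f) (hf : MemLp f 2 Q)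
    (hf0 : ∫ o, f o ∂Q = 0) :
    TendstoInDistribution (fun (n : ℕ) ω => (√(n : ℝ))⁻¹ * ∑ i : Fin n, f (S i ω)) atTop
      (id : ℝ → ℝ) (fun _ => P) (gaussianReal 0 (∫ o, f o ^ 2 ∂Q).toNNReal) := by
  have hX0 : ∫ ω, f (S 0 ω) ∂P = 0 := by
    rw [← hf0, ← hlaw 0, integral_map (hS 0).aemeasurable hfm.aestronglyMeasurable]
  have hvar : Var[fun ω => f (S 0 ω); P] = ∫ o, f o ^ 2 ∂Q := by
    have hm : AEMeasurable (fun ω => f (S 0 ω)) P := (hfm.comp (hS 0)).aemeasurable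
    rw [variance_of_integral_eq_zero hm hX0, ← hlaw 0,
      integral_map (hS 0).aemeasurable (hfm.pow_const 2).aestronglyMeasurable]
  have key := tendstoInDistribution_inv_sqrt_mul_sum_sub (P := P) (X := fun i ω => f (S i ω))
    (Y := (id : ℝ → ℝ)) (P' := gaussianReal 0 (∫ o, f o ^ 2 ∂Q).toNNReal)
    ⟨aemeasurable_id, by rw [hvar, Measure.map_id]⟩
    (by
      have := hf
      rw [← hlaw 0] at this
      exact this.comp_of_map (hS 0).aemeasurable)
    (hindep.comp (fun _ => f) fun _ => hfm)
    (fun i => (⟨(hS i).aemeasurable, (hS 0).aemeasurable, by rw [hlaw, hlaw]⟩ :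
      IdentDistrib (S i) (S 0) P P).comp hfm)
  refine key.congr (fun n => Eventually.of_forall fun ω => ?_) EventuallyEq.rfl
  simp only [hX0, mul_zero, sub_zero]
  rw [Finset.sum_range fun i => f (S i ω)]

omit [IsProbabilityMeasure Q] in
/-- The sample share of the treated group is consistent. -/
lemma tendsto_piHat (hS : ∀ i, Measurable (S i)) (hindep : iIndepFun S P)
    (hlaw : ∀ i, P.map (S i) = Q) :
    ∀ᵐ ω ∂P, Tendsto (fun n => piHat n fun i => S i ω) atTop (𝓝 (∫ o, o.ind 0 ∂Q)) := by
  have hi := measurable_obs_ind (N := N) (T := T) 0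
  have h := strong_law_ae_real (μ := P) (fun i ω => (S i ω).ind 0)
    (Integrable.of_bound (hi.comp (hS 0)).aestronglyMeasurable 1
      (Eventually.of_forall fun ω => (S 0 ω).abs_ind_le_one 0))
    (fun i j hij => (hindep.indepFun hij).comp hi hi)
    (fun i => (⟨(hS i).aemeasurable, (hS 0).aemeasurable, by rw [hlaw, hlaw]⟩ :
      IdentDistrib (S i) (S 0) P P).comp hi)
  filter_upwards [h] with ω hω
  have e1 : ∫ ω, (S 0 ω).ind 0 ∂P = ∫ o, o.ind 0 ∂Q := by
    rw [← hlaw 0, integral_map (hS 0).aemeasurable hi.aestronglyMeasurable]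
  rw [e1] at hω
  refine hω.congr fun n => ?_
  rw [piHat, Finset.sum_range fun i => (S i ω).ind 0]

/-- Asymptotic normality of the cross-fitted estimator for a measurable sample. -/
lemma tendstoInDistribution_thetaHat
    (hf : ∀ ℓ, FirstStep P F q S fold fX K h ℓ fun k => e k ℓ)
    (hd : Design P Q F S fold fX K h) (hQ : Population Q F q C) (hC : 0 ≤ C) {π θ : ℝ}
    (hπ0 : π ≠ 0) (hπ : ∫ o, o.ind 0 ∂Q = π) (hθ : ∫ o, phi q.mΔ q.r q.w 1 o ∂Q = π * θ) :
    TendstoInDistribution (fun (k : ℕ) ω => √((L * k : ℕ) : ℝ) *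
        (thetaHat (fold k) (e k) (fun i => S i ω) - θ)) atTop (id : ℝ → ℝ) (fun _ => P)
      (gaussianReal 0 (∫ o, q.psiSC π θ o ^ 2 ∂Q).toNNReal) := by
  have hS := hd.measurable
  have hL : 0 < L := by have := hd.two_le; omega
  have hLk : Tendsto (fun k => L * k) atTop atTop := tendsto_id.const_mul_atTop' hL
  -- An almost sure version of the influence function whose measurability, square integrability and
  -- zero mean follow termwise.
  set f : Obs N T → ℝ := fun o =>
    π⁻¹ * (phi q.mΔ q.r q.w 1 o - θ * o.ind 0 - q.adjustment o) with hfdef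
  have hind2 := Population.memLp_ind (Q := Q) 0
  have hf2 : MemLp f 2 Q :=
    ((hQ.memLp_phi.sub (hind2.const_mul θ)).sub (hQ.memLp_adjustment hC)).const_mul _
  have hphim : Measurable fun o : Obs N T => phi q.mΔ q.r q.w 1 o :=
    measurable_phi (mΔ := fun _ => q.mΔ) (r := fun g _ => q.r g) (w := fun g _ => q.w g)
      measurable_id (hQ.measurable_mΔ.comp measurable_snd)
      (fun g => (hQ.measurable_r g).comp measurable_snd)
      (fun g => (hQ.measurable_w g).comp measurable_snd)
  have hadjm : Measurable fun o : Obs N T => q.adjustment o := by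
    refine (Finset.measurable_sum _ fun g _ => ?_).add (Finset.measurable_sum _ fun k _ => ?_)
    · exact ((hQ.measurable_ratioCoef g).comp measurable_obs_x).mul (hQ.measurable_ratioResidual g)
    · exact ((hQ.measurable_scoreCoef k).comp measurable_obs_x).mul (hQ.measurable_residual _ _)
  have hfm : Measurable f :=
    ((hphim.sub ((measurable_obs_ind 0).const_mul θ)).sub hadjm).const_mul _
  have hf0 : ∫ o, f o ∂Q = 0 := by
    have i1 := hQ.memLp_phi.integrable (by norm_num)
    have i2 : Integrable (fun o : Obs N T => θ * o.ind 0) Q :=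
      (hind2.const_mul θ).integrable (by norm_num)
    have i3 := (hQ.memLp_adjustment hC).integrable (by norm_num)
    have i4 : Integrable (fun o => phi q.mΔ q.r q.w 1 o - θ * o.ind 0) Q := i1.sub i2
    rw [hfdef]
    rw [integral_const_mul, integral_sub i4 i3, integral_sub i1 i2, integral_const_mul, hπ, hθ,
      hQ.integral_adjustment hC]
    ring
  have hV : ∫ o, q.psiSC π θ o ^ 2 ∂Q = ∫ o, f o ^ 2 ∂Q :=
    integral_congr_ae ((hQ.psiSC_ae_eq π θ).mono fun o ho => by simp only [ho, hfdef])
  rw [hV]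
  have hclt0 := tendstoInDistribution_sum hS hd.indep hd.law hfm hf2 hf0
  have hclt : TendstoInDistribution (fun (k : ℕ) ω => (√((L * k : ℕ) : ℝ))⁻¹ *
      ∑ i : Fin (L * k), f (S i ω)) atTop (id : ℝ → ℝ) (fun _ => P)
      (gaussianReal 0 (∫ o, f o ^ 2 ∂Q).toNNReal) :=
    ⟨fun k => hclt0.1 _, hclt0.2, hclt0.3.comp hLk⟩
  have hpi := tendsto_piHat hS hd.indep hd.law
  rw [hπ] at hpi
  have hpim := fun n => measurable_piHat hS n
  have hθm := fun k => measurable_thetaHat hf hS k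
  have hWm : ∀ k, Measurable fun ω => √((L * k : ℕ) : ℝ) *
      (thetaHat (fold k) (e k) (fun i => S i ω) - θ) := fun k =>
    ((hθm k).sub_const θ).const_mul _
  -- the estimator, scaled by the ratio of the estimated to the true share of the treated
  have h1 : TendstoInDistribution (fun (k : ℕ) ω => π⁻¹ * (piHat (L * k) fun i => S i ω) *
      (√((L * k : ℕ) : ℝ) * (thetaHat (fold k) (e k) (fun i => S i ω) - θ))) atTop
      (id : ℝ → ℝ) (fun _ => P) (gaussianReal 0 (∫ o, f o ^ 2 ∂Q).toNNReal) := by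
    refine tendstoInDistribution_of_tendstoInMeasure_sub _ _ hclt ?_
      fun k => (((hpim _).const_mul _).mul (hWm k)).aemeasurable
    rw [← negligible_iff_tendstoInMeasure]
    -- The algebra below divides by the estimated share; the event that it is zero has vanishing
    -- probability, as the limit `π` is not zero.
    have h0 : Negligible P fun k ω => if (piHat (L * k) fun i => S i ω) = 0 then ∞ else 0 := by
      have hm := negligible_iff_tendstoInMeasure.2 (tendstoInMeasure_of_tendsto_ae (g := 0)
        (fun k => ((hpim (L * k)).sub_const π).aestronglyMeasurable) (by
          filter_upwards [hpi] with ω hω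
          simpa using (hω.comp hLk).sub_const π))
      intro ε hε
      refine tendsto_of_tendsto_of_tendsto_of_le_of_le tendsto_const_nhds
        (hm ‖π‖ₑ (by simpa using hπ0)) (fun _ => zero_le) fun k => measure_mono fun ω hω => ?_
      simp only [Set.mem_ofPred_eq] at hω ⊢
      split_ifs at hω with h0
      · rw [h0, zero_sub, enorm_neg]
      · exact absurd (le_antisymm hω zero_le) hε
    refine (((negligible_expansion hf hd hQ hC).const_mul (c := ‖π⁻¹‖ₑ) enorm_ne_top).add
      h0).mono fun k ω => ?_
    by_cases hz : (piHat (L * k) fun i => S i ω) = 0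
    · simp [hz]
    rw [if_neg hz, add_zero, ← enorm_mul, Pi.sub_apply, Pi.sub_apply]
    refine le_of_eq (congrArg _ ?_)
    have e1 : √((L * k : ℕ) : ℝ) * ((L * k : ℕ) : ℝ)⁻¹ = (√((L * k : ℕ) : ℝ))⁻¹ := by
      rw [← div_eq_mul_inv, Real.sqrt_div_self]
    -- Multiplied by the estimated share, the centring at `θ` becomes a sum of treatment indicators,
    -- which is the term `θ * o.ind 0` of the influence function.
    have e2 : √((L * k : ℕ) : ℝ) * (piHat (L * k) fun i => S i ω) =
        (√((L * k : ℕ) : ℝ))⁻¹ * ∑ i : Fin (L * k), (S i ω).ind 0 := by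
      rw [piHat, ← e1]
      ring
    rw [thetaHat_eq]
    simp only [hfdef, ← Finset.mul_sum, Finset.sum_sub_distrib]
    have e3 := mul_inv_cancel₀ hz
    have key : ∀ p p' a n b B Φ I A : ℝ, p * p' = 1 → a * n = b → a * p = b * I →
        π⁻¹ * p * (a * (p' * (n * B) - θ)) - b * (π⁻¹ * (Φ - θ * I - A)) =
          π⁻¹ * (b * B - b * (Φ - A)) := by
      intro p p' a n b B Φ I A h1 h2 h3
      linear_combination π⁻¹ * a * n * B * h1 + π⁻¹ * B * h2 - π⁻¹ * θ * h3
    exact key _ _ _ _ _ _ _ _ _ e3 e1 e2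
  have h2 : TendstoInMeasure P (fun (k : ℕ) ω => π * (piHat (L * k) fun i => S i ω)⁻¹) atTop
      fun _ => (1 : ℝ) := by
    refine tendstoInMeasure_of_tendsto_ae
      (fun k => ((hpim _).inv.const_mul _).aestronglyMeasurable) ?_
    filter_upwards [hpi] with ω hω
    have := ((hω.comp hLk).inv₀ hπ0).const_mul π
    rwa [mul_inv_cancel₀ hπ0] at this
  have h3 := h1.continuous_comp_prodMk_of_tendstoInMeasure_const
    (g := fun p : ℝ × ℝ => p.1 * p.2) continuous_mul h2
    fun k => ((hpim _).inv.const_mul _).aemeasurable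
  simp only [mul_one] at h3
  -- The two scaling factors cancel whenever the estimated share is nonzero, which almost surely
  -- holds for all large samples.
  refine tendstoInDistribution_of_tendstoInMeasure_sub _ _ h3 ?_ fun k => (hWm k).aemeasurable
  refine tendstoInMeasure_of_tendsto_ae (fun k => ((hWm k).sub
    ((((hpim _).const_mul _).mul (hWm k)).mul
      ((hpim _).inv.const_mul _))).aestronglyMeasurable) ?_
  filter_upwards [hpi] with ω hω
  refine tendsto_const_nhds.congr' ?_
  filter_upwards [(hω.comp hLk).eventually_ne hπ0] with k hk
  simp only [Function.comp_apply] at hk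
  simp only [Pi.sub_apply, Pi.zero_apply]
  field_simp
  ring

end SyntheticDiD

/-! ### Modification on null sets, and conversion of the rates. -/

namespace SyntheticDiD

variable {N T : ℕ} {Ω : Type*} [MeasurableSpace Ω] {P : Measure Ω}
  {F : Measure ℝ} {q : Nuisance N T} {S S' : ℕ → Ω → Obs N T} {L : ℕ}
  {fold : ∀ k : ℕ, Fin (L * k) → Fin L} {fX K : ℝ → ℝ} {h : ℕ → ℝ} {ℓ : Fin L}
  {e : ∀ k : ℕ, Estimators (Train (fold k) ℓ) N T}

/-- The rate conditions are not affected by a modification of the sample on a null set. -/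
lemma FirstStep.congr (hf : FirstStep P F q S fold fX K h ℓ e)
    (hS : ∀ᵐ ω ∂P, ∀ i, S i ω = S' i ω) : FirstStep P F q S' fold fX K h ℓ e := by
  have hn : ∀ {Z : (ℕ → Obs N T) → ℕ → ℝ≥0∞}, (Negligible P fun k ω => Z (fun i => S i ω) k) →
      Negligible P fun k ω => Z (fun i => S' i ω) k := fun {Z} hZ =>
    hZ.mono_ae (Eventually.of_forall fun k => hS.mono fun ω hω => by simp only [hω, le_refl])
  have hb : ∀ {Z : (ℕ → Obs N T) → ℕ → ℝ≥0∞}, (BoundedInProb P fun k ω => Z (fun i => S i ω) k) →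
      BoundedInProb P fun k ω => Z (fun i => S' i ω) k := fun {Z} hZ =>
    hZ.mono_ae (Eventually.of_forall fun k => hS.mono fun ω hω => by simp only [hω, le_refl])
  exact
    { measurable := hf.measurable
      bounded_w := fun g => hb (Z := fun s k => eLpNorm ((e k).w g (train (fold k) ℓ s)) ∞ F)
        (hf.bounded_w g)
      error_mΔ := hn (Z := fun s k => eLpNorm ((e k).mΔ (train (fold k) ℓ s) - q.mΔ) 2 F)
        hf.error_mΔ
      error_prod := fun g => hn (Z := fun s k => ENNReal.ofReal √((L * k : ℕ) : ℝ) *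
        (eLpNorm ((e k).r g (train (fold k) ℓ s) - q.r g) 2 F *
          eLpNorm ((e k).mΔ (train (fold k) ℓ s) - q.mΔ) 2 F)) (hf.error_prod g)
      error_m := fun g t => hn (Z := fun s k => ENNReal.ofReal √√((L * k : ℕ) : ℝ) *
        eLpNorm ((e k).m g t (train (fold k) ℓ s) - q.m g t) 2 F) (hf.error_m g t)
      error_r := fun g => hn (Z := fun s k => ENNReal.ofReal √√((L * k : ℕ) : ℝ) *
        eLpNorm ((e k).r g (train (fold k) ℓ s) - q.r g) 2 F) (hf.error_r g)
      error_w := fun g => hn (Z := fun s k => ENNReal.ofReal √√((L * k : ℕ) : ℝ) *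
        eLpNorm ((e k).w g (train (fold k) ℓ s) - q.w g) 2 F) (hf.error_w g)
      bahadur_r := fun g => hn (Z := fun s k => ENNReal.ofReal √((L * k : ℕ) : ℝ) *
        eLpNorm (fun x => (e k).r g (train (fold k) ℓ s) x - q.r g x
          - ratioBahadur q fX K (h (L * k)) g (train (fold k) ℓ s) x) 1 F) (hf.bahadur_r g)
      bahadur_m := fun g t => hn (Z := fun s k => ENNReal.ofReal √((L * k : ℕ) : ℝ) *
        eLpNorm (fun x => (e k).m g t.castSucc (train (fold k) ℓ s) x - q.m g t.castSucc x
          - outcomeBahadur q fX K (h (L * k)) g t.castSucc (train (fold k) ℓ s) x) 1 F)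
        (hf.bahadur_m g t) }

section Rates

variable {Z : ℕ → Ω → ℝ≥0∞}

lemma eventually_natCast_mul_pos (hL : 2 ≤ L) :
    ∀ᶠ k : ℕ in atTop, (0 : ℝ) < ((L * k : ℕ) : ℝ) := by
  filter_upwards [eventually_gt_atTop 0] with k hk
  exact_mod_cast Nat.mul_pos (by omega) hk

lemma IsLittleOp.negligible_sqrt (hL : 2 ≤ L)
    (hZ : IsLittleOp P Z fun k => ((L * k : ℕ) : ℝ) ^ (-(1 / 2) : ℝ)) :
    Negligible P fun k ω => ENNReal.ofReal √((L * k : ℕ) : ℝ) * Z k ω := by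
  have h := hZ.negligible ((eventually_natCast_mul_pos hL).mono fun k hk => by positivity)
  simpa only [Real.rpow_neg (Nat.cast_nonneg _), inv_inv, ← Real.sqrt_eq_rpow] using h

lemma IsLittleOp.negligible_sqrt_sqrt (hL : 2 ≤ L)
    (hZ : IsLittleOp P Z fun k => ((L * k : ℕ) : ℝ) ^ (-(1 / 4) : ℝ)) :
    Negligible P fun k ω => ENNReal.ofReal √√((L * k : ℕ) : ℝ) * Z k ω := by
  have h := hZ.negligible ((eventually_natCast_mul_pos hL).mono fun k hk => by positivity)
  have e1 : ∀ x : ℝ, 0 ≤ x → x ^ (1 / 4 : ℝ) = √√x := fun x hx => by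
    rw [Real.sqrt_eq_rpow, Real.sqrt_eq_rpow, ← Real.rpow_mul hx]
    norm_num
  simpa only [Real.rpow_neg (Nat.cast_nonneg _), inv_inv, e1 _ (Nat.cast_nonneg _)] using h

end Rates

end SyntheticDiD


/-! ### The main theorem. -/

open SyntheticDiD in
theorem mainTheorem3 {Ω : Type*} [MeasurableSpace Ω] (P : Measure Ω) [IsProbabilityMeasure P]
    -- `T + 2` periods, `N + 1` control groups, `L` folds, polynomials of order `d`
    (N T L d : ℕ) (hNT : N + 1 ≤ T + 2) (hL : 2 ≤ L)
    -- potential outcomes, group and covariate; no anticipation; square-integrable outcomes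
    (Y0 Y1 : Fin (T + 2) → Ω → ℝ) (G : Ω → Fin (N + 2)) (X : Ω → ℝ)
    (hY0 : ∀ t, Measurable (Y0 t)) (hY1 : ∀ t, Measurable (Y1 t))
    (hG : Measurable G) (hX : Measurable X)
    (hNA : ∀ t : Fin (T + 1), Y1 t.castSucc =ᵐ[P] Y0 t.castSucc)
    (hY : ∀ t, MemLp (observedY Y0 Y1 G t) 2 P)
    -- i.i.d. sample
    (S : ℕ → Ω → Obs N T) (hindep : iIndepFun S P)
    (hident : ∀ i, IdentDistrib (S i) (observation Y0 Y1 G X) P P)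
    -- density and compact support of the covariate
    (fX : ℝ → ℝ) (hfX : Measurable fX) (hfX0 : ∀ x, 0 ≤ fX x)
    (hdens : P.map X = volume.withDensity fun x => ENNReal.ofReal (fX x))
    (hcomp : IsCompact (P.map X).support)
    -- the population nuisance functions
    (q : Nuisance N T)
    (hp : ∀ g, IsRegression P X ((G ⁻¹' {g}).indicator fun _ => 1) (q.p g))
    (hm : ∀ g t, IsRegression (givenGroup P G g) X (observedY Y0 Y1 G t) (q.m g t))
    (hmΔ : IsRegression (givenControl P G) X
      (fun ω => observedY Y0 Y1 G (post T) ω - observedY Y0 Y1 G (pre T) ω) q.mΔ)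
    (hw : ∀ g, Measurable (q.w g))
    -- overlap and synthetic control
    (hoverlap : ∀ g, ∀ᵐ ω ∂P, 0 < q.p g (X ω))
    (hSC : SyntheticControl P Y0 G X q.w)
    -- bounded conditional second moments, inverse propensity scores and weights
    (hvar : ∀ g, Integrable (fun ω => ((observation Y0 Y1 G X ω).dy - q.mΔ (X ω)) ^ 2)
        (givenGroup P G g) ∧
      ∃ C : ℝ, ∀ᵐ ω ∂(givenGroup P G g),
        ((givenGroup P G g)[fun ω => ((observation Y0 Y1 G X ω).dy - q.mΔ (X ω)) ^ 2 |
          MeasurableSpace.comap X inferInstance]) ω ≤ C)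
    (hpbdd : ∀ g, ∃ C : ℝ, ∀ᵐ ω ∂P, 1 / q.p g (X ω) ≤ C)
    (hwbdd : ∀ g, ∃ C : ℝ, ∀ᵐ ω ∂P, |q.w g (X ω)| ≤ C)
    -- smoothness, and uniform invertibility of `M(x)'M(x)`
    (hpC : ∀ g, ContDiffOn ℝ 2 (q.p g) (P.map X).support)
    (hmC : ∀ g t, ContDiffOn ℝ 2 (q.m g t) (P.map X).support)
    (hwC : ∀ g, ContDiffOn ℝ 2 (q.w g) (P.map X).support)
    (hM : ∃ c : ℝ, 0 < c ∧ ∀ x ∈ (P.map X).support, ∀ lam : ℝ,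
      Module.End.HasEigenvalue
        (Matrix.toLin' ((weightMatrix q.m x)ᵀ * weightMatrix q.m x)) lam → c < lam)
    -- kernel and undersmoothing bandwidth (a function of the sample size)
    (K : ℝ → ℝ) (hK : Integrable K) (hK0 : ∀ u, 0 ≤ K u) (hKsymm : ∀ u, K (-u) = K u)
    (hK1 : ∫ u, K u = 1) (hK2 : Integrable fun u => u ^ 2 * K u) (hKm : Measurable K)
    (h : ℕ → ℝ) (hh0 : ∀ n, 0 < h n)
    (hh : h =o[atTop] fun n : ℕ => (n : ℝ) ^ (-(1 / 4) : ℝ))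
    -- `L` folds of `k` units each, the sample size being `n = L * k`
    (fold : ∀ k : ℕ, Fin (L * k) → Fin L)
    (hfold : ∀ k ℓ, (Finset.univ.filter fun i => fold k i = ℓ).card = k)
    -- the first-step estimators, computed without fold `ℓ`
    (e : ∀ (k : ℕ) (ℓ : Fin L), Estimators (Train (fold k) ℓ) N T)
    (hemeas : ∀ k ℓ, (e k ℓ).IsMeasurable)
    (hepoly : ∀ k ℓ, (e k ℓ).IsLocalPolynomial K (h (L * k)) d)
    -- the estimated weights are bounded in probability
    (hebdd : ∀ ℓ g, SupIsBigOpOne P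
      (fun k ω => (e k ℓ).w g (train (fold k) ℓ fun i => S i ω)) (P.map X).support)
    -- consistency and product rate
    (hemΔ : ∀ ℓ, IsLittleOp P
      (fun k ω => eLpNorm ((e k ℓ).mΔ (train (fold k) ℓ fun i => S i ω) - q.mΔ) 2 (P.map X))
      fun _ => 1)
    (heprod : ∀ ℓ g, IsLittleOp P
      (fun k ω => eLpNorm ((e k ℓ).r g (train (fold k) ℓ fun i => S i ω) - q.r g) 2 (P.map X) *
        eLpNorm ((e k ℓ).mΔ (train (fold k) ℓ fun i => S i ω) - q.mΔ) 2 (P.map X))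
      fun k => ((L * k : ℕ) : ℝ) ^ (-(1 / 2) : ℝ))
    -- convergence rates (these contain the consistency of the ratios and of the weights)
    (hem : ∀ ℓ g t, IsLittleOp P
      (fun k ω => eLpNorm ((e k ℓ).m g t (train (fold k) ℓ fun i => S i ω) - q.m g t) 2 (P.map X))
      fun k => ((L * k : ℕ) : ℝ) ^ (-(1 / 4) : ℝ))
    (her : ∀ ℓ g, IsLittleOp P
      (fun k ω => eLpNorm ((e k ℓ).r g (train (fold k) ℓ fun i => S i ω) - q.r g) 2 (P.map X))
      fun k => ((L * k : ℕ) : ℝ) ^ (-(1 / 4) : ℝ))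
    (hew : ∀ ℓ g, IsLittleOp P
      (fun k ω => eLpNorm ((e k ℓ).w g (train (fold k) ℓ fun i => S i ω) - q.w g) 2 (P.map X))
      fun k => ((L * k : ℕ) : ℝ) ^ (-(1 / 4) : ℝ))
    -- Bahadur representations
    (herB : ∀ ℓ g, IsLittleOp P
      (fun k ω => eLpNorm (fun x => (e k ℓ).r g (train (fold k) ℓ fun i => S i ω) x - q.r g x
        - ratioBahadur q fX K (h (L * k)) g (train (fold k) ℓ fun i => S i ω) x) 1 (P.map X))
      fun k => ((L * k : ℕ) : ℝ) ^ (-(1 / 2) : ℝ))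
    (hemB : ∀ ℓ g (t : Fin (T + 1)), IsLittleOp P
      (fun k ω => eLpNorm (fun x => (e k ℓ).m g t.castSucc (train (fold k) ℓ fun i => S i ω) x
        - q.m g t.castSucc x
        - outcomeBahadur q fX K (h (L * k)) g t.castSucc (train (fold k) ℓ fun i => S i ω) x)
        1 (P.map X))
      fun k => ((L * k : ℕ) : ℝ) ^ (-(1 / 2) : ℝ))
    -- the asymptotic variance is finite
    (hV : Integrable (fun ω => q.psiSC (P.real (G ⁻¹' {0})) (att P Y0 Y1 G)
      (observation Y0 Y1 G X ω) ^ 2) P) :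
    TendstoInDistribution
      (fun (k : ℕ) ω => √((L * k : ℕ) : ℝ) *
        (thetaHat (fold k) (e k) (fun i => S i ω) - att P Y0 Y1 G))
      atTop (id : ℝ → ℝ) (fun _ => P)
      (gaussianReal 0 (Real.toNNReal (∫ ω, q.psiSC (P.real (G ⁻¹' {0})) (att P Y0 Y1 G)
        (observation Y0 Y1 G X ω) ^ 2 ∂P))) := by
  have hFp : IsProbabilityMeasure (P.map X) := Measure.isProbabilityMeasure_map hX.aemeasurable
  have hob := measurable_observation hY0 hY1 hG hX
  have hQp : IsProbabilityMeasure (P.map (observation Y0 Y1 G X)) :=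
    Measure.isProbabilityMeasure_map hob.aemeasurable
  obtain ⟨c, hc, hMc⟩ := hM
  obtain ⟨C, hQ⟩ := exists_population hX hY0 hY1 hG hNA hY hcomp hp hm hmΔ.1 hw hoverlap hSC hvar
    hpbdd hwbdd (fun g t => (hmC g t).continuousOn) fun x hx => isUnit_det_gram hc (hMc x hx)
  -- The law of the covariate is a probability measure, so some point is regular with constant `C`.
  have hC : 0 ≤ C := by
    obtain ⟨x, hx⟩ := hQ.regular.exists
    exact hx.nonneg
  have hsupp : (P.map X) (P.map X).supportᶜ = 0 := Measure.measure_compl_support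
  -- Identical distribution yields observations that are measurable only almost everywhere. They are
  -- replaced by measurable versions, and the resulting limit is carried back to the original sample
  -- at the end.
  have hSm := fun i => (hident i).aemeasurable_fst
  have hSS : ∀ᵐ ω ∂P, ∀ i, S i ω = (hSm i).mk (S i) ω :=
    ae_all_iff.2 fun i => (hSm i).ae_eq_mk
  have hd : Design P (P.map (observation Y0 Y1 G X)) (P.map X) (fun i => (hSm i).mk (S i))
      fold fX K h :=
    { measurable := fun i => (hSm i).measurable_mk
      indep := hindep.congr fun i => (hSm i).ae_eq_mk
      law := fun i => by rw [← Measure.map_congr (hSm i).ae_eq_mk, (hident i).map_eq]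
      two_le := hL
      card_fold := hfold
      measurable_density := hfX
      density_nonneg := hfX0
      density := hdens
      compact := hcomp
      map_x := hQ.map_x
      measurable_kernel := hKm
      integrable_kernel := hK
      kernel_nonneg := hK0
      integral_kernel := hK1
      bandwidth_pos := hh0
      bandwidth_tendsto := hh.trans_tendsto
        ((tendsto_rpow_neg_atTop (by norm_num)).comp tendsto_natCast_atTop_atTop) }
  have hf : ∀ ℓ, FirstStep P (P.map X) q (fun i => (hSm i).mk (S i)) fold fX K h ℓ
      fun k => e k ℓ := fun ℓ => by
    refine FirstStep.congr (S := S) ?_ hSS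
    exact
      { measurable := fun k => hemeas k ℓ
        bounded_w := fun g => (hebdd ℓ g).boundedInProb _ hsupp
        error_mΔ := by
          simpa using (hemΔ ℓ).negligible (Eventually.of_forall fun _ => one_pos)
        error_prod := fun g => (heprod ℓ g).negligible_sqrt hL
        error_m := fun g t => (hem ℓ g t).negligible_sqrt_sqrt hL
        error_r := fun g => (her ℓ g).negligible_sqrt_sqrt hL
        error_w := fun g => (hew ℓ g).negligible_sqrt_sqrt hL
        bahadur_r := fun g => (herB ℓ g).negligible_sqrt hL
        bahadur_m := fun g t => (hemB ℓ g t).negligible_sqrt hL }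
  have hπ0 : P.real (G ⁻¹' {0}) ≠ 0 :=
    (measureReal_ne_zero_iff).2 (measure_group_ne_zero hG hX (hp 0) (hoverlap 0))
  have hπ : ∫ o, o.ind 0 ∂(P.map (observation Y0 Y1 G X)) = P.real (G ⁻¹' {0}) := by
    rw [integral_map hob.aemeasurable (measurable_obs_ind 0).aestronglyMeasurable,
      ← integral_indicator_one (hG (measurableSet_singleton 0))]
    refine integral_congr_ae (Eventually.of_forall fun ω => ?_)
    by_cases h0 : G ω = 0
    · rw [Set.indicator_of_mem (show ω ∈ G ⁻¹' {0} from h0)]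
      simp [observation, Obs.ind, h0]
    · rw [Set.indicator_of_notMem (show ω ∉ G ⁻¹' {0} from h0)]
      simp [observation, Obs.ind, h0]
  have hθ := integral_phi_eq_att hX hY0 hY1 hG hNA hp hm hmΔ.1 hoverlap hSC (hvar 0).1 hQ
  have key := tendstoInDistribution_thetaHat hf hd hQ hC hπ0 hπ hθ
  -- Measurability of the influence function is read off its almost sure representation.
  have hψm : AEStronglyMeasurable (fun o => q.psiSC (P.real (G ⁻¹' {0})) (att P Y0 Y1 G) o)
      (P.map (observation Y0 Y1 G X)) :=
    ((((hQ.memLp_phi.sub ((Population.memLp_ind 0).const_mul (att P Y0 Y1 G))).sub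
      (hQ.memLp_adjustment hC)).const_mul (P.real (G ⁻¹' {0}))⁻¹).1).congr
      (EventuallyEq.symm (hQ.psiSC_ae_eq _ _))
  have hV2 : ∫ o, q.psiSC (P.real (G ⁻¹' {0})) (att P Y0 Y1 G) o ^ 2
      ∂(P.map (observation Y0 Y1 G X)) = ∫ ω, q.psiSC (P.real (G ⁻¹' {0})) (att P Y0 Y1 G)
        (observation Y0 Y1 G X ω) ^ 2 ∂P :=
    integral_map hob.aemeasurable (hψm.pow 2)
  rw [hV2] at key
  refine key.congr (fun k => ?_) EventuallyEq.rfl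
  filter_upwards [hSS] with ω hω
  simp only [hω]
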